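/- Let $\mathsf{k}$ be a field, $M$ a lattice (finitely generated free abelian group), $M_{\mathbb R}=M\otimes_{\mathbb Z}\mathbb R$, and let $C\subset M_{\mathbb R}$ be a pointed, full-dimensional rational polyhedral cone, with toric algebra $R=\mathsf{k}[C\cap M]\subset \mathsf{k}[M]$. For $v\in M_{\mathbb R}$ let $A_v$ (the conic module) and $\mathring A_v$ (the open conic module) be the $R$-submodules of the Laurent ring $\mathsf{k}[M]$ spanned by the monomials $x^m$ with $m\in M\cap(C+v)$, respectively with $m\in M$ in the interior of $C+v$. A chamber of constancy is an equivalence class $\Delta\subset M_{\mathbb R}$ of the relation $A_v=A_w$; write $A_\Delta=A_v$ for $v\in\Delta$. Let $\Sigma_1\subset\mathrm{Hom}(M,\mathbb Z)$ be the set of primitive generators of the extremal rays of the dual cone of $C$, and for a chamber $\Delta\ni v$ put $d_n=\lceil\langle v,n\rangle\rceil$ for $n\in\Sigma_1$. The open cells of $\Delta$ are the non-empty sets of the form $$\tau_\Omega=\{x\in M_{\mathbb R} \mid d_n-1<\langle x,n\rangle<d_n \text{ for } n\in\Omega,\ \langle x,n\rangle=d_n \text{ for } n\in\Sigma_1\setminus\Omega\},\qquad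 \Omega\subseteq\Sigma_1 .$$ The codimension of a cell is that of its affine span, and $\mathring A_\tau:=\mathring A_x$ for any $x\in\tau$. Let $\mathbb A$ be a complete sum of conic modules, i.e. a finite direct sum of conic $R$-modules such that every conic $R$-module is isomorphic to one of the summands. For a chamber $\Delta$ let $P_\Delta=\mathrm{Hom}_R(\mathbb A,A_\Delta)$, a right $\mathrm{End}_R(\mathbb A)$-module by precomposition, graded by $M$, and let $S_\Delta$ be its unique graded simple quotient, i.e. the quotient of $P_\Delta$ by its unique maximal proper graded submodule. Then for any two chambers of constancy $\Delta,\Delta'$ and every integer $i\ge 0$, the number of open cells $\tau$ of $\Delta$ of codimension $i$ with $\mathring A_\tau\cong A_{\Delta'}$ as $R$-modules is finite, and $$\dim_{\mathsf{k}}\mathrm{Ext}^i_{\mathrm{End}_R(\mathbb A)}(S_\Delta,S_{\Delta'})=\#\{\tau \text{ a cell of codimension } i \text{ in } \Delta \mid \mathring A_\tau\cong A_{\Delta'}\},$$ where Ext is taken in the category of right $\mathrm{End}_R(\mathbb A)$-modules. -/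

import Mathlib

set_option maxSynthPendingDepth 3

open scoped MulOpposite

noncomputable section

universe u v

namespace Toric

section Geometry

variable {V : Type v} [NormedAddCommGroup V] [NormedSpace ℝ V]

/-- `C` is a pointed full-dimensional rational polyhedral cone in the real vector space `V = M_ℝ`
with lattice `L = M`: the set of non-negative real combinations of finitely many lattice vectors,
containing no line, and spanning `V`. (A `PointedCone` is merely a convex cone containing `0`.) -/
structure IsToricCone (L : Submodule ℤ V) (C : PointedCone ℝ V) : Prop where
  rational_polyhedral : ∃ s : Set V, s.Finite ∧ s ⊆ (L : Set V) ∧ C = PointedCone.hull ℝ s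
  pointed : ∀ x ∈ C, -x ∈ C → x = 0
  full_dimensional : Submodule.span ℝ (C : Set V) = ⊤

/-- The linear functional `n` belongs to the dual lattice `N = Hom(M, ℤ)`. -/
def IsIntegral (L : Submodule ℤ V) (n : Module.Dual ℝ V) : Prop :=
  ∀ m ∈ L, ∃ z : ℤ, n m = z

/-- The dual cone `σ` of `C`. -/
def dualCone (C : PointedCone ℝ V) : Set (Module.Dual ℝ V) :=
  {n | ∀ x ∈ C, 0 ≤ n x}

/-- The set `Σ₁` of primitive inward-pointing normals to the facets of `C`: the non-zero integral
functionals in `σ` that are primitive and span an extremal ray of `σ`. -/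
def primitiveNormals (L : Submodule ℤ V) (C : PointedCone ℝ V) : Set (Module.Dual ℝ V) :=
  {n | n ∈ dualCone C ∧ n ≠ 0 ∧ IsIntegral L n ∧
    (∀ ε : ℝ, 0 < ε → ε < 1 → ¬ IsIntegral L (ε • n)) ∧
    ∀ a ∈ dualCone C, ∀ b ∈ dualCone C, a + b = n → ∃ t : ℝ, 0 ≤ t ∧ a = t • n}

/-- The chamber of constancy containing `v`: all `w` with `(C + w) ∩ M = (C + v) ∩ M`. -/
def chamber (L : Submodule ℤ V) (C : PointedCone ℝ V) (v : V) : Set V :=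
  {w | ∀ m ∈ L, m - w ∈ C ↔ m - v ∈ C}

/-- A subset of `V` is a chamber of constancy. -/
def IsChamber (L : Submodule ℤ V) (C : PointedCone ℝ V) (Δ : Set V) : Prop :=
  ∃ v, Δ = chamber L C v

/-- The set `τ_Ω`, for a set `Ω` of primitive normals, computed with the integers
`d_n = ⌈⟨v, n⟩⌉`. -/
def cellSet (L : Submodule ℤ V) (C : PointedCone ℝ V) (v : V) (Ω : Set (Module.Dual ℝ V)) :
    Set V :=
  {x | (∀ n ∈ Ω, (⌈n v⌉ : ℝ) - 1 < n x ∧ n x < (⌈n v⌉ : ℝ)) ∧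
    ∀ n ∈ primitiveNormals L C, n ∉ Ω → n x = (⌈n v⌉ : ℝ)}

/-- `τ` is one of the (non-empty) open cells of the chamber of constancy `Δ`. -/
def IsCell (L : Submodule ℤ V) (C : PointedCone ℝ V) (Δ τ : Set V) : Prop :=
  τ.Nonempty ∧ ∃ v ∈ Δ, ∃ Ω ⊆ primitiveNormals L C, τ = cellSet L C v Ω

/-- `τ` has codimension `i`: the direction space of its affine span has codimension `i`. -/
def HasCodim (τ : Set V) (i : ℕ) : Prop :=
  Module.finrank ℝ (vectorSpan ℝ τ) + i = Module.finrank ℝ V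

theorem add_mem_interior (C : PointedCone ℝ V) {c x : V} (hc : c ∈ C)
    (hx : x ∈ interior (C : Set V)) : c + x ∈ interior (C : Set V) := by
  have h1 : (fun y => c + y) '' interior (C : Set V) ⊆ (C : Set V) := by
    rintro _ ⟨y, hy, rfl⟩
    exact C.add_mem hc (interior_subset hy)
  have h2 : IsOpen ((fun y => c + y) '' interior (C : Set V)) :=
    (Homeomorph.addLeft c).isOpenMap _ isOpen_interior
  exact interior_maximal h1 h2 ⟨x, hx, rfl⟩

end Geometry

section Algebra

variable (𝕜 : Type u) [Field 𝕜] {V : Type v} [NormedAddCommGroup V] [NormedSpace ℝ V]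
  (L : Submodule ℤ V) (C : PointedCone ℝ V)

/-- The Laurent ring `𝕜[M]`, with basis the monomials `x^m`, `m ∈ M`. -/
abbrev Laurent : Type (max u v) := AddMonoidAlgebra 𝕜 L

/-- The toric algebra `R = 𝕜[C ∩ M]`: the Laurent polynomials all of whose monomials `x^m` have
`m ∈ C`. -/
def toricAlgebra : Subalgebra 𝕜 (Laurent 𝕜 L) where
  carrier := {f | ∀ m ∈ f.coeff.support, (m : V) ∈ C}
  mul_mem' := by
    classical
    intro f g hf hg m hm
    obtain ⟨a, ha, b, hb, rfl⟩ := Finset.mem_add.1 (AddMonoidAlgebra.support_coeff_mul_subset f g hm)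
    exact C.add_mem (hf a ha) (hg b hb)
  add_mem' := by
    classical
    intro f g hf hg m hm
    exact (Finset.mem_union.1 (Finsupp.support_add hm)).elim (hf m) (hg m)
  algebraMap_mem' := by
    intro r m hm
    have h : m = 0 := by
      by_contra h
      simp [AddMonoidAlgebra.coe_algebraMap, h] at hm
    subst h
    exact C.zero_mem

variable {C} in
/-- The `R`-submodule of `𝕜[M]` spanned by the monomials `x^m` with `m ∈ T ∩ M`, where `C + T ⊆ T`. -/
def monomialSubmodule (T : Set V) (hT : ∀ c ∈ C, ∀ x ∈ T, c + x ∈ T) :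
    Submodule (toricAlgebra 𝕜 L C) (Laurent 𝕜 L) where
  carrier := {f | ∀ m ∈ f.coeff.support, (m : V) ∈ T}
  zero_mem' := by
    intro m hm
    simp at hm
  add_mem' := by
    classical
    intro f g hf hg m hm
    exact (Finset.mem_union.1 (Finsupp.support_add hm)).elim (hf m) (hg m)
  smul_mem' := by
    classical
    intro r f hf m hm
    obtain ⟨a, ha, b, hb, rfl⟩ :=
      Finset.mem_add.1 (AddMonoidAlgebra.support_coeff_mul_subset (r : Laurent 𝕜 L) f hm)
    exact hT _ (r.2 a ha) _ (hf b hb)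

/-- The conic module `A_v`, spanned by the monomials `x^m` with `m ∈ M ∩ (C + v)`. -/
def conicModule (v : V) : Submodule (toricAlgebra 𝕜 L C) (Laurent 𝕜 L) :=
  monomialSubmodule 𝕜 L (C := C) {x | x - v ∈ C} fun c hc x hx => by
    simpa [add_sub_assoc] using C.add_mem hc hx

/-- The open conic module `Å_v`, spanned by the monomials `x^m` with `m` in `M` and in the
interior of `C + v`. -/
def openConicModule (v : V) : Submodule (toricAlgebra 𝕜 L C) (Laurent 𝕜 L) :=
  monomialSubmodule 𝕜 L (C := C) {x | x - v ∈ interior (C : Set V)} fun c hc x hx => by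
    simpa [add_sub_assoc] using add_mem_interior C hc hx

instance (v : V) : SMul (toricAlgebra 𝕜 L C) (conicModule 𝕜 L C v) :=
  (conicModule 𝕜 L C v).module.toSMul

instance (v : V) : SMul 𝕜 (conicModule 𝕜 L C v) :=
  (conicModule 𝕜 L C v).module'.toSMul

variable {ι : Type} (w : ι → V)

/-- The direct sum `𝔸` of the finitely many conic modules `A_{w i}`. -/
abbrev conicSum : Type (max u v) := ∀ i, conicModule 𝕜 L C (w i)

instance : SMul (toricAlgebra 𝕜 L C) (conicSum 𝕜 L C w) := Pi.instSMul

instance : SMul 𝕜 (conicSum 𝕜 L C w) := Pi.instSMul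

instance : Module (toricAlgebra 𝕜 L C) (conicSum 𝕜 L C w) := Pi.module _ _ _

instance : Module 𝕜 (conicSum 𝕜 L C w) := Pi.module _ _ _

instance (v : V) : SMulCommClass (toricAlgebra 𝕜 L C) 𝕜 (conicModule 𝕜 L C v) :=
  IsScalarTower.to_smulCommClass'

instance : SMulCommClass (toricAlgebra 𝕜 L C) 𝕜 (conicSum 𝕜 L C w) := Pi.smulCommClass

/-- The direct sum of the conic modules `A_{w i}` is complete: every conic module is isomorphic to
one of the summands. -/
def IsComplete : Prop :=
  ∀ v : V, ∃ i, Nonempty (conicModule 𝕜 L C v ≃ₗ[toricAlgebra 𝕜 L C] conicModule 𝕜 L C (w i))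

/-- The endomorphism ring `End_R(𝔸)`, with composition as multiplication. -/
abbrev conicEnd : Type (max u v) := Module.End (toricAlgebra 𝕜 L C) (conicSum 𝕜 L C w)

/-- The `𝕜`-algebra structure of `End_R(𝔸)`, with `c` acting as multiplication by `c`. -/
instance : Algebra 𝕜 (conicEnd 𝕜 L C w) :=
  Module.End.instAlgebra 𝕜 (toricAlgebra 𝕜 L C) (conicSum 𝕜 L C w)

/-- The right `End_R(𝔸)`-module `P_v = Hom_R(𝔸, A_v)`. -/
def projModule (v : V) : Type (max u v) :=
  conicSum 𝕜 L C w →ₗ[toricAlgebra 𝕜 L C] conicModule 𝕜 L C v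

instance (v : V) : AddCommGroup (projModule 𝕜 L C w v) :=
  inferInstanceAs
    (AddCommGroup (conicSum 𝕜 L C w →ₗ[toricAlgebra 𝕜 L C] conicModule 𝕜 L C v))

/-- Right modules over `End_R(𝔸)` are left modules over the opposite ring; an endomorphism acts on
`P_v` by precomposition. -/
instance (v : V) : Module (conicEnd 𝕜 L C w)ᵐᵒᵖ (projModule 𝕜 L C w v) where
  smul g f := LinearMap.comp f g.unop
  one_smul _ := rfl
  mul_smul _ _ _ := rfl
  smul_zero _ := rfl
  smul_add _ _ _ := rfl
  add_smul g h f := LinearMap.comp_add g.unop h.unop f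
  zero_smul f := LinearMap.comp_zero f

variable {𝕜 L C w} in
/-- The map `f : 𝔸 → A_v` is homogeneous of degree `m` for the `M`-gradings: it sends the degree
`n` part of `𝔸`, consisting of tuples of scalar multiples of `x^n`, to the degree `n + m` part
of `A_v`. -/
def IsHomogeneousOfDegree {v : V} (f : projModule 𝕜 L C w v) (m : L) : Prop :=
  ∀ (n : L) (a : conicSum 𝕜 L C w),
    (∀ i, (a i : Laurent 𝕜 L).coeff.support ⊆ {n}) →
      ((show conicSum 𝕜 L C w →ₗ[toricAlgebra 𝕜 L C] conicModule 𝕜 L C v from f) a :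
        Laurent 𝕜 L).coeff.support ⊆ {n + m}

variable {𝕜 L C w} in
/-- An `End_R(𝔸)`-submodule of `P_v` is graded if each of its elements is a sum of homogeneous
elements belonging to it. -/
def IsGraded {v : V} (N : Submodule (conicEnd 𝕜 L C w)ᵐᵒᵖ (projModule 𝕜 L C w v)) : Prop :=
  ∀ f ∈ N, f ∈ AddSubgroup.closure {g | g ∈ N ∧ ∃ m, IsHomogeneousOfDegree g m}

/-- The unique maximal (proper) graded submodule of `P_v`, obtained as the sum of all proper graded
submodules. -/
def maximalGradedSubmodule (v : V) :
    Submodule (conicEnd 𝕜 L C w)ᵐᵒᵖ (projModule 𝕜 L C w v) :=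
  sSup {N | IsGraded N ∧ N ≠ ⊤}

/-- The unique graded simple quotient `S_v` of `P_v`, as a right `End_R(𝔸)`-module. -/
def simpleModule (v : V) : ModuleCat.{max u v} (conicEnd 𝕜 L C w)ᵐᵒᵖ :=
  ModuleCat.of _ (projModule 𝕜 L C w v ⧸ maximalGradedSubmodule 𝕜 L C w v)

/-- The cells `τ` of codimension `i` of the chamber of constancy `Δ` such that the open conic module
`Å_τ` (that is, `Å_x` for any `x ∈ τ`) is isomorphic to the conic module `A_v`. -/
def cellsOfType (Δ : Set V) (v : V) (i : ℕ) : Set (Set V) :=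
  {τ | IsCell L C Δ τ ∧ HasCodim τ i ∧ ∀ x ∈ τ,
    Nonempty (openConicModule 𝕜 L C x ≃ₗ[toricAlgebra 𝕜 L C] conicModule 𝕜 L C v)}

end Algebra

end Toric

end

/-!
Let `Δ` be the chamber of `v`. The simple module `S_Δ` has a projective resolution whose `k`-th term
is the sum of the `P_{y τ}` over the cells `τ` of `Δ` of codimension `k`, where `y τ` is chosen so
that the open conic module at `τ` is the conic module at `y τ`; its differential is made of
incidence numbers of cells. In a fixed degree `u` this is the complex of the cells of `Δ` visible
from `u`. Moving towards `u` across the facet hyperplanes one at a time shows that it is exact,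
unless `u` is itself a degree of `S_Δ`, in which case its only homology is a copy of the field in
degree `0`. The resolution is minimal: a map between the `P`s that is not an isomorphism dies in
every simple quotient. So `Ext^i` is the space of maps from the `i`-th term to `S_Δ'`, which has one
dimension for each cell of codimension `i` whose open conic module is `A_Δ'` up to isomorphism.
-/

noncomputable section

universe u v

namespace Toric

/-! ### Hyperplanes in general position -/

section GenericVectors

variable {K V : Type*} [Field K] [AddCommGroup V] [Module K V]

theorem sup_span_singleton_eq_of_finrank_eq_add_one [FiniteDimensional K V] {A B : Submodule K V}
    {y : V} (hAB : A ≤ B) (hyB : y ∈ B) (hyA : y ∉ A)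
    (hr : Module.finrank K B = Module.finrank K A + 1) : A ⊔ K ∙ y = B := by
  have hle : A ⊔ K ∙ y ≤ B := sup_le hAB ((Submodule.span_singleton_le_iff_mem y B).2 hyB)
  have hlt : A < A ⊔ K ∙ y := left_lt_sup.2 fun h =>
    hyA ((Submodule.span_singleton_le_iff_mem y A).1 h)
  exact Submodule.eq_of_le_of_finrank_le hle (hr.trans_le (Submodule.finrank_lt_finrank_of_lt hlt))

theorem exists_normal_of_generic {N : Submodule K (Module.Dual K V)} {g : ℕ → V} {r : ℕ}
    (hr : Module.finrank K N = r + 1)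
    (hg : ∀ y ∈ N, (∀ j < r + 1, y (g j) = 0) → y = 0) :
    ∃ y ∈ N, (∀ j < r, y (g j) = 0) ∧ y (g r) = 1 := by
  have := Module.finite_of_finrank_pos (R := K) (M := N) (by lia)
  let F : N →ₗ[K] Fin r → K := LinearMap.pi fun j =>
    (Module.Dual.eval K V (g j)).comp N.subtype
  obtain ⟨⟨y, hyN⟩, hyF, hy⟩ := Submodule.exists_mem_ne_zero_of_ne_bot
    (LinearMap.ker_ne_bot_of_finrank_lt (f := F) (by simp [hr]))
  have hy0 (j : ℕ) (hj : j < r) : y (g j) = 0 := congrFun hyF ⟨j, hj⟩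
  have hyr : y (g r) ≠ 0 := fun h => hy (Subtype.ext (hg y hyN fun j hj =>
    (Nat.lt_succ_iff_lt_or_eq.1 hj).elim (hy0 j) fun hj' => hj' ▸ h))
  refine ⟨(y (g r))⁻¹ • y, N.smul_mem _ hyN, fun j hj => ?_, ?_⟩
  · rw [LinearMap.smul_apply, hy0 j hj, smul_zero]
  · rw [LinearMap.smul_apply, smul_eq_mul, inv_mul_cancel₀ hyr]

theorem exists_apply_ne_zero_of_notMem [FiniteDimensional K V]
    {N : Submodule K (Module.Dual K V)}
    {y : Module.Dual K V} (hy : y ∉ N) : ∃ x, (∀ z ∈ N, z x = 0) ∧ y x ≠ 0 := by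
  rw [← Subspace.dualCoannihilator_dualAnnihilator_eq (W := N),
    Submodule.mem_dualAnnihilator] at hy
  push Not at hy
  simpa only [Submodule.mem_dualCoannihilator] using hy

variable [Infinite K] {κ : Type*} [Finite κ]

theorem exists_generic_vector (N : κ → Submodule K (Module.Dual K V)) :
    ∃ x, ∀ i, N i ≠ ⊥ → ∃ y ∈ N i, y x ≠ 0 := by
  have h (i : {i // N i ≠ ⊥}) : ∃ y ∈ N i, y ≠ 0 := (Submodule.ne_bot_iff _).1 i.2
  choose y hyN hy using h
  obtain ⟨x, hx⟩ := Module.Dual.exists_forall_ne_zero_of_forall_exists y fun i => by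
    simpa using DFunLike.ne_iff.1 (hy i)
  exact ⟨x, fun i hi => ⟨y ⟨i, hi⟩, hyN ⟨i, hi⟩, hx ⟨i, hi⟩⟩⟩

theorem exists_generic_flag [FiniteDimensional K V] (N : κ → Submodule K (Module.Dual K V)) :
    ∃ g : ℕ → V, ∀ i, ∀ y ∈ N i, (∀ j < Module.finrank K (N i), y (g j) = 0) → y = 0 := by
  obtain ⟨r, hr⟩ : ∃ r, ∀ i, Module.finrank K (N i) ≤ r :=
    ⟨Module.finrank K (Module.Dual K V), fun i => Submodule.finrank_le _⟩
  induction r generalizing N with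
  | zero =>
    refine ⟨0, fun i y hy _ => ?_⟩
    rwa [Submodule.finrank_eq_zero.1 (Nat.le_zero.1 (hr i)), Submodule.mem_bot] at hy
  | succ r ih =>
    obtain ⟨x, hx⟩ := exists_generic_vector N
    have hlt (i : κ) (hi : N i ≠ ⊥) :
        N i ⊓ LinearMap.ker (Module.Dual.eval K V x) < N i := by
      obtain ⟨y, hy, hyx⟩ := hx i hi
      exact inf_lt_left.2 fun h => hyx (h hy)
    obtain ⟨g, hg⟩ := ih (fun i => N i ⊓ LinearMap.ker (Module.Dual.eval K V x)) fun i => by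
      rcases eq_or_ne (N i) ⊥ with hi | hi
      · exact (Submodule.finrank_mono inf_le_left).trans (by rw [hi, finrank_bot]; lia)
      · exact Nat.lt_succ_iff.1 ((Submodule.finrank_lt_finrank_of_lt (hlt i hi)).trans_le (hr i))
    refine ⟨fun j => j.casesOn x g, fun i y hy hy0 => ?_⟩
    by_cases hi : N i = ⊥
    · rwa [hi, Submodule.mem_bot] at hy
    have hrank := Submodule.finrank_lt_finrank_of_lt (hlt i hi)
    exact hg i y ⟨hy, hy0 0 (Nat.zero_lt_of_lt hrank)⟩ fun j hj => hy0 (j + 1) (by lia)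

end GenericVectors

theorem exists_forall_apply_ne_zero {K V κ : Type*} [Field K] [Infinite K] [AddCommGroup V]
    [Module K V] [FiniteDimensional K V] [Finite κ] (N : Submodule K (Module.Dual K V))
    (y : κ → Module.Dual K V) :
    ∃ w, (∀ z ∈ N, z w = 0) ∧ ∀ i, y i ∉ N → y i w ≠ 0 := by
  obtain ⟨w, hw⟩ := Module.Dual.exists_forall_ne_zero_of_forall_exists
    (fun i : {i // y i ∉ N} => (y i).domRestrict N.dualCoannihilator) fun i => by
      obtain ⟨x, hxN, hx⟩ := exists_apply_ne_zero_of_notMem i.2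
      exact ⟨⟨x, (Submodule.mem_dualCoannihilator _).2 hxN⟩, hx⟩
  exact ⟨w, (Submodule.mem_dualCoannihilator _).1 w.2, fun i hi => hw ⟨i, hi⟩⟩

section ExactOn

open scoped Matrix

variable {κ R : Type*} [Fintype κ] [CommRing R]

/-- Exactness of the operator `· ᵥ* M`, restricted and corestricted to vectors supported in `X`. -/
def ExactOn (M : Matrix κ κ R) (X : Set κ) : Prop :=
  ∀ c : κ → R, Function.support c ⊆ X → (∀ j ∈ X, (c ᵥ* M) j = 0) →
    ∃ b : κ → R, Function.support b ⊆ X ∧ ∀ j ∈ X, (b ᵥ* M) j = c j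

theorem vecMul_eq_zero_of_support [LE κ] {M : Matrix κ κ R} (hle : ∀ i j, M i j ≠ 0 → j ≤ i)
    {Y W : Set κ} (hsep : ∀ i ∈ Y, ∀ j ∈ W, ¬ j ≤ i) {c : κ → R} (hc : Function.support c ⊆ Y) :
    ∀ j ∈ W, (c ᵥ* M) j = 0 := fun j hj =>
  Finset.sum_eq_zero fun i _ => by_contra fun h =>
    hsep i (hc (left_ne_zero_of_mul h)) j hj (hle i j (right_ne_zero_of_mul h))

theorem indicator_vecMul_vecMul_eq_zero [Preorder κ] {M : Matrix κ κ R}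
    (hle : ∀ i j, M i j ≠ 0 → j ≤ i) (hM : M * M = 0) {Y W : Set κ}
    (hYW : (Y ∪ W).OrdConnected) {b : κ → R}
    (hb : Function.support b ⊆ W) :
    ∀ j ∈ Y, ((Y ∪ W).indicator (b ᵥ* M) ᵥ* M) j = 0 := by
  intro j hj
  trans ((b ᵥ* M) ᵥ* M) j
  · refine Finset.sum_congr rfl fun i _ => ?_
    by_cases hi : i ∈ Y ∪ W
    · rw [Set.indicator_of_mem hi]
    rw [Set.indicator_of_notMem hi, zero_mul, eq_comm]
    refine by_contra fun h => hi ?_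
    obtain ⟨k, -, hk⟩ := Finset.exists_ne_zero_of_sum_ne_zero (left_ne_zero_of_mul h)
    exact hYW.out (.inl hj) (.inr (hb (left_ne_zero_of_mul hk)))
      ⟨hle i j (right_ne_zero_of_mul h), hle k i (right_ne_zero_of_mul hk)⟩
  · rw [Matrix.vecMul_vecMul, hM, Matrix.vecMul_zero, Pi.zero_apply]

theorem ExactOn.union [Preorder κ] {M : Matrix κ κ R} (hle : ∀ i j, M i j ≠ 0 → j ≤ i)
    (hM : M * M = 0) {Y W : Set κ} (hYW : (Y ∪ W).OrdConnected)
    (hsep : ∀ i ∈ Y, ∀ j ∈ W, ¬ j ≤ i) (hY : ExactOn M Y) (hW : ExactOn M W) :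
    ExactOn M (Y ∪ W) := by
  classical
  intro c hc hcM
  obtain ⟨b, hb, hbc⟩ := hW (W.indicator c) Set.support_indicator_subset fun j hj => by
    have hdiff : Function.support (c - W.indicator c) ⊆ Y := by
      intro i hi
      have hiW : i ∉ W := fun h => hi (by simp [h])
      exact (hc (by simpa [hiW] using hi)).resolve_right hiW
    have := vecMul_eq_zero_of_support hle hsep hdiff j hj
    rwa [Matrix.sub_vecMul, Pi.sub_apply, hcM j (.inr hj), zero_sub, neg_eq_zero] at this
  have hbM := indicator_vecMul_vecMul_eq_zero hle hM hYW hb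
  have hsupport : Function.support (c - (Y ∪ W).indicator (b ᵥ* M)) ⊆ Y := by
    intro i hi
    by_contra hiY
    refine hi ?_
    by_cases hiW : i ∈ W
    · simp [hiW, hbc i hiW]
    · have hiYW : i ∉ Y ∪ W := not_or.2 ⟨hiY, hiW⟩
      rw [Pi.sub_apply, Set.indicator_of_notMem hiYW, sub_zero]
      exact Function.notMem_support.1 fun h => hiYW (hc h)
  obtain ⟨a, ha, hac⟩ := hY _ hsupport fun j hj => by
    rw [Matrix.sub_vecMul, Pi.sub_apply, hcM j (.inl hj), hbM j hj, sub_zero]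
  refine ⟨a + b, fun i hi => (Function.support_add a b hi).imp (@ha i) (@hb i), fun j hj => ?_⟩
  rw [Matrix.add_vecMul, Pi.add_apply]
  by_cases hjW : j ∈ W
  · rw [vecMul_eq_zero_of_support hle hsep ha j hjW, hbc j hjW, zero_add,
      Set.indicator_of_mem hjW]
  · rw [hac j (hj.resolve_right hjW), Pi.sub_apply, Set.indicator_of_mem hj, sub_add_cancel]

theorem ExactOn.of_pair {M : Matrix κ κ R} {i j : κ} (hi : M i i = 0) (hj : M j j = 0)
    (hij : IsUnit (M i j)) : ExactOn M {j, i} := by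
  classical
  obtain ⟨s, hs⟩ := hij.exists_left_inv
  intro c hc hcM
  have hci : c i = 0 := by
    have h : (c ᵥ* M) j = c i * M i j := Finset.sum_eq_single i (fun k _ hki => by
      by_cases hkj : k = j
      · subst hkj
        exact mul_eq_zero_of_right _ hj
      · rw [Function.notMem_support.1 fun h => (hc h).elim hkj hki, zero_mul]) (by simp)
    rwa [hcM j (.inl rfl), eq_comm, hij.mul_left_eq_zero] at h
  refine ⟨Pi.single i (c j * s), Pi.support_single_subset.trans (by simp), ?_⟩
  rintro k (rfl | rfl)
  · rw [Matrix.single_vecMul, Pi.smul_apply, Matrix.row_apply, smul_eq_mul, mul_assoc, hs, mul_one]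
  · rw [Matrix.single_vecMul, Pi.smul_apply, Matrix.row_apply, smul_eq_mul, hi, mul_zero, hci]

end ExactOn

theorem exists_first_zero {κ : Type*} {S : Set κ} (hS : S.Finite) {a b : κ → ℝ}
    (ha : ∀ n ∈ S, a n < 0) (hb : ∃ n ∈ S, 0 < b n) :
    ∃ t > 0, IsGreatest ((fun n => a n + t * b n) '' S) 0 := by
  obtain ⟨n, ⟨hn, hbn⟩, hmin⟩ := (hS.subset (S.sep_subset (0 < b ·))).exists_minimalFor
    (fun n => -a n / b n) _ hb
  have hmin : ∀ m ∈ S, 0 < b m → -a n / b n ≤ -a m / b m := fun m hm hbm =>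
    (le_total _ _).elim id (hmin ⟨hm, hbm⟩)
  have ht : 0 < -a n / b n := div_pos (neg_pos.2 (ha n hn)) hbn
  refine ⟨-a n / b n, ht, ⟨n, hn, ?_⟩, ?_⟩
  · change a n + -a n / b n * b n = 0
    rw [div_mul_cancel₀ _ hbn.ne', add_neg_cancel]
  · rintro _ ⟨m, hm, rfl⟩
    change a m + -a n / b n * b m ≤ 0
    rcases lt_or_ge 0 (b m) with hbm | hbm
    · linarith [(le_div_iff₀ hbm).1 (hmin m hm hbm)]
    · nlinarith [ha m hm]

theorem eq_of_isGreatest_zero {κ : Type*} {S : Set κ} {a b : κ → ℝ} (ha : ∀ n ∈ S, a n < 0)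
    {s t : ℝ} (hs : 0 ≤ s) (ht : 0 ≤ t) (hS : IsGreatest ((fun n => a n + s * b n) '' S) 0)
    (hT : IsGreatest ((fun n => a n + t * b n) '' S) 0) : s = t := by
  wlog hst : s ≤ t generalizing s t
  · exact (this ht hs hT hS (le_of_not_ge hst)).symm
  obtain ⟨n, hn, (h : a n + s * b n = 0)⟩ := hS.1
  have hle : a n + t * b n ≤ 0 := hT.2 ⟨n, hn, rfl⟩
  nlinarith [ha n hn, h]

theorem exists_isGreatest_zero_iff {κ : Type*} {S : Set κ} (hS : S.Finite) {a b : κ → ℝ}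
    (ha : ∀ n ∈ S, a n < 0) (hpos : ∃ n ∈ S, 0 < b n) (hneg : ∃ n ∈ S, b n < 0) :
    ∃ t₁ > 0, ∃ t₂ < 0, ∀ t,
      IsGreatest ((fun n => a n + t * b n) '' S) 0 ↔ t = t₁ ∨ t = t₂ := by
  obtain ⟨t₁, ht₁, h₁⟩ := exists_first_zero hS ha hpos
  obtain ⟨t₂, ht₂, h₂⟩ := exists_first_zero hS (b := -b) ha (by simpa using hneg)
  have hneg (t : ℝ) : (fun n => a n + -t * b n) = fun n => a n + t * (-b) n := by
    funext n
    simp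
  refine ⟨t₁, ht₁, -t₂, neg_lt_zero.2 ht₂, fun t => ⟨fun h => ?_, ?_⟩⟩
  · rcases le_total 0 t with ht | ht
    · exact Or.inl (eq_of_isGreatest_zero ha ht ht₁.le h h₁)
    · rw [← neg_neg t, hneg] at h
      exact Or.inr (neg_eq_iff_eq_neg.1
        (eq_of_isGreatest_zero ha (neg_nonneg.2 ht) ht₂.le h h₂))
  · rintro (rfl | rfl)
    · exact h₁
    · rwa [hneg]

theorem exists_complementary_direction {K V : Type*} [Field K] [AddCommGroup V] [Module K V]
    [FiniteDimensional K V] {A B : Submodule K (Module.Dual K V)} (hAB : A ≤ B)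
    (hr : Module.finrank K B = Module.finrank K A + 2) {s : Module.Dual K V} (hs : s ∈ B) {w : V}
    (hw : ∀ y ∈ A, y w = 0) (hsw : s w ≠ 0) :
    ∃ w', (∀ y ∈ A, y w' = 0) ∧ s w' = 0 ∧ (∃ y ∈ B, y w' ≠ 0) ∧
      ∀ x, (∀ y ∈ A, y x = 0) → ∃ b, ∀ y ∈ B, y x = s x / s w * y w + b * y w' := by
  have hsA : s ∉ A := fun h => hsw (hw s h)
  have hrs : Module.finrank K ↥(A ⊔ K ∙ s) = Module.finrank K A + 1 :=
    Submodule.finrank_sup_span_singleton hsA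
  have hle : A ⊔ K ∙ s ≤ B := sup_le hAB ((Submodule.span_singleton_le_iff_mem s B).2 hs)
  obtain ⟨r, hrB, hr'⟩ : ∃ r ∈ B, r ∉ A ⊔ K ∙ s := by
    by_contra! h
    have := Submodule.finrank_mono h
    lia
  obtain ⟨w', hw', hrw⟩ := exists_apply_ne_zero_of_notMem hr'
  have hAw' : ∀ y ∈ A, y w' = 0 := fun y hy => hw' y (Submodule.mem_sup_left hy)
  have hsw' : s w' = 0 := hw' s (Submodule.mem_sup_right (Submodule.mem_span_singleton_self s))
  refine ⟨w', hAw', hsw', ⟨r, hrB, hrw⟩, fun x hx => ?_⟩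
  have hB : (A ⊔ K ∙ s) ⊔ K ∙ r = B :=
    sup_span_singleton_eq_of_finrank_eq_add_one hle hrB hr' (by rw [hr, hrs])
  refine ⟨(r x - s x / s w * r w) / r w', fun y hy => ?_⟩
  simp only [← hB, Submodule.mem_sup, Submodule.mem_span_singleton] at hy
  obtain ⟨_, ⟨a, ha, _, ⟨c, rfl⟩, rfl⟩, _, ⟨d, rfl⟩, rfl⟩ := hy
  simp only [LinearMap.add_apply, LinearMap.smul_apply, smul_eq_mul, hx a ha, hw a ha, hAw' a ha,
    hsw']
  field_simp
  ring

/-! ### Faces and visibility -/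

/-- The part of an open convex `domain` cut out by the closed half-spaces `form n ≤ bound n`. Its
faces are recorded only where they meet the domain. -/
structure RelPolyhedron (V ν : Type*) [AddCommGroup V] [Module ℝ V] [TopologicalSpace V] where
  domain : Set V
  isOpen_domain : IsOpen domain
  convex_domain : Convex ℝ domain
  form : ν → Module.Dual ℝ V
  bound : ν → ℝ

namespace RelPolyhedron

open Filter Topology

variable {V ν : Type*} [NormedAddCommGroup V] [NormedSpace ℝ V] (P : RelPolyhedron V ν)

/-- The indices of the half-spaces having `x` on their boundary. -/
def active (x : V) : Set ν := {n | P.form n x = P.bound n}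

/-- The indices of the half-spaces that do not contain `x`. -/
def violated (x : V) : Set ν := {n | P.bound n < P.form n x}

/-- The points of the polyhedron. -/
def carrier : Set V := {x ∈ P.domain | P.violated x = ∅}

/-- The functionals that are constant on the points at which the half-spaces of `I` are active. -/
def conormal (I : Set ν) : Submodule ℝ (Module.Dual ℝ V) := Submodule.span ℝ (Set.image P.form I)

/-- The codimension of the affine subspace on which the half-spaces of `I` are active. -/
def codim (I : Set ν) : ℕ := Module.finrank ℝ (P.conormal I)

/-- The non-empty open faces, given by their active sets. The order is reversed: a larger active
set is a smaller face. -/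
abbrev Face : Type _ := {I : Set ν // ∃ x ∈ P.carrier, P.active x = I}

variable {P}

theorem mem_carrier_iff {x : V} :
    x ∈ P.carrier ↔ x ∈ P.domain ∧ ∀ n, P.form n x ≤ P.bound n := by
  simp [carrier, violated, Set.eq_empty_iff_forall_notMem]

theorem form_mem_conormal {I : Set ν} {n : ν} (hn : n ∈ I) : P.form n ∈ P.conormal I :=
  Submodule.subset_span ⟨n, hn, rfl⟩

theorem conormal_mono {I J : Set ν} (h : I ⊆ J) : P.conormal I ≤ P.conormal J :=
  Submodule.span_mono (Set.image_mono h)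

theorem conormal_apply_eq_zero {I : Set ν} {x : V} (h : ∀ n ∈ I, P.form n x = 0) :
    ∀ y ∈ P.conormal I, y x = 0 := by
  have hle : P.conormal I ≤ LinearMap.ker (Module.Dual.eval ℝ V x) := by
    rw [conormal, Submodule.span_le, Set.image_subset_iff]
    exact h
  exact fun y hy => hle hy

theorem codim_empty : P.codim ∅ = 0 := by
  rw [codim, conormal, Set.image_empty, Submodule.span_empty, finrank_bot]

theorem eventually_add_smul [Finite ν] {x : V} (hx : x ∈ P.domain) (w : V) :
    ∀ᶠ δ : ℝ in 𝓝[>] 0, x + δ • w ∈ P.domain ∧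
      P.active (x + δ • w) = {n ∈ P.active x | P.form n w = 0} ∧
      P.violated (x + δ • w) = P.violated x ∪ {n ∈ P.active x | 0 < P.form n w} := by
  have hdomain : ∀ᶠ δ : ℝ in 𝓝[>] 0, x + δ • w ∈ P.domain := by
    refine nhdsWithin_le_nhds (ContinuousAt.eventually_mem (by fun_prop)
      (P.isOpen_domain.mem_nhds ?_))
    simpa using hx
  have hlt : ∀ᶠ δ : ℝ in 𝓝[>] 0, ∀ n,
      (P.form n x < P.bound n → P.form n x + δ * P.form n w < P.bound n) ∧
      (P.bound n < P.form n x → P.bound n < P.form n x + δ * P.form n w) := by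
    refine eventually_all.2 fun n => (eventually_imp_distrib_left.2 fun h => ?_).and
      (eventually_imp_distrib_left.2 fun h => ?_) <;> refine nhdsWithin_le_nhds ?_
    · exact ContinuousAt.eventually_lt (by fun_prop) continuousAt_const (by simpa using h)
    · exact ContinuousAt.eventually_lt continuousAt_const (by fun_prop) (by simpa using h)
  filter_upwards [hdomain, hlt, self_mem_nhdsWithin] with δ hδ hlt (hpos : 0 < δ)
  refine ⟨hδ, Set.ext fun n => ?_, Set.ext fun n => ?_⟩ <;>
    simp only [active, violated, Set.mem_ofPred_eq, Set.mem_union, map_add, map_smul, smul_eq_mul]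
  all_goals
    rcases lt_trichotomy (P.form n x) (P.bound n) with h | h | h
    · have := (hlt n).1 h
      grind
    · have := mul_pos_iff_of_pos_left (b := P.form n w) hpos
      have := mul_eq_zero (a := δ) (b := P.form n w)
      grind
    · have := (hlt n).2 h
      grind

namespace Face

/-- A chosen point of the open face `I`. -/
def point (I : P.Face) : V := I.2.choose

theorem point_mem (I : P.Face) : I.point ∈ P.carrier := I.2.choose_spec.1

theorem active_point (I : P.Face) : P.active I.point = I := I.2.choose_spec.2

theorem form_point_eq (I : P.Face) {n : ν} (hn : n ∈ I.1) : P.form n I.point = P.bound n := by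
  rwa [← I.active_point] at hn

theorem form_point_lt (I : P.Face) {n : ν} (hn : n ∉ I.1) : P.form n I.point < P.bound n :=
  ((mem_carrier_iff.1 I.point_mem).2 n).lt_of_ne fun h => hn (I.active_point ▸ h)

theorem form_sub_point_eq_zero {I K : P.Face} (hKI : K ≤ I) {n : ν} (hn : n ∈ K.1) :
    P.form n (K.point - I.point) = 0 := by
  rw [map_sub, K.form_point_eq hn, I.form_point_eq (hKI hn), sub_self]

theorem form_sub_point_neg {I K : P.Face} {n : ν} (hn : n ∈ I.1) (hnK : n ∉ K.1) :
    P.form n (K.point - I.point) < 0 := by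
  rw [map_sub, I.form_point_eq hn]
  exact sub_neg_of_lt (K.form_point_lt hnK)

theorem conormal_sub_point_eq_zero {I K : P.Face} (hKI : K ≤ I) :
    ∀ y ∈ P.conormal K, y (K.point - I.point) = 0 :=
  conormal_apply_eq_zero fun _ => form_sub_point_eq_zero hKI

theorem form_notMem_conormal {I K : P.Face} (hKI : K ≤ I) {n : ν} (hn : n ∈ I.1)
    (hnK : n ∉ K.1) : P.form n ∉ P.conormal K := fun h =>
  (form_sub_point_neg hn hnK).ne (conormal_sub_point_eq_zero hKI _ h)

theorem codim_strictMono [FiniteDimensional ℝ V] : StrictMono fun I : P.Face => P.codim I := by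
  intro K I hKI
  obtain ⟨n, hn, hnK⟩ := Set.exists_of_ssubset hKI
  refine Submodule.finrank_lt_finrank_of_lt ((conormal_mono hKI.le).lt_of_not_ge fun h => ?_)
  exact form_notMem_conormal hKI.le hn hnK (h (form_mem_conormal hn))

theorem exists_of_direction [Finite ν] (I : P.Face) {u : V} (hu : ∀ n ∈ I.1, P.form n u ≤ 0) :
    ∃ K : P.Face, K.1 = {n ∈ I.1 | P.form n u = 0} := by
  obtain ⟨δ, hdomain, hactive, hviolated⟩ := (eventually_add_smul I.point_mem.1 u).exists
  rw [active_point] at hactive hviolated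
  refine ⟨⟨_, _, ⟨hdomain, ?_⟩, hactive⟩, rfl⟩
  rw [hviolated, I.point_mem.2, Set.empty_union, Set.eq_empty_iff_forall_notMem]
  exact fun n hn => hn.2.not_ge (hu n hn.1)

/-- From the points of the face `I`, the face `K` lies in the direction `u`, up to vectors along
`I`. -/
def InDirection (I K : P.Face) (u : V) : Prop :=
  ∃ r > 0, ∀ y ∈ P.conormal I, y (K.point - I.point) = r * y u

theorem InDirection.form_nonpos {I K : P.Face} {u : V} (h : InDirection I K u) {n : ν}
    (hn : n ∈ I.1) : P.form n u ≤ 0 := by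
  obtain ⟨r, hr, hu⟩ := h
  refine nonpos_of_mul_nonpos_right ?_ hr
  rw [← hu _ (form_mem_conormal hn), map_sub, I.form_point_eq hn, sub_nonpos]
  exact (mem_carrier_iff.1 K.point_mem).2 n

theorem InDirection.eq_setOf {I K : P.Face} {u : V} (h : InDirection I K u) (hKI : K ≤ I) :
    K.1 = {n ∈ I.1 | P.form n u = 0} := by
  obtain ⟨r, hr, hu⟩ := h
  ext n
  refine ⟨fun hn => ⟨hKI hn, ?_⟩, fun ⟨hn, hn0⟩ => ?_⟩
  · have h := hu _ (form_mem_conormal (hKI hn))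
    rw [form_sub_point_eq_zero hKI hn, eq_comm, mul_eq_zero] at h
    exact h.resolve_left hr.ne'
  · by_contra hnK
    have h := hu _ (form_mem_conormal hn)
    rw [hn0, mul_zero] at h
    exact (form_sub_point_neg hn hnK).ne h

theorem exists_between_of_direction [Finite ν] {I J : P.Face} (hJI : J ≤ I) {u : V}
    (hu : ∀ n ∈ I.1, P.form n u ≤ 0) (hJu : ∀ n ∈ J.1, P.form n u = 0)
    (hzero : ∃ n ∈ I.1 \ J.1, P.form n u = 0) (hneg : ∃ n ∈ I.1, P.form n u ≠ 0) :
    ∃ K : P.Face, J < K ∧ K < I ∧ K.1 = {n ∈ I.1 | P.form n u = 0} := by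
  obtain ⟨n, hn, hnu⟩ := hzero
  obtain ⟨m, hm, hmu⟩ := hneg
  obtain ⟨K, hK⟩ := I.exists_of_direction hu
  have hJK : J.1 ⊆ K.1 := hK ▸ fun k hk => ⟨hJI hk, hJu k hk⟩
  have hKI : K.1 ⊆ I.1 := hK ▸ Set.sep_subset _ _
  refine ⟨K, lt_of_le_not_ge hJK fun h => hn.2 (h ?_), lt_of_le_not_ge hKI fun h => hmu ?_, hK⟩
  · rw [hK]
    exact ⟨hn.1, hnu⟩
  · have hmK : m ∈ K.1 := h hm
    rw [hK] at hmK
    exact hmK.2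

/-- The directions `J.point - I.point + t • w'`, in which the faces between `I` and `J` are sought
when `J` has codimension two in the link of `I`. -/
def pencil (I J : P.Face) (w' : V) (t : ℝ) : V := J.point - I.point + t • w'

theorem apply_pencil (I J : P.Face) (w' : V) (t : ℝ) (y : Module.Dual ℝ V) :
    y (pencil I J w' t) = y (J.point - I.point) + t * y w' := by
  rw [pencil, map_add, map_smul, smul_eq_mul]

theorem pencil_slope_unique {I J : P.Face} {w' : V} {s t : ℝ} {n : ν} (hn : n ∈ I.1 \ J.1)
    (hs : P.form n (pencil I J w' s) = 0) (ht : P.form n (pencil I J w' t) = 0) : s = t := by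
  rw [apply_pencil] at hs ht
  have hw' : P.form n w' ≠ 0 := fun h => (form_sub_point_neg hn.1 hn.2).ne (by simpa [h] using hs)
  exact mul_right_cancel₀ hw' (add_left_cancel (hs.trans ht.symm))

/-- The directions `pencil I J w' t` are transverse to the direction of `J` and contain those of
all faces between `J` and `I`. -/
structure IsPencil (I J : P.Face) (w' : V) : Prop where
  form_eq_zero : ∀ n ∈ J.1, P.form n w' = 0
  exists_form_pos : ∃ n ∈ I.1 \ J.1, 0 < P.form n w'
  exists_form_neg : ∃ n ∈ I.1 \ J.1, P.form n w' < 0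
  exists_inDirection : ∀ K : P.Face, J ≤ K → K < I → ∃ t, InDirection I K (pencil I J w' t)

section IsPencil

variable {I J : P.Face} {w' : V} (h : IsPencil I J w')
include h

theorem IsPencil.form_pencil_eq_zero (hJI : J ≤ I) (t : ℝ) {n : ν} (hn : n ∈ J.1) :
    P.form n (pencil I J w' t) = 0 := by
  rw [apply_pencil, h.form_eq_zero n hn, form_sub_point_eq_zero hJI hn, mul_zero, add_zero]

theorem IsPencil.exists_form_pencil_ne_zero (t : ℝ) :
    ∃ n ∈ I.1, P.form n (pencil I J w' t) ≠ 0 := by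
  by_contra! h0
  obtain ⟨k, hk, hkpos⟩ := h.exists_form_pos
  obtain ⟨l, hl, hlneg⟩ := h.exists_form_neg
  have hk0 := h0 k hk.1
  have hl0 := h0 l hl.1
  rw [apply_pencil] at hk0 hl0
  nlinarith [form_sub_point_neg hk.1 hk.2, form_sub_point_neg hl.1 hl.2]

theorem IsPencil.exists_isGreatest_and_inDirection {K : P.Face} (hJK : J < K) (hKI : K < I) :
    ∃ t, IsGreatest ((fun n => P.form n (pencil I J w' t)) '' (I.1 \ J.1)) 0 ∧
      InDirection I K (pencil I J w' t) := by
  obtain ⟨t, hK⟩ := h.exists_inDirection K hJK.le hKI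
  obtain ⟨n, hnK, hnJ⟩ := Set.exists_of_ssubset hJK
  have hn := hK.eq_setOf hKI.le ▸ hnK
  refine ⟨t, ⟨⟨n, ⟨hn.1, hnJ⟩, hn.2⟩, ?_⟩, hK⟩
  rintro _ ⟨m, hm, rfl⟩
  exact hK.form_nonpos hm.1

theorem IsPencil.exists_between_of_isGreatest [Finite ν] (hJI : J ≤ I) {t : ℝ}
    (ht : IsGreatest ((fun n => P.form n (pencil I J w' t)) '' (I.1 \ J.1)) 0) :
    ∃ K : P.Face, J < K ∧ K < I ∧ InDirection I K (pencil I J w' t) := by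
  obtain ⟨⟨n, hn, hn0⟩, hle⟩ := ht
  have hnonpos (m : ν) (hm : m ∈ I.1) : P.form m (pencil I J w' t) ≤ 0 := by
    by_cases hmJ : m ∈ J.1
    · exact (h.form_pencil_eq_zero hJI t hmJ).le
    · exact hle ⟨m, ⟨hm, hmJ⟩, rfl⟩
  obtain ⟨K, hJK, hKI, hK⟩ := exists_between_of_direction hJI hnonpos
    (fun m => h.form_pencil_eq_zero hJI t) ⟨n, hn, hn0⟩ (h.exists_form_pencil_ne_zero t)
  obtain ⟨t', hK'⟩ := h.exists_inDirection K hJK.le hKI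
  have hnK : n ∈ K.1 := hK ▸ ⟨hn.1, hn0⟩
  rw [hK'.eq_setOf hKI.le] at hnK
  exact ⟨K, hJK, hKI, pencil_slope_unique hn hn0 hnK.2 ▸ hK'⟩

theorem IsPencil.exists_inDirection_pair [Finite ν] (hJI : J ≤ I) :
    ∃ t₁ > (0 : ℝ), ∃ t₂ < (0 : ℝ), ∃ K₁ K₂ : P.Face, K₁ ≠ K₂ ∧
      InDirection I K₁ (pencil I J w' t₁) ∧ InDirection I K₂ (pencil I J w' t₂) ∧
      ∀ K : P.Face, (J < K ∧ K < I) ↔ K = K₁ ∨ K = K₂ := by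
  obtain ⟨t₁, ht₁, t₂, ht₂, ht⟩ := exists_isGreatest_zero_iff (Set.toFinite (I.1 \ J.1))
    (fun n hn => form_sub_point_neg hn.1 hn.2) h.exists_form_pos h.exists_form_neg
  simp only [← apply_pencil] at ht
  obtain ⟨K₁, hJK₁, hK₁I, hK₁⟩ := h.exists_between_of_isGreatest hJI ((ht t₁).2 (Or.inl rfl))
  obtain ⟨K₂, hJK₂, hK₂I, hK₂⟩ := h.exists_between_of_isGreatest hJI ((ht t₂).2 (Or.inr rfl))
  refine ⟨t₁, ht₁, t₂, ht₂, K₁, K₂, ?_, hK₁, hK₂, fun K => ⟨fun ⟨hJK, hKI⟩ => ?_, ?_⟩⟩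
  · rintro rfl
    obtain ⟨n, hn, hnJ⟩ := Set.exists_of_ssubset hJK₁
    have hn₁ := hK₁.eq_setOf hK₁I.le ▸ hn
    have hn₂ := hK₂.eq_setOf hK₁I.le ▸ hn
    exact (ht₂.trans ht₁).ne' (pencil_slope_unique ⟨hn₁.1, hnJ⟩ hn₁.2 hn₂.2)
  · obtain ⟨t, htK, hK⟩ := h.exists_isGreatest_and_inDirection hJK hKI
    obtain rfl | rfl := (ht t).1 htK
    · exact Or.inl (Subtype.ext ((hK.eq_setOf hKI.le).trans (hK₁.eq_setOf hK₁I.le).symm))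
    · exact Or.inr (Subtype.ext ((hK.eq_setOf hKI.le).trans (hK₂.eq_setOf hK₂I.le).symm))
  · rintro (rfl | rfl)
    · exact ⟨hJK₁, hK₁I⟩
    · exact ⟨hJK₂, hK₂I⟩

end IsPencil

theorem sum_form_sub_point_neg {I J K : P.Face} [Fintype ↥(I.1 \ J.1)] (hJK : J ≤ K)
    (hKI : K < I) : (∑ n ∈ (I.1 \ J.1).toFinset, P.form n) (K.point - I.point) < 0 := by
  obtain ⟨n, hn, hnK⟩ := Set.exists_of_ssubset hKI
  rw [LinearMap.sum_apply]
  refine Finset.sum_neg' (fun m hm => ?_)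
    ⟨n, Set.mem_toFinset.2 ⟨hn, fun h => hnK (hJK h)⟩, form_sub_point_neg hn hnK⟩
  by_cases hmK : m ∈ K.1
  · exact (form_sub_point_eq_zero hKI.le hmK).le
  · exact (form_sub_point_neg (Set.mem_toFinset.1 hm).1 hmK).le

variable [FiniteDimensional ℝ V] [Finite ν]

theorem exists_isPencil {I J : P.Face} (hJI : J ≤ I) (hcodim : P.codim I = P.codim J + 2) :
    ∃ w', IsPencil I J w' := by
  classical
  have := Fintype.ofFinite ν
  set s : Module.Dual ℝ V := ∑ n ∈ (I.1 \ J.1).toFinset, P.form n with hs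
  have hsI : s ∈ P.conormal I :=
    Submodule.sum_mem _ fun n hn => form_mem_conormal (Set.mem_toFinset.1 hn).1
  have hsneg (K : P.Face) (hJK : J ≤ K) (hKI : K < I) : s (K.point - I.point) < 0 :=
    sum_form_sub_point_neg hJK hKI
  have hJ : J < I := hJI.lt_of_ne fun h => by subst h; lia
  obtain ⟨w', hJw', hsw', ⟨y, hy, hyw'⟩, hspan⟩ := exists_complementary_direction
    (conormal_mono hJI) hcodim hsI (conormal_sub_point_eq_zero hJI) (hsneg J le_rfl hJ).ne
  have hform : ∃ n ∈ (I.1 \ J.1).toFinset, P.form n w' ≠ 0 := by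
    by_contra! h
    refine hyw' (conormal_apply_eq_zero (fun n hn => ?_) y hy)
    by_cases hnJ : n ∈ J.1
    · exact hJw' _ (form_mem_conormal hnJ)
    · exact h n (Set.mem_toFinset.2 ⟨hn, hnJ⟩)
  rw [hs, LinearMap.sum_apply] at hsw'
  have hpos := Finset.exists_pos_of_sum_zero_of_exists_nonzero _ hsw' hform
  have hneg := Finset.exists_pos_of_sum_zero_of_exists_nonzero (fun n => -P.form n w')
    (by rw [Finset.sum_neg_distrib, hsw', neg_zero]) (by simpa only [neg_ne_zero] using hform)
  simp only [Set.mem_toFinset, neg_pos] at hpos hneg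
  refine ⟨w', fun n hn => hJw' _ (form_mem_conormal hn), hpos, hneg, fun K hJK hKI => ?_⟩
  obtain ⟨b, hb⟩ := hspan (K.point - I.point) fun y hy =>
    conormal_sub_point_eq_zero hKI.le y (conormal_mono hJK hy)
  have hr := div_pos_of_neg_of_neg (hsneg K hJK hKI) (hsneg J le_rfl hJ)
  refine ⟨b / (s (K.point - I.point) / s (J.point - I.point)), _, hr, fun y hy => ?_⟩
  rw [hb y hy, apply_pencil, mul_add, ← mul_assoc, mul_div_cancel₀ _ hr.ne']

theorem exists_diamond {I J : P.Face} (hJI : J ≤ I) (hcodim : P.codim I = P.codim J + 2) :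
    ∃ K₁ K₂ : P.Face, K₁ ≠ K₂ ∧
      (∀ K : P.Face, (J < K ∧ K < I) ↔ K = K₁ ∨ K = K₂) ∧
      ∃ α > 0, ∃ β > 0, ∀ y ∈ P.conormal I,
        y (J.point - I.point) = α * y (K₁.point - I.point) + β * y (K₂.point - I.point) := by
  obtain ⟨w', h⟩ := exists_isPencil hJI hcodim
  obtain ⟨t₁, ht₁, t₂, ht₂, K₁, K₂, hne, ⟨r₁, hr₁, h₁⟩, ⟨r₂, hr₂, h₂⟩, hK⟩ :=
    h.exists_inDirection_pair hJI
  have ht : 0 < t₁ - t₂ := by linarith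
  refine ⟨K₁, K₂, hne, hK, -t₂ / (r₁ * (t₁ - t₂)), div_pos (neg_pos.2 ht₂) (by positivity),
    t₁ / (r₂ * (t₁ - t₂)), by positivity, fun y hy => ?_⟩
  rw [h₁ y hy, h₂ y hy]
  simp only [apply_pencil]
  field_simp
  ring

end Face

/-- `N I` co-orients the facets `J` of the cellular boundary of `I` by its sign on them; the
relation between faces with a common subface makes the resulting incidence numbers cancel around
each codimension-two pair. -/
structure IsCoorientation (N : P.Face → Module.Dual ℝ V) : Prop where
  mem : ∀ I : P.Face, P.codim I ≠ 0 → N I ∈ P.conormal I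
  notMem : ∀ I J : P.Face, P.codim I = P.codim J + 1 → N I ∉ P.conormal J
  exists_eq_add_smul : ∀ I K K' : P.Face, K ≤ I → K' ≤ I → P.codim K ≠ 0 →
    P.codim I = P.codim K + 1 → P.codim I = P.codim K' + 1 → ∃ c : ℝ, N K = N K' + c • N I

theorem exists_isCoorientation [FiniteDimensional ℝ V] [Finite ν] :
    ∃ N : P.Face → Module.Dual ℝ V, IsCoorientation N := by
  obtain ⟨g, hg⟩ := exists_generic_flag fun I : P.Face => P.conormal I
  have hN (I : P.Face) : ∃ y, ∀ r, P.codim I.1 = r + 1 →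
      y ∈ P.conormal I ∧ (∀ j < r, y (g j) = 0) ∧ y (g r) = 1 := by
    rcases hI : P.codim I with - | r
    · exact ⟨0, by lia⟩
    · obtain ⟨y, hy⟩ := exists_normal_of_generic hI fun y hy h => hg I y hy (by rwa [← codim, hI])
      exact ⟨y, fun s hs => by rwa [← Nat.succ_injective hs]⟩
  choose N hN using hN
  refine ⟨N, fun I hI => ?_, fun I J hr hmem => ?_, fun I K K' hKI hK'I hK0 hK hK' => ?_⟩
  · obtain ⟨r, hr⟩ := Nat.exists_eq_succ_of_ne_zero hI
    exact (hN I r hr).1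
  · obtain ⟨-, hzero, hone⟩ := hN I _ hr
    have h0 : N I = 0 := hg J _ hmem hzero
    rw [h0, LinearMap.zero_apply] at hone
    exact zero_ne_one hone
  · obtain ⟨r, hr⟩ := Nat.exists_eq_succ_of_ne_zero hK0
    obtain ⟨hKmem, hKzero, hKone⟩ := hN K r hr
    obtain ⟨hK'mem, hK'zero, hK'one⟩ := hN K' r (by lia)
    obtain ⟨hImem, hIzero, hIone⟩ := hN I (r + 1) (by lia)
    set c := (N K - N K') (g (r + 1))
    refine ⟨c, sub_eq_iff_eq_add'.1 (sub_eq_zero.1 (hg I (N K - N K' - c • N I) ?_ ?_))⟩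
    · exact Submodule.sub_mem _ (Submodule.sub_mem _ (conormal_mono hKI hKmem)
        (conormal_mono hK'I hK'mem)) (Submodule.smul_mem _ _ hImem)
    · rw [← codim, show P.codim I = r + 2 by lia]
      intro j hj
      simp only [LinearMap.sub_apply, LinearMap.smul_apply, smul_eq_mul]
      rcases (Nat.lt_succ_iff.1 hj).lt_or_eq with hj | rfl
      · rw [hIzero j hj]
        rcases (Nat.lt_succ_iff.1 hj).lt_or_eq with hj | rfl
        · rw [hKzero j hj, hK'zero j hj]; ring
        · rw [hKone, hK'one]; ring
      · rw [hIone]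
        exact sub_eq_zero.2 (mul_one _).symm

theorem IsCoorientation.apply_ne_zero [FiniteDimensional ℝ V] {N : P.Face → Module.Dual ℝ V}
    (hN : IsCoorientation N) {I J : P.Face} (hJI : J ≤ I) (hr : P.codim I = P.codim J + 1) :
    N I (J.point - I.point) ≠ 0 := by
  intro h0
  have hlt : J < I := hJI.lt_of_ne fun h => by subst h; lia
  obtain ⟨n, hn, hnJ⟩ := Set.exists_of_ssubset hlt
  have hspan := sup_span_singleton_eq_of_finrank_eq_add_one (conormal_mono hJI)
    (hN.mem I (by lia)) (hN.notMem I J hr) hr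
  have hform := hspan ▸ form_mem_conormal hn
  simp only [Submodule.mem_sup, Submodule.mem_span_singleton] at hform
  obtain ⟨y, hy, _, ⟨c, rfl⟩, hyn⟩ := hform
  refine (Face.form_sub_point_neg hn hnJ).ne ?_
  rw [← hyn, LinearMap.add_apply, LinearMap.smul_apply, h0, smul_zero, add_zero]
  exact Face.conormal_sub_point_eq_zero hJI y hy

instance [Finite ν] : Fintype P.Face := Fintype.ofFinite _

/-- A system of incidence numbers of the open faces: the matrix of a cellular boundary operator,
with entries `±1` exactly at the pairs of incident faces of adjacent codimensions. -/
structure IsIncidence [Finite ν] (ε : Matrix P.Face P.Face ℤ) : Prop where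
  of_ne_zero : ∀ {I J}, ε I J ≠ 0 → J ≤ I ∧ P.codim I = P.codim J + 1
  isUnit : ∀ {I J : P.Face}, J ≤ I → P.codim I = P.codim J + 1 → IsUnit (ε I J)
  mul_self : ε * ε = 0

open Classical in
/-- The incidence numbers defined by a co-orientation. -/
def incidence (N : P.Face → Module.Dual ℝ V) : Matrix P.Face P.Face ℤ := fun I J =>
  if J ≤ I ∧ P.codim I = P.codim J + 1 then SignType.sign (N I (J.point - I.point)) else 0

theorem incidence_of_le {N : P.Face → Module.Dual ℝ V} {I J : P.Face} (hJI : J ≤ I)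
    (hr : P.codim I = P.codim J + 1) :
    incidence N I J = SignType.sign (N I (J.point - I.point)) := if_pos ⟨hJI, hr⟩

theorem of_incidence_ne_zero {N : P.Face → Module.Dual ℝ V} {I J : P.Face}
    (h : incidence N I J ≠ 0) : J ≤ I ∧ P.codim I = P.codim J + 1 := by
  by_contra h'
  exact h (if_neg h')

theorem IsCoorientation.incidence_cancel {N : P.Face → Module.Dual ℝ V} (hN : IsCoorientation N)
    {I J K₁ K₂ : P.Face} (hJK₁ : J ≤ K₁) (hJK₂ : J ≤ K₂) (hK₁I : K₁ ≤ I) (hK₂I : K₂ ≤ I)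
    (h₁ : P.codim K₁ = P.codim J + 1) (h₂ : P.codim K₂ = P.codim J + 1)
    (hI : P.codim I = P.codim J + 2) {α β : ℝ} (hα : 0 < α) (hβ : 0 < β)
    (hw : ∀ y ∈ P.conormal I,
      y (J.point - I.point) = α * y (K₁.point - I.point) + β * y (K₂.point - I.point)) :
    incidence N I K₁ * incidence N K₁ J + incidence N I K₂ * incidence N K₂ J = 0 := by
  obtain ⟨c, hc⟩ := hN.exists_eq_add_smul I K₁ K₂ hK₁I hK₂I (by lia) (by lia) (by lia)
  have hmem₁ := hN.mem K₁ (by lia)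
  have hmem₂ := hN.mem K₂ (by lia)
  have hzero₁ := Face.conormal_sub_point_eq_zero hK₁I _ hmem₁
  have hzero₂ := Face.conormal_sub_point_eq_zero hK₂I _ hmem₂
  have hJ₁ : N K₁ (J.point - K₁.point) = β * (c * N I (K₂.point - I.point)) := by
    rw [← sub_sub_sub_cancel_right _ _ I.point, map_sub, hw _ (conormal_mono hK₁I hmem₁), hzero₁,
      hc, LinearMap.add_apply, hzero₂, LinearMap.smul_apply, smul_eq_mul]
    ring
  have hJ₂ : N K₂ (J.point - K₂.point) = α * -(c * N I (K₁.point - I.point)) := by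
    rw [hc, LinearMap.add_apply, LinearMap.smul_apply, smul_eq_mul] at hzero₁
    rw [← sub_sub_sub_cancel_right _ _ I.point, map_sub, hw _ (conormal_mono hK₂I hmem₂), hzero₂,
      ← eq_neg_of_add_eq_zero_left hzero₁]
    ring
  rw [incidence_of_le hK₁I (by lia), incidence_of_le hK₂I (by lia), incidence_of_le hJK₁ h₁,
    incidence_of_le hJK₂ h₂, hJ₁, hJ₂]
  simp only [sign_mul, Left.sign_neg, sign_pos hα, sign_pos hβ, SignType.coe_mul,
    SignType.coe_neg, SignType.coe_one]
  ring

theorem IsCoorientation.isIncidence [FiniteDimensional ℝ V] [Finite ν]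
    {N : P.Face → Module.Dual ℝ V} (hN : IsCoorientation N) : IsIncidence (incidence N) where
  of_ne_zero := of_incidence_ne_zero
  isUnit {I J} hJI hr := by
    rw [incidence_of_le hJI hr]
    rcases (hN.apply_ne_zero hJI hr).lt_or_gt with h | h
    · rw [sign_neg h]; simp
    · rw [sign_pos h]; simp
  mul_self := by
    ext I J
    rw [Matrix.mul_apply, Matrix.zero_apply]
    by_cases h : J ≤ I ∧ P.codim I = P.codim J + 2
    · obtain ⟨K₁, K₂, hne, hK, α, hα, β, hβ, hw⟩ := Face.exists_diamond h.1 h.2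
      have hcodim (K : P.Face) (hK : J < K ∧ K < I) : P.codim K = P.codim J + 1 := by
        have h₁ : P.codim J < P.codim K := Face.codim_strictMono hK.1
        have h₂ : P.codim K < P.codim I := Face.codim_strictMono hK.2
        lia
      have hK₁ := (hK K₁).2 (Or.inl rfl)
      have hK₂ := (hK K₂).2 (Or.inr rfl)
      rw [Fintype.sum_eq_add K₁ K₂ hne]
      · exact hN.incidence_cancel hK₁.1.le hK₂.1.le hK₁.2.le hK₂.2.le (hcodim K₁ hK₁)
          (hcodim K₂ hK₂) h.2 hα hβ hw
      · intro K hK'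
        by_contra h0
        obtain ⟨hKI, h₁⟩ := of_incidence_ne_zero (left_ne_zero_of_mul h0)
        obtain ⟨hJK, h₂⟩ := of_incidence_ne_zero (right_ne_zero_of_mul h0)
        refine not_or.2 hK' ((hK K).1 ⟨hJK.lt_of_ne ?_, hKI.lt_of_ne ?_⟩) <;>
          · rintro rfl
            lia
    · refine Finset.sum_eq_zero fun K _ => by_contra fun h0 => h ?_
      obtain ⟨hKI, h₁⟩ := of_incidence_ne_zero (left_ne_zero_of_mul h0)
      obtain ⟨hJK, h₂⟩ := of_incidence_ne_zero (right_ne_zero_of_mul h0)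
      exact ⟨hJK.trans hKI, by lia⟩

theorem exists_isIncidence [FiniteDimensional ℝ V] [Finite ν] (P : RelPolyhedron V ν) :
    ∃ ε : Matrix P.Face P.Face ℤ, IsIncidence ε :=
  let ⟨_, hN⟩ := exists_isCoorientation (P := P)
  ⟨_, hN.isIncidence⟩

/-- The faces contained in every hyperplane through `u` and otherwise only in hyperplanes that
separate `u` from the polyhedron. -/
def visible (P : RelPolyhedron V ν) (u : V) : Set P.Face :=
  {I | P.active u ⊆ I.1 ∧ I.1 ⊆ P.active u ∪ P.violated u}

theorem ordConnected_visible (u : V) : (P.visible u).OrdConnected :=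
  ⟨fun _ hI _ hK _ hJ => ⟨fun _ hn => hJ.1 (hI.1 hn), fun _ hn => hK.2 (hJ.2 hn)⟩⟩

theorem exists_face_eq_active [Finite ν] {u : V} (hu : (P.visible u).Nonempty) :
    ∃ K : P.Face, K.1 = P.active u := by
  obtain ⟨I, hactive, hI⟩ := hu
  have hform (n) (hn : n ∈ I.1) : P.form n (I.point - u) = P.bound n - P.form n u := by
    rw [map_sub, I.form_point_eq hn]
  obtain ⟨K, hK⟩ := I.exists_of_direction (u := I.point - u) fun n hn => by
    rw [hform n hn, sub_nonpos]
    exact (hI hn).elim (fun h => h.ge) (fun h => h.le)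
  refine ⟨K, hK.trans (Set.ext fun n => ⟨fun hn => ?_, fun hn => ⟨hactive hn, ?_⟩⟩)⟩
  · exact (sub_eq_zero.1 ((hform n hn.1).symm.trans hn.2)).symm
  · rw [hform n (hactive hn), sub_eq_zero]
    exact hn.symm

theorem exists_generic_perturbation [FiniteDimensional ℝ V] [Finite ν] {κ : Type*} [Finite κ]
    {u : V} (hu : u ∈ P.domain) (z : V) (y : κ → Module.Dual ℝ V) :
    ∃ u' ∈ P.domain, P.active u' = P.active u ∧ P.violated u' = P.violated u ∧
      ∀ i, y i (u' - z) = 0 → y i ∈ P.conormal (P.active u) := by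
  obtain ⟨w, hw, hyw⟩ := exists_forall_apply_ne_zero (P.conormal (P.active u)) y
  have hform (n) (hn : n ∈ P.active u) : P.form n w = 0 := hw _ (form_mem_conormal hn)
  have hgeneric : ∀ᶠ δ : ℝ in 𝓝[>] 0,
      ∀ i, y i (u + δ • w - z) = 0 → y i ∈ P.conormal (P.active u) := by
    refine eventually_all.2 fun i => ?_
    by_cases hi : y i ∈ P.conormal (P.active u)
    · exact .of_forall fun _ _ => hi
    have hne : ∀ᶠ δ : ℝ in 𝓝[>] 0, δ ≠ -y i (u - z) / y i w :=
      ((nhdsGT_le_nhdsNE 0).trans (nhdsNE_le_cofinite 0)) (eventually_cofinite_ne _)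
    filter_upwards [hne] with δ hδ h
    rw [add_sub_right_comm, map_add, map_smul, smul_eq_mul, ← eq_neg_iff_add_eq_zero] at h
    exact absurd (eq_div_of_mul_eq (hyw i hi) (by rw [h, neg_neg])) hδ
  obtain ⟨δ, ⟨hdomain, hactive, hviolated⟩, hδ⟩ :=
    ((eventually_add_smul hu w).and hgeneric).exists
  refine ⟨_, hdomain, hactive.trans (Set.sep_eq_self_iff_mem_true.2 hform),
    hviolated.trans (Set.union_eq_self_of_subset_right ?_), hδ⟩
  exact fun n hn => absurd (hform n hn.1) hn.2.ne'

theorem exists_crossing [Finite ν] {z u : V} (hz : z ∈ P.carrier) (hzu : P.active z = P.active u)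
    (hne : (P.violated u).Nonempty) :
    ∃ s ∈ Set.Ioo (0 : ℝ) 1, ∃ S ⊆ P.violated u, S.Nonempty ∧
      P.active (u + s • (z - u)) = P.active u ∪ S ∧
      P.violated (u + s • (z - u)) = P.violated u \ S := by
  have hz' := (mem_carrier_iff.1 hz).2
  have hlt (n) (hn : n ∉ P.active u) : P.form n z < P.bound n :=
    (hz' n).lt_of_ne fun h => hn (hzu ▸ h)
  have hdown (n) (hn : n ∈ P.violated u) : P.form n z < P.bound n :=
    hlt n (ne_of_gt hn)
  have hform (s : ℝ) (n) : P.form n (u + s • (z - u)) =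
      P.form n u - s * (P.form n u - P.form n z) := by
    rw [map_add, map_smul, map_sub, smul_eq_mul]; ring
  obtain ⟨s, hs, ⟨m, hm, hm0⟩, hle⟩ := exists_first_zero (P.violated u).toFinite
    (a := fun n => P.bound n - P.form n u) (b := fun n => P.form n u - P.form n z)
    (fun n hn => sub_neg.2 hn) (hne.imp fun n hn => ⟨hn, sub_pos.2 ((hdown n hn).trans hn)⟩)
  have hge (n) (hn : n ∈ P.violated u) : P.bound n ≤ P.form n (u + s • (z - u)) := by
    linarith [hform s n, hle ⟨n, hn, rfl⟩]
  have hm0 : P.form m (u + s • (z - u)) = P.bound m := by linarith [hform s m, hm0]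
  have hs1 : s < 1 := by
    have := hform s m
    have := hdown m hm
    have : P.bound m < P.form m u := hm
    nlinarith
  have hout (n) (hn : n ∉ P.violated u) (hn' : n ∉ P.active u) :
      P.form n (u + s • (z - u)) < P.bound n := by
    rw [hform]
    nlinarith [hlt n hn', (not_lt.1 hn).lt_of_ne hn']
  have hin (n) (hn : n ∈ P.active u) : P.form n (u + s • (z - u)) = P.bound n := by
    have : P.form n z = P.bound n := by rwa [← hzu] at hn
    rw [hform, this, show P.form n u = P.bound n from hn, sub_self, mul_zero, sub_zero]
  refine ⟨s, ⟨hs, hs1⟩, {n ∈ P.violated u | P.form n (u + s • (z - u)) = P.bound n},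
    Set.sep_subset _ _, ⟨m, hm, hm0⟩, Set.ext fun n => ?_, Set.ext fun n => ?_⟩ <;>
  · have := hge n
    have := hout n
    have := hin n
    simp only [active, violated, Set.mem_union, Set.mem_sdiff, Set.mem_ofPred_eq] at *
    grind

theorem exists_active_eq_of_union [Finite ν] {q w : V} (hq : q ∈ P.domain) {A S : Set ν}
    (hAS : P.active q = A ∪ S) (hA : ∀ n ∈ A, P.form n w = 0) (hS : ∀ n ∈ S, P.form n w < 0) :
    ∃ p ∈ P.domain, P.active p = A ∧ P.violated p = P.violated q := by
  obtain ⟨δ, hδ, hactive, hviolated⟩ := (eventually_add_smul hq w).exists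
  refine ⟨_, hδ, hactive.trans ?_, hviolated.trans ?_⟩ <;> rw [hAS]
  · ext n
    have := hA n
    have := hS n
    grind
  · grind

theorem exists_last_crossing [FiniteDimensional ℝ V] [Finite ν] {u : V} (hu : u ∈ P.domain)
    (hvisible : (P.visible u).Nonempty) (hne : (P.violated u).Nonempty) :
    ∃ S ⊆ P.violated u, S.Nonempty ∧
      (∃ p ∈ P.domain, P.active p = P.active u ∧ P.violated p = P.violated u \ S) ∧
      (∃ q ∈ P.domain, P.active q = P.active u ∪ S ∧ P.violated q = P.violated u \ S) ∧
      ∀ n ∈ S, ∀ m ∈ S, ∃ c : ℝ, P.form m - c • P.form n ∈ P.conormal (P.active u) := by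
  obtain ⟨K, hK⟩ := exists_face_eq_active hvisible
  set z := K.point
  have hgap (n) (hn : n ∈ P.violated u) : P.form n z < P.bound n :=
    K.form_point_lt fun h => (ne_of_gt hn) (hK ▸ h :)
  obtain ⟨u', hu', hactive, hviolated, hgeneric⟩ := exists_generic_perturbation hu z
    fun i : ν × ν => (P.bound i.1 - P.form i.1 z) • P.form i.2 -
      (P.bound i.2 - P.form i.2 z) • P.form i.1
  obtain ⟨s, ⟨hs, hs1⟩, S, hS, hSne, hqactive, hqviolated⟩ :=
    exists_crossing K.point_mem (K.active_point.trans (hK.trans hactive.symm)) (hviolated ▸ hne)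
  rw [hviolated] at hS hqviolated
  rw [hactive] at hqactive
  set q := u' + s • (z - u') with hq
  have hqdomain : q ∈ P.domain :=
    P.convex_domain.add_smul_sub_mem hu' K.point_mem.1 ⟨hs.le, hs1.le⟩
  refine ⟨S, hS, hSne, ?_, ⟨q, hqdomain, hqactive, hqviolated⟩, fun n hn m hm => ?_⟩
  · have hzero (n) (hn : n ∈ P.active u) : P.form n (z - u') = 0 := by
      have hn' : P.form n u' = P.bound n := by rwa [← hactive] at hn
      rw [map_sub, hn', K.form_point_eq (hK ▸ hn), sub_self]
    have hneg (n) (hn : n ∈ S) : P.form n (z - u') < 0 := by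
      have hn' : P.bound n < P.form n u' := hviolated.ge (hS hn)
      rw [map_sub]
      exact sub_neg.2 ((hgap n (hS hn)).trans hn')
    rw [← hqviolated]
    exact exists_active_eq_of_union hqdomain hqactive hzero hneg
  · have hcross (k) (hk : k ∈ S) : P.form k q = P.bound k := hqactive.ge (.inr hk)
    have hqz : q - z = (1 - s) • (u' - z) := by rw [hq]; module
    have hmem := hgeneric (n, m) <| by
      refine (smul_eq_zero.1 ?_).resolve_left (sub_ne_zero.2 hs1.ne')
      rw [← map_smul, ← hqz]
      simp only [LinearMap.sub_apply, LinearMap.smul_apply, map_sub, hcross n hn, hcross m hm,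
        smul_eq_mul]
      ring
    have hn0 := sub_ne_zero.2 (hgap n (hS hn)).ne'
    refine ⟨(P.bound n - P.form n z)⁻¹ * (P.bound m - P.form m z), ?_⟩
    convert Submodule.smul_mem _ (P.bound n - P.form n z)⁻¹ hmem using 1
    rw [smul_sub, smul_smul, smul_smul, inv_mul_cancel₀ hn0, one_smul]

theorem active_subset_or_disjoint {u q : V} {S : Set ν} (hq : P.active q = P.active u ∪ S)
    (hS : ∀ n ∈ S, ∀ m ∈ S, ∃ c : ℝ, P.form m - c • P.form n ∈ P.conormal (P.active u))
    {I : P.Face} (hI : P.active u ⊆ I.1) : S ⊆ I.1 ∨ Disjoint S I.1 := by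
  by_contra! h
  obtain ⟨⟨m, hm, hmI⟩, n, hn, hnI⟩ := h.imp Set.not_subset.1 Set.not_disjoint_iff.1
  obtain ⟨c, hc⟩ := hS n hn m hm
  have heq (k) (hk : k ∈ P.active q) : P.form k q = P.bound k := hk
  have h0 := conormal_apply_eq_zero (x := I.point - q) (fun k hk => by
    rw [map_sub, I.form_point_eq (hI hk), heq k (hq ▸ .inl hk), sub_self]) _ hc
  rw [LinearMap.sub_apply, LinearMap.smul_apply, map_sub (P.form n), I.form_point_eq hnI,
    heq n (hq ▸ .inr hn), sub_self, smul_zero, sub_zero, map_sub, heq m (hq ▸ .inr hm)] at h0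
  exact (sub_neg.2 (I.form_point_lt hmI)).ne h0

theorem codim_union_eq_add_one [FiniteDimensional ℝ V] {K I : P.Face} {S : Set ν}
    (hI : I.1 = K.1 ∪ S) (hne : S.Nonempty) (hdisj : Disjoint S K.1)
    (hS : ∀ n ∈ S, ∀ m ∈ S, ∃ c : ℝ, P.form m - c • P.form n ∈ P.conormal K) :
    P.codim I = P.codim K + 1 := by
  obtain ⟨n, hn⟩ := hne
  have hKI : K ≤ I := Set.subset_union_left.trans hI.ge
  have hnmem : P.form n ∉ P.conormal K :=
    Face.form_notMem_conormal hKI (hI ▸ .inr hn) (Set.disjoint_left.1 hdisj hn)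
  have hspan : P.conormal I = P.conormal K ⊔ ℝ ∙ P.form n := by
    refine le_antisymm ?_ (sup_le (conormal_mono hKI) ?_)
    · rw [conormal, Submodule.span_le, hI]
      rintro _ ⟨m, hm | hm, rfl⟩
      · exact Submodule.mem_sup_left (form_mem_conormal hm)
      · obtain ⟨c, hc⟩ := hS n hn m hm
        rw [← sub_add_cancel (P.form m) (c • P.form n)]
        exact Submodule.add_mem_sup hc (Submodule.mem_span_singleton.2 ⟨c, rfl⟩)
    · rw [Submodule.span_singleton_le_iff_mem]
      exact form_mem_conormal (hI ▸ .inr hn)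
  rw [codim, hspan, Submodule.finrank_sup_span_singleton hnmem, codim]

theorem visible_eq_union {u p q : V} {S : Set ν} (hSu : S ⊆ P.violated u)
    (hp : P.active p = P.active u) (hp' : P.violated p = P.violated u \ S)
    (hq : P.active q = P.active u ∪ S) (hq' : P.violated q = P.violated u \ S)
    (hS : ∀ n ∈ S, ∀ m ∈ S, ∃ c : ℝ, P.form m - c • P.form n ∈ P.conormal (P.active u)) :
    P.visible u = P.visible p ∪ P.visible q := by
  ext I
  simp only [visible, Set.mem_union, Set.mem_ofPred_eq]
  rw [hp, hp', hq, hq']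
  have := active_subset_or_disjoint hq hS (I := I)
  simp only [Set.disjoint_left] at this
  grind

theorem visible_eq_singleton {p : V} (hp : p ∈ P.carrier) :
    P.visible p = {⟨P.active p, p, hp, rfl⟩} := by
  ext I
  simp only [visible, hp.2, Set.union_empty, Set.mem_ofPred_eq, Set.mem_singleton_iff,
    Subtype.ext_iff]
  exact ⟨fun h => h.2.antisymm h.1, fun h => ⟨h.ge, h.le⟩⟩

theorem IsIncidence.map_mul_self [Finite ν] {ε : Matrix P.Face P.Face ℤ} (hε : IsIncidence ε)
    (R : Type*) [Ring R] : ε.map (Int.cast : ℤ → R) * ε.map Int.cast = 0 := by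
  trans (ε * ε).map Int.cast
  · exact (Matrix.map_mul (f := Int.castRingHom R)).symm
  · rw [hε.mul_self, Matrix.map_zero _ Int.cast_zero]

theorem IsIncidence.exactOn_pair [Finite ν] {ε : Matrix P.Face P.Face ℤ} (hε : IsIncidence ε)
    (R : Type*) [CommRing R] {K I : P.Face} (hKI : K ≤ I) (hcodim : P.codim I = P.codim K + 1) :
    ExactOn (ε.map (Int.cast : ℤ → R)) {K, I} := by
  have hdiag (J : P.Face) : ε.map (Int.cast : ℤ → R) J J = 0 := by
    have h : ε J J = 0 := by_contra fun h => absurd (hε.of_ne_zero h).2 (by lia)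
    rw [Matrix.map_apply, h, Int.cast_zero]
  exact .of_pair (hdiag I) (hdiag K) ((hε.isUnit hKI hcodim).map (Int.castRingHom R))

/-- Moving from the polyhedron towards `u` and crossing the hyperplanes that separate them one at a
time, the visible faces of `u` are those of the points just before and on the last hyperplane. -/
theorem exactOn_visible [FiniteDimensional ℝ V] [Finite ν] {ε : Matrix P.Face P.Face ℤ}
    (hε : IsIncidence ε) (R : Type*) [CommRing R] {u : V} (hu : u ∈ P.domain)
    (hne : (P.violated u).Nonempty) :
    ExactOn (ε.map (Int.cast : ℤ → R)) (P.visible u) := by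
  induction hT : (P.violated u).ncard using Nat.strong_induction_on generalizing u with
  | h N ih =>
  subst hT
  rcases (P.visible u).eq_empty_or_nonempty with hempty | hvisible
  · rw [hempty]
    exact fun c _ _ => ⟨0, by simp⟩
  obtain ⟨S, hSu, hSne, ⟨p, hp, hpactive, hpviolated⟩, ⟨q, hq, hqactive, hqviolated⟩, hS⟩ :=
    exists_last_crossing hu hvisible hne
  have hdisj : Disjoint S (P.active u) :=
    Set.disjoint_left.2 fun n hn h => (ne_of_gt (hSu hn)) h
  rw [visible_eq_union hSu hpactive hpviolated hqactive hqviolated hS]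
  by_cases hTS : (P.violated u \ S).Nonempty
  · have hlt : (P.violated u \ S).ncard < (P.violated u).ncard :=
      Set.ncard_lt_ncard (hSu.sdiff_ssubset_of_nonempty hSne)
    refine ExactOn.union (fun I J h => ?_) (hε.map_mul_self R) ?_ (fun I hI J hJ hJI => ?_)
      (ih _ (hpviolated ▸ hlt) hp (hpviolated ▸ hTS) rfl)
      (ih _ (hqviolated ▸ hlt) hq (hqviolated ▸ hTS) rfl)
    · exact (hε.of_ne_zero fun h0 => h (by rw [Matrix.map_apply, h0, Int.cast_zero])).1
    · rw [← visible_eq_union hSu hpactive hpviolated hqactive hqviolated hS]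
      exact ordConnected_visible u
    · obtain ⟨n, hn⟩ := hSne
      have hnI := hI.2 (hJI (hJ.1 (hqactive.ge (.inr hn))))
      rw [hpactive, hpviolated] at hnI
      exact hnI.elim (Set.disjoint_left.1 hdisj hn) fun h => h.2 hn
  · rw [Set.not_nonempty_iff_eq_empty] at hTS
    rw [hTS] at hpviolated hqviolated
    set K : P.Face := ⟨P.active p, p, ⟨hp, hpviolated⟩, rfl⟩
    set I : P.Face := ⟨P.active q, q, ⟨hq, hqviolated⟩, rfl⟩
    have hKp : P.visible p = {K} := visible_eq_singleton ⟨hp, hpviolated⟩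
    have hIq : P.visible q = {I} := visible_eq_singleton ⟨hq, hqviolated⟩
    have hIK : I.1 = K.1 ∪ S := by rw [← hpactive] at hqactive; exact hqactive
    rw [hKp, hIq, Set.singleton_union]
    refine hε.exactOn_pair R (Set.subset_union_left.trans hIK.ge)
      (codim_union_eq_add_one hIK hSne ?_ ?_)
    · rwa [← hpactive] at hdisj
    · rwa [← hpactive] at hS

end RelPolyhedron

/-! ### Finitely generated cones and lattices -/

section FinitelyGeneratedCone

variable {K V : Type*} [Field K] [AddCommGroup V] [Module K V]

/-- The projection along `a` to the kernel of `n`, when `n a ≠ 0`. -/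
def projAlong (n : Module.Dual K V) (a : V) : V →ₗ[K] V :=
  LinearMap.id - n.smulRight ((n a)⁻¹ • a)

theorem projAlong_apply (n : Module.Dual K V) (a y : V) :
    projAlong n a y = y - (n y * (n a)⁻¹) • a := by
  simp [projAlong, smul_smul]

theorem projAlong_self {n : Module.Dual K V} {a : V} (ha : n a ≠ 0) : projAlong n a a = 0 := by
  rw [projAlong_apply, mul_inv_cancel₀ ha, one_smul, sub_self]

/-- The functional `n` is determined up to scaling by its zeros on `s`. For `n` non-negative on
`s`, this says that `n` spans an extremal ray of the dual of the cone generated by `s`. -/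
def IsExtremalOn (s : Set V) (n : Module.Dual K V) : Prop :=
  ∀ g : Module.Dual K V, (∀ y ∈ s, n y = 0 → g y = 0) → ∃ t : K, g = t • n

theorem exists_mem_apply_ne_zero {s : Set V} (hs : Submodule.span K s = ⊤)
    {n : Module.Dual K V} (h0 : n ≠ 0) : ∃ y ∈ s, n y ≠ 0 := by
  by_contra! h
  exact h0 (LinearMap.ext_on hs h)

variable [LinearOrder K] [IsStrictOrderedRing K]

theorem forall_mem_hull_nonneg_iff {s : Set V} {n : Module.Dual K V} :
    (∀ x ∈ PointedCone.hull K s, 0 ≤ n x) ↔ ∀ y ∈ s, 0 ≤ n y := by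
  refine ⟨fun h y hy => h y (Submodule.subset_span hy), fun h x hx => ?_⟩
  induction hx using Submodule.span_induction with
  | mem y hy => exact h y hy
  | zero => exact (map_zero n).ge
  | add y z _ _ hy hz => exact (map_add n y z).symm ▸ add_nonneg hy hz
  | smul a y _ hy => exact (n.map_smul (a : K) y).symm ▸ mul_nonneg a.2 hy

theorem add_smul_mem_hull_insert {s : Set V} {a y : V}
    (hy : y ∈ PointedCone.hull K (insert a s)) {r : K} (hr : 0 ≤ r) :
    y + r • a ∈ PointedCone.hull K (insert a s) :=
  add_mem hy (Submodule.smul_mem _ (⟨r, hr⟩ : {c : K // 0 ≤ c})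
    (Submodule.subset_span (Set.mem_insert a s)))

theorem hull_image_projAlong_le {s : Set V} {n : Module.Dual K V} (hn : ∀ y ∈ s, 0 ≤ n y) {a : V}
    (ha : n a < 0) :
    PointedCone.hull K (projAlong n a '' s) ≤ PointedCone.hull K (insert a s) := by
  refine Submodule.span_le.2 ?_
  rintro _ ⟨y, hy, rfl⟩
  rw [projAlong_apply, sub_eq_add_neg, ← neg_smul]
  exact add_smul_mem_hull_insert (Submodule.subset_span (Set.mem_insert_of_mem a hy))
    (neg_nonneg.2 (mul_nonpos_of_nonneg_of_nonpos (hn y hy) (inv_nonpos.2 ha.le)))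

theorem exists_dual_neg_of_notMem_hull_image {κ : Type*} (s : Finset κ) (y : κ → V) {x : V}
    (hx : x ∉ PointedCone.hull K (y '' s)) :
    ∃ n : Module.Dual K V, (∀ i ∈ s, 0 ≤ n (y i)) ∧ n x < 0 := by
  classical
  induction s using Finset.induction_on generalizing y x with
  | empty =>
    obtain ⟨n, hn⟩ : ∃ n : Module.Dual K V, n x ≠ 0 := by
      by_contra! h
      exact hx ((Module.forall_dual_apply_eq_zero_iff K x).1 h ▸ zero_mem _)
    rcases hn.lt_or_gt with h | h
    · exact ⟨n, by simp, h⟩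
    · exact ⟨-n, by simp, neg_lt_zero.2 h⟩
  | insert a s _ ih =>
    rw [Finset.coe_insert, Set.image_insert_eq] at hx
    obtain ⟨n, hn, hnx⟩ := ih y fun h => hx (Submodule.span_mono (Set.subset_insert _ _) h)
    rcases le_or_gt 0 (n (y a)) with ha | ha
    · exact ⟨n, Finset.forall_mem_insert _ _ _ |>.2 ⟨ha, hn⟩, hnx⟩
    · -- project along `y a`: this removes a generator and stays inside the cone
      have hx' : projAlong n (y a) x ∉ PointedCone.hull K ((projAlong n (y a) ∘ y) '' s) := by
        intro h
        rw [Set.image_comp] at h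
        have := add_smul_mem_hull_insert
          (hull_image_projAlong_le (Set.forall_mem_image.2 hn) ha h)
          (mul_nonneg_of_nonpos_of_nonpos hnx.le (inv_nonpos.2 ha.le))
        rw [projAlong_apply, sub_add_cancel] at this
        exact hx this
      obtain ⟨t, ht, htx⟩ := ih _ hx'
      refine ⟨t.comp (projAlong n (y a)), Finset.forall_mem_insert _ _ _ |>.2 ⟨?_, ht⟩, htx⟩
      rw [LinearMap.comp_apply, projAlong_self ha.ne, map_zero]

theorem exists_ratio_bounds {s : Finset V} {n g : Module.Dual K V} (hn : ∀ y ∈ s, 0 ≤ n y)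
    (hne : ∃ y ∈ s, n y ≠ 0) (hg : ∀ y ∈ s, n y = 0 → g y = 0) :
    ∃ a b : K, a ≤ b ∧ (∀ y ∈ s, a * n y ≤ g y) ∧ (∀ y ∈ s, g y ≤ b * n y) ∧
      (∃ y ∈ s, n y ≠ 0 ∧ g y = a * n y) ∧ ∃ y ∈ s, n y ≠ 0 ∧ g y = b * n y := by
  have hne' : (s.filter fun y => n y ≠ 0).Nonempty := by
    simpa only [Finset.filter_nonempty_iff] using hne
  obtain ⟨p, hp, hmin⟩ := Finset.exists_min_image _ (fun y => g y / n y) hne'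
  obtain ⟨q, hq, hmax⟩ := Finset.exists_max_image _ (fun y => g y / n y) hne'
  refine ⟨g p / n p, g q / n q, hmax p hp, fun y hy => ?_, fun y hy => ?_, ?_, ?_⟩
  · rcases (hn y hy).eq_or_lt with h | h
    · rw [hg y hy h.symm, ← h, mul_zero]
    · exact (le_div_iff₀ h).1 (hmin y (Finset.mem_filter.2 ⟨hy, h.ne'⟩))
  · rcases (hn y hy).eq_or_lt with h | h
    · rw [hg y hy h.symm, ← h, mul_zero]
    · exact (div_le_iff₀ h).1 (hmax y (Finset.mem_filter.2 ⟨hy, h.ne'⟩))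
  · rw [Finset.mem_filter] at hp
    exact ⟨p, hp.1, hp.2, (div_mul_cancel₀ _ hp.2).symm⟩
  · rw [Finset.mem_filter] at hq
    exact ⟨q, hq.1, hq.2, (div_mul_cancel₀ _ hq.2).symm⟩

theorem isExtremalOn_of_forall_add {s : Finset V}
    (hs : Submodule.span K (s : Set V) = ⊤) {n : Module.Dual K V} (h0 : n ≠ 0)
    (hn : ∀ y ∈ s, 0 ≤ n y)
    (h : ∀ a b : Module.Dual K V, (∀ y ∈ s, 0 ≤ a y) → (∀ y ∈ s, 0 ≤ b y) → a + b = n →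
      ∃ t : K, a = t • n) :
    IsExtremalOn (s : Set V) n := by
  intro g hg
  obtain ⟨a, b, hab, ha, hb, -, -⟩ := exists_ratio_bounds hn (exists_mem_apply_ne_zero hs h0) hg
  rcases hab.eq_or_lt with rfl | hab
  · exact ⟨a, LinearMap.ext_on hs fun y hy => le_antisymm (hb y hy) (ha y hy)⟩
  · have hpos : 0 < (b - a)⁻¹ := inv_pos.2 (sub_pos.2 hab)
    obtain ⟨t, ht⟩ := h ((b - a)⁻¹ • (g - a • n)) ((b - a)⁻¹ • (b • n - g))
      (fun y hy => mul_nonneg hpos.le (sub_nonneg.2 (ha y hy)))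
      (fun y hy => mul_nonneg hpos.le (sub_nonneg.2 (hb y hy))) (by
        rw [← smul_add, sub_add_sub_cancel', ← sub_smul, smul_smul,
          inv_mul_cancel₀ (sub_pos.2 hab).ne', one_smul])
    refine ⟨(b - a) * t + a, ?_⟩
    rw [add_smul, mul_smul, ← ht, smul_smul, mul_inv_cancel₀ (sub_pos.2 hab).ne', one_smul,
      sub_add_cancel]

theorem nonneg_of_forall_isExtremalOn {s : Finset V}
    (hs : Submodule.span K (s : Set V) = ⊤) {x : V}
    (hx : ∀ n : Module.Dual K V, n ≠ 0 → (∀ y ∈ s, 0 ≤ n y) → IsExtremalOn (s : Set V) n → 0 ≤ n x)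
    (n : Module.Dual K V) (hn : ∀ y ∈ s, 0 ≤ n y) : 0 ≤ n x := by
  classical
  induction hk : (s.filter fun y => n y ≠ 0).card using Nat.strong_induction_on
    generalizing n with
  | _ k ih =>
  subst hk
  by_cases h0 : n = 0
  · exact (DFunLike.congr_fun h0 x).ge
  by_cases hext : IsExtremalOn (s : Set V) n
  · exact hx n h0 hn hext
  simp only [IsExtremalOn, not_forall, exists_prop, not_exists] at hext
  obtain ⟨g, hg, hgn⟩ := hext
  -- subtracting extremal multiples of `n` from `±g` kills further generators
  obtain ⟨a, b, hab, ha, hb, ⟨p, hp, hnp, hgp⟩, q, hq, hnq, hgq⟩ :=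
    exists_ratio_bounds hn (exists_mem_apply_ne_zero hs h0) hg
  have hlt : a < b := hab.lt_of_ne fun h => hgn a <| LinearMap.ext_on hs fun y hy =>
    le_antisymm (h ▸ hb y hy) (ha y hy)
  have hdescent : ∀ m : Module.Dual K V, (∀ y ∈ s, 0 ≤ m y) → (∀ y ∈ s, n y = 0 → m y = 0) →
      ∀ y ∈ s, n y ≠ 0 → m y = 0 → 0 ≤ m x := by
    intro m hm hmn y hy hny hmy
    refine ih _ (Finset.card_lt_card ⟨fun z hz => ?_, fun h => ?_⟩) m hm rfl
    · rw [Finset.mem_filter] at hz ⊢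
      exact ⟨hz.1, fun h => hz.2 (hmn z hz.1 h)⟩
    · exact (Finset.mem_filter.1 (h (Finset.mem_filter.2 ⟨hy, hny⟩))).2 hmy
  have hlower : 0 ≤ g x - a * n x := hdescent (g - a • n) (fun y hy => sub_nonneg.2 (ha y hy))
    (fun y hy h => by simp [h, hg y hy h]) p hp hnp (sub_eq_zero.2 hgp)
  have hupper : 0 ≤ b * n x - g x := hdescent (b • n - g) (fun y hy => sub_nonneg.2 (hb y hy))
    (fun y hy h => by simp [h, hg y hy h]) q hq hnq (sub_eq_zero.2 hgq.symm)
  exact nonneg_of_mul_nonneg_right (by linarith : 0 ≤ (b - a) * n x) (sub_pos.2 hlt)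

theorem mem_hull_iff_forall_isExtremalOn {s : Finset V}
    (hs : Submodule.span K (s : Set V) = ⊤) {x : V} :
    x ∈ PointedCone.hull K (s : Set V) ↔ ∀ n : Module.Dual K V, n ≠ 0 → (∀ y ∈ s, 0 ≤ n y) →
      IsExtremalOn (s : Set V) n → 0 ≤ n x := by
  refine ⟨fun hx n _ hn _ => forall_mem_hull_nonneg_iff.2 hn x hx, fun h => ?_⟩
  by_contra hx
  obtain ⟨n, hn, hnx⟩ := exists_dual_neg_of_notMem_hull_image s id (by rwa [Set.image_id])
  exact hnx.not_ge (nonneg_of_forall_isExtremalOn hs h n hn)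

end FinitelyGeneratedCone

section FiniteFamily

variable {V : Type*} [AddCommGroup V] [Module ℝ V] {N : Set (Module.Dual ℝ V)}

theorem exists_forall_apply_le_apply_nsmul (hN : N.Finite) {c : V} (hc : ∀ n ∈ N, 0 < n c)
    (u : V) : ∃ k : ℕ, ∀ n ∈ N, n u ≤ n (k • c) := by
  have h : ∀ n ∈ N, ∀ᶠ k : ℕ in Filter.atTop, n u ≤ n (k • c) := fun n hn => by
    simp only [map_nsmul, nsmul_eq_mul]
    exact (tendsto_natCast_atTop_atTop.atTop_mul_const (hc n hn)).eventually_ge_atTop _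
  exact ((Filter.eventually_all_finite hN).2 h).exists

theorem exists_pos_forall_apply_add_smul_lt (hN : N.Finite) {x : V} (c : V)
    {b : Module.Dual ℝ V → ℝ} (hb : ∀ n ∈ N, n x < b n) :
    ∃ η : ℝ, 0 < η ∧ ∀ n ∈ N, n (x + η • c) < b n := by
  have h : ∀ n ∈ N, ∀ᶠ η : ℝ in nhdsWithin 0 (Set.Ioi 0), n (x + η • c) < b n := fun n hn => by
    have hcont : Continuous fun η : ℝ => n (x + η • c) := by
      simp only [map_add, map_smul, smul_eq_mul]
      fun_prop
    exact ((hcont.tendsto' 0 (n x) (by simp)).mono_left nhdsWithin_le_nhds).eventually_lt_const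
      (hb n hn)
  obtain ⟨η, hlt, hη⟩ :=
    ((Filter.eventually_all_finite hN).2 h |>.and self_mem_nhdsWithin).exists
  exact ⟨η, hη, hlt⟩

end FiniteFamily

section Lattice

variable {V : Type v} [NormedAddCommGroup V] [NormedSpace ℝ V] {L : Submodule ℤ V}
  {C : PointedCone ℝ V} {n : Module.Dual ℝ V}

theorem IsIntegral.neg (hn : IsIntegral L n) : IsIntegral L (-n) := fun m hm => by
  obtain ⟨z, hz⟩ := hn m hm
  exact ⟨-z, by rw [LinearMap.neg_apply, hz, Int.cast_neg]⟩

theorem IsIntegral.exists_generator (hn : IsIntegral L n) :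
    ∃ g : ℕ, (∃ l ∈ L, n l = g) ∧ ∀ l ∈ L, ∃ k : ℤ, n l = k * g := by
  let H : AddSubgroup ℤ := (L.toAddSubgroup.map n.toAddMonoidHom).comap (Int.castAddHom ℝ)
  obtain ⟨a, ha⟩ := Int.subgroup_cyclic H
  rw [← AddSubgroup.zmultiples_eq_closure, ← Int.zmultiples_natAbs] at ha
  have hmem : ∀ z : ℤ, z ∈ H ↔ ∃ l ∈ L, n l = z := fun _ => Iff.rfl
  refine ⟨a.natAbs, ?_, fun l hl => ?_⟩
  · obtain ⟨l, hl, hnl⟩ := (hmem a.natAbs).1 (ha ▸ AddSubgroup.mem_zmultiples _)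
    exact ⟨l, hl, hnl.trans (Int.cast_natCast _)⟩
  · obtain ⟨z, hz⟩ := hn l hl
    obtain ⟨k, hk⟩ := AddSubgroup.mem_zmultiples_iff.1 (ha ▸ (hmem z).2 ⟨l, hl, hz⟩)
    exact ⟨k, by rw [hz, ← hk]; simp⟩

variable [DiscreteTopology L] [IsZLattice ℝ L]

theorem exists_mem_lattice_apply_ne_zero (h0 : n ≠ 0) : ∃ l ∈ L, n l ≠ 0 :=
  exists_mem_apply_ne_zero (IsZLattice.span_top (K := ℝ) (L := L)) h0

theorem IsIntegral.exists_inv_smul (hn : IsIntegral L n) (h0 : n ≠ 0) :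
    ∃ g : ℕ, 0 < g ∧ IsIntegral L ((g : ℝ)⁻¹ • n) ∧ ∃ l ∈ L, n l = g := by
  obtain ⟨g, hg, hdvd⟩ := hn.exists_generator
  have hg0 : g ≠ 0 := by
    rintro rfl
    obtain ⟨l, hl, hnl⟩ := exists_mem_lattice_apply_ne_zero (L := L) h0
    obtain ⟨k, hk⟩ := hdvd l hl
    exact hnl (by rw [hk, Nat.cast_zero, mul_zero])
  refine ⟨g, Nat.pos_of_ne_zero hg0, fun l hl => ?_, hg⟩
  obtain ⟨k, hk⟩ := hdvd l hl
  refine ⟨k, ?_⟩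
  rw [LinearMap.smul_apply, hk, smul_eq_mul]
  field_simp

theorem exists_apply_eq_one (hn : n ∈ primitiveNormals L C) : ∃ l ∈ L, n l = 1 := by
  obtain ⟨-, h0, hint, hprim, -⟩ := hn
  obtain ⟨g, hg, hgi, l, hl, hlg⟩ := hint.exists_inv_smul h0
  obtain rfl : g = 1 := by
    by_contra h1
    have hlt : (1 : ℝ) < g := by exact_mod_cast (by lia : 1 < g)
    exact hprim _ (by positivity) (inv_lt_one_of_one_lt₀ hlt) hgi
  exact ⟨l, hl, by rw [hlg, Nat.cast_one]⟩

variable [FiniteDimensional ℝ V]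

theorem exists_dual_extending (φ : L →ₗ[ℤ] ℤ) :
    ∃ g : Module.Dual ℝ V, ∀ l : L, g l = φ l := by
  have : Module.Free ℤ L := ZLattice.module_free ℝ L
  have : Module.Finite ℤ L := ZLattice.module_finite ℝ L
  let b := Module.Free.chooseBasis ℤ L
  let g : Module.Dual ℝ V := (b.ofZLatticeBasis ℝ L).constr ℝ fun i => (φ (b i) : ℝ)
  have hg : (g.restrictScalars ℤ).comp L.subtype = (Algebra.linearMap ℤ ℝ).comp φ :=
    b.ext fun i => by
      have := (b.ofZLatticeBasis ℝ L).constr_basis ℝ (fun i => (φ (b i) : ℝ)) i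
      rw [Module.Basis.ofZLatticeBasis_apply] at this
      exact this
  exact ⟨g, LinearMap.congr_fun hg⟩

theorem IsExtremalOn.exists_isIntegral_smul {s : Set V} (hs : s ⊆ L) (h0 : n ≠ 0)
    (hn : IsExtremalOn s n) : ∃ t : ℝ, 0 < t ∧ IsIntegral L (t • n) := by
  have : Module.Finite ℤ L := ZLattice.module_finite ℝ L
  -- `n(L) ⊆ ℝ` is free over `ℤ`, so some integral functional on it does not vanish
  let f : L →ₗ[ℤ] ℝ := (n.restrictScalars ℤ).comp L.subtype
  obtain ⟨l, hl, hnl⟩ := exists_mem_lattice_apply_ne_zero (L := L) h0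
  obtain ⟨ψ, hψ⟩ : ∃ ψ : Module.Dual ℤ f.range, ψ (f.rangeRestrict ⟨l, hl⟩) ≠ 0 := by
    by_contra! h
    exact hnl (congrArg Subtype.val ((Module.forall_dual_apply_eq_zero_iff ℤ _).1 h))
  obtain ⟨g, hg⟩ := exists_dual_extending (ψ.comp f.rangeRestrict)
  obtain ⟨t, rfl⟩ := hn g fun y hy hny => by
    have hy0 : f.rangeRestrict ⟨y, hs hy⟩ = 0 := Subtype.ext hny
    rw [hg ⟨y, hs hy⟩, LinearMap.comp_apply, hy0, map_zero, Int.cast_zero]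
  have ht : t ≠ 0 := by
    rintro rfl
    have := hg ⟨l, hl⟩
    rw [zero_smul, LinearMap.zero_apply] at this
    exact hψ (by exact_mod_cast this.symm)
  have hint : IsIntegral L (t • n) := fun m hm => ⟨_, hg ⟨m, hm⟩⟩
  rcases ht.lt_or_gt with h | h
  · exact ⟨-t, neg_pos.2 h, by rw [neg_smul]; exact hint.neg⟩
  · exact ⟨t, h, hint⟩

end Lattice

section PrimitiveNormals

variable {V : Type v} [NormedAddCommGroup V] [NormedSpace ℝ V] {L : Submodule ℤ V}
  {s : Finset V} {n n' : Module.Dual ℝ V}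

theorem mem_dualCone_hull {s : Set V} :
    n ∈ dualCone (PointedCone.hull ℝ s) ↔ ∀ y ∈ s, 0 ≤ n y :=
  forall_mem_hull_nonneg_iff

theorem isExtremalOn_of_mem_primitiveNormals (hspan : Submodule.span ℝ (s : Set V) = ⊤)
    (hn : n ∈ primitiveNormals L (PointedCone.hull ℝ (s : Set V))) :
    IsExtremalOn (s : Set V) n :=
  isExtremalOn_of_forall_add hspan hn.2.1 (mem_dualCone_hull.1 hn.1) fun a b ha hb hab => by
    obtain ⟨t, -, ht⟩ :=
      hn.2.2.2.2 a (mem_dualCone_hull.2 ha) b (mem_dualCone_hull.2 hb) hab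
    exact ⟨t, ht⟩

variable [DiscreteTopology L] [IsZLattice ℝ L]

theorem eq_of_forall_apply_eq_zero (hspan : Submodule.span ℝ (s : Set V) = ⊤)
    (hn : n ∈ primitiveNormals L (PointedCone.hull ℝ (s : Set V)))
    (hn' : n' ∈ primitiveNormals L (PointedCone.hull ℝ (s : Set V)))
    (h : ∀ y ∈ s, n y = 0 → n' y = 0) : n' = n := by
  obtain ⟨t, rfl⟩ := isExtremalOn_of_mem_primitiveNormals hspan hn n' h
  obtain ⟨l, hl, hl1⟩ := exists_apply_eq_one hn
  obtain ⟨l', hl', hl1'⟩ := exists_apply_eq_one hn'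
  obtain ⟨a, ha⟩ := hn'.2.2.1 l hl
  obtain ⟨b, hb⟩ := hn.2.2.1 l' hl'
  obtain rfl : t = a := by rw [← ha, LinearMap.smul_apply, hl1, smul_eq_mul, mul_one]
  have hab : a * b = 1 := by
    rw [LinearMap.smul_apply, hb, smul_eq_mul] at hl1'
    exact_mod_cast hl1'
  obtain ⟨y, hy, hny⟩ := exists_mem_apply_ne_zero hspan hn.2.1
  have ha0 : 0 ≤ a := by
    have hpos := (mem_dualCone_hull.1 hn.1 y hy).lt_of_ne' hny
    exact_mod_cast nonneg_of_mul_nonneg_left (mem_dualCone_hull.1 hn'.1 y hy) hpos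
  obtain rfl : a = 1 := Int.eq_one_of_mul_eq_one_right ha0 hab
  rw [Int.cast_one, one_smul]

theorem IsExtremalOn.exists_smul_mem_primitiveNormals [FiniteDimensional ℝ V]
    (hs : (s : Set V) ⊆ L) (hspan : Submodule.span ℝ (s : Set V) = ⊤) (h0 : n ≠ 0)
    (hn : ∀ y ∈ s, 0 ≤ n y) (hext : IsExtremalOn (s : Set V) n) :
    ∃ t : ℝ, 0 < t ∧ t • n ∈ primitiveNormals L (PointedCone.hull ℝ (s : Set V)) := by
  obtain ⟨r, hr, hrint⟩ := hext.exists_isIntegral_smul hs h0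
  obtain ⟨g, hg, hint, l, hl, hlg⟩ := hrint.exists_inv_smul (smul_ne_zero hr.ne' h0)
  rw [smul_smul] at hint
  set t : ℝ := (g : ℝ)⁻¹ * r
  have ht : 0 < t := by positivity
  have htl : t * n l = 1 := by
    rw [mul_assoc, ← smul_eq_mul r, ← LinearMap.smul_apply, hlg, inv_mul_cancel₀ (by positivity)]
  refine ⟨t, ht, mem_dualCone_hull.2 fun y hy => mul_nonneg ht.le (hn y hy),
    smul_ne_zero ht.ne' h0, hint, fun ε hε0 hε1 hε => ?_, fun a ha b hb hab => ?_⟩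
  · obtain ⟨z, hz⟩ := hε l hl
    rw [LinearMap.smul_apply, LinearMap.smul_apply, smul_eq_mul, smul_eq_mul, htl, mul_one] at hz
    rw [hz] at hε0 hε1
    norm_cast at hε0 hε1
    lia
  · rw [mem_dualCone_hull] at ha hb
    have hab' : ∀ y, a y + b y = t * n y := LinearMap.congr_fun hab
    obtain ⟨c, rfl⟩ := hext a fun y hy hny =>
      le_antisymm (by linarith [hb y hy, (hab' y).trans (by rw [hny, mul_zero])]) (ha y hy)
    obtain ⟨y, hy, hny⟩ := exists_mem_apply_ne_zero hspan h0
    have hc : 0 ≤ c := nonneg_of_mul_nonneg_left (ha y hy) ((hn y hy).lt_of_ne' hny)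
    exact ⟨c / t, div_nonneg hc ht.le, by rw [smul_smul, div_mul_cancel₀ _ ht.ne']⟩

end PrimitiveNormals

section Dominates

variable {V : Type v} [NormedAddCommGroup V] [NormedSpace ℝ V] {L : Submodule ℤ V}
  {C : PointedCone ℝ V}

/-- The preorder on `V` defined by `A_u ⊆ A_v`, expressed by the integers `⌈⟨·, n⟩⌉` that
determine the conic modules; see `IsToricCone.dominates_iff`. -/
def Dominates (L : Submodule ℤ V) (C : PointedCone ℝ V) (u v : V) : Prop :=
  ∀ n ∈ primitiveNormals L C, ⌈n v⌉ ≤ ⌈n u⌉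

theorem dominates_refl (u : V) : Dominates L C u u := fun _ _ => le_rfl

theorem Dominates.trans {u v w : V} (h : Dominates L C u v) (h' : Dominates L C v w) :
    Dominates L C u w := fun n hn => (h' n hn).trans (h n hn)

theorem ceil_apply_add {n : Module.Dual ℝ V} (hn : n ∈ primitiveNormals L C) {m : V} (hm : m ∈ L)
    (u : V) : ⌈n (u + m)⌉ = ⌈n u⌉ + ⌈n m⌉ := by
  obtain ⟨z, hz⟩ := hn.2.2.1 m hm
  rw [map_add, hz, Int.ceil_add_intCast, Int.ceil_intCast]

theorem dominates_add_right_iff {u v m : V} (hm : m ∈ L) :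
    Dominates L C (u + m) (v + m) ↔ Dominates L C u v :=
  forall₂_congr fun n hn => by
    rw [ceil_apply_add hn hm, ceil_apply_add hn hm, add_le_add_iff_right]

end Dominates

namespace IsToricCone

variable {V : Type v} [NormedAddCommGroup V] [NormedSpace ℝ V] {L : Submodule ℤ V}
  {C : PointedCone ℝ V}

theorem exists_finset (hC : IsToricCone L C) :
    ∃ s : Finset V, (s : Set V) ⊆ L ∧ C = PointedCone.hull ℝ (s : Set V) ∧
      Submodule.span ℝ (s : Set V) = ⊤ := by
  obtain ⟨s, hs, hsL, rfl⟩ := hC.rational_polyhedral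
  obtain ⟨s, rfl⟩ := hs.exists_finset_coe
  refine ⟨s, hsL, rfl, top_le_iff.1 (hC.full_dimensional ▸ Submodule.span_le.2 ?_)⟩
  exact Submodule.span_le_restrictScalars _ ℝ (s : Set V)

theorem exists_interior_vector (hC : IsToricCone L C) :
    ∃ c ∈ L, ∀ n ∈ primitiveNormals L C, 0 < n c := by
  obtain ⟨s, hs, rfl, hspan⟩ := hC.exists_finset
  refine ⟨∑ y ∈ s, y, L.sum_mem fun y hy => hs hy, fun n hn => ?_⟩
  have hnonneg := mem_dualCone_hull.1 hn.1
  obtain ⟨y, hy, hny⟩ := exists_mem_apply_ne_zero hspan hn.2.1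
  rw [map_sum]
  exact Finset.sum_pos' hnonneg ⟨y, hy, (hnonneg y hy).lt_of_ne' hny⟩

variable [DiscreteTopology L] [IsZLattice ℝ L]

theorem finite_primitiveNormals (hC : IsToricCone L C) : (primitiveNormals L C).Finite := by
  classical
  obtain ⟨s, -, rfl, hspan⟩ := hC.exists_finset
  -- an extremal functional is determined by its zeros on the generators
  refine Set.Finite.of_finite_image (f := fun n => s.filter fun y => n y = 0)
    (s.powerset.finite_toSet.subset ?_) fun n hn n' hn' h => ?_
  · rintro _ ⟨n, -, rfl⟩
    exact Finset.mem_coe.2 (Finset.mem_powerset.2 (Finset.filter_subset _ _))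
  · exact eq_of_forall_apply_eq_zero hspan hn' hn fun y hy h0 =>
      (Finset.mem_filter.1 (h.ge (Finset.mem_filter.2 ⟨hy, h0⟩))).2

theorem exists_facet_vector (hC : IsToricCone L C) {n : Module.Dual ℝ V}
    (hn : n ∈ primitiveNormals L C) :
    ∃ y ∈ L, n y = 0 ∧ ∀ n' ∈ primitiveNormals L C, n' ≠ n → 0 < n' y := by
  classical
  obtain ⟨s, hs, rfl, hspan⟩ := hC.exists_finset
  refine ⟨∑ y ∈ s with n y = 0, y, L.sum_mem fun y hy => hs (Finset.mem_filter.1 hy).1, ?_,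
    fun n' hn' hne => ?_⟩
  · rw [map_sum]
    exact Finset.sum_eq_zero fun y hy => (Finset.mem_filter.1 hy).2
  · have hnonneg := mem_dualCone_hull.1 hn'.1
    rw [map_sum]
    refine Finset.sum_pos' (fun y hy => hnonneg y (Finset.mem_filter.1 hy).1) ?_
    by_contra! h
    exact hne (eq_of_forall_apply_eq_zero hspan hn hn' fun y hy h0 =>
      (h y (Finset.mem_filter.2 ⟨hy, h0⟩)).antisymm (hnonneg y hy))

variable [FiniteDimensional ℝ V]

theorem mem_iff (hC : IsToricCone L C) {x : V} : x ∈ C ↔ ∀ n ∈ primitiveNormals L C, 0 ≤ n x := by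
  refine ⟨fun hx n hn => hn.1 x hx, fun h => ?_⟩
  obtain ⟨s, hs, rfl, hspan⟩ := hC.exists_finset
  refine (mem_hull_iff_forall_isExtremalOn hspan).2 fun n h0 hn hext => ?_
  obtain ⟨t, ht, hnt⟩ := hext.exists_smul_mem_primitiveNormals hs hspan h0 hn
  exact nonneg_of_mul_nonneg_right (h _ hnt) ht

theorem mem_interior_iff (hC : IsToricCone L C) {x : V} :
    x ∈ interior (C : Set V) ↔ ∀ n ∈ primitiveNormals L C, 0 < n x := by
  constructor
  · intro hx n hn
    have hopen : IsOpenMap n := n.isOpenMap_of_finiteDimensional (n.surjective hn.2.1)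
    have himage : n '' interior (C : Set V) ⊆ Set.Ici 0 :=
      Set.image_subset_iff.2 fun y hy => hn.1 y (interior_subset hy)
    have hinterior := interior_maximal himage (hopen _ isOpen_interior)
    rw [interior_Ici] at hinterior
    exact hinterior (Set.mem_image_of_mem n hx)
  · intro h
    refine mem_interior.2 ⟨⋂ n ∈ primitiveNormals L C, {y | 0 < n y}, fun y hy => ?_, ?_, ?_⟩
    · exact hC.mem_iff.2 fun n hn => (Set.mem_iInter₂.1 hy n hn).le
    · exact hC.finite_primitiveNormals.isOpen_biInter fun n _ =>
        isOpen_lt continuous_const n.continuous_of_finiteDimensional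
    · exact Set.mem_iInter₂.2 h

theorem eq_zero (hC : IsToricCone L C) {x : V} (hx : ∀ n ∈ primitiveNormals L C, n x = 0) :
    x = 0 :=
  hC.pointed x (hC.mem_iff.2 fun n hn => (hx n hn).ge)
    (hC.mem_iff.2 fun n hn => by rw [map_neg, hx n hn, neg_zero])

theorem sub_mem_iff (hC : IsToricCone L C) {m : V} (hm : m ∈ L) (v : V) :
    m - v ∈ C ↔ ∀ n ∈ primitiveNormals L C, ⌈n v⌉ ≤ ⌈n m⌉ := by
  rw [hC.mem_iff]
  refine forall₂_congr fun n hn => ?_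
  obtain ⟨z, hz⟩ := hn.2.2.1 m hm
  rw [map_sub, sub_nonneg, hz, Int.ceil_intCast, Int.ceil_le]

theorem exists_sub_mem_apply_eq_ceil (hC : IsToricCone L C) {n : Module.Dual ℝ V}
    (hn : n ∈ primitiveNormals L C) (u : V) : ∃ m ∈ L, m - u ∈ C ∧ n m = ⌈n u⌉ := by
  obtain ⟨l, hl, hnl⟩ := exists_apply_eq_one hn
  obtain ⟨y, hy, hny, hpos⟩ := hC.exists_facet_vector hn
  obtain ⟨k, hk⟩ := exists_forall_apply_le_apply_nsmul
    (hC.finite_primitiveNormals.subset Set.sdiff_subset)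
    (fun n' hn' => hpos n' hn'.1 hn'.2) (u - ⌈n u⌉ • l) (N := primitiveNormals L C \ {n})
  have hnm : n (⌈n u⌉ • l + k • y) = ⌈n u⌉ := by
    rw [map_add, map_zsmul, map_nsmul, hnl, hny]
    simp
  refine ⟨⌈n u⌉ • l + k • y, L.add_mem (L.smul_mem _ hl) (L.nsmul_mem hy k),
    hC.mem_iff.2 fun n' hn' => ?_, hnm⟩
  rw [map_sub, sub_nonneg]
  by_cases hne : n' = n
  · rw [hne, hnm]
    exact Int.le_ceil _
  · have := hk n' ⟨hn', hne⟩
    rw [map_sub] at this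
    rw [map_add]
    linarith

theorem dominates_iff (hC : IsToricCone L C) {u v : V} :
    Dominates L C u v ↔ ∀ m ∈ L, m - u ∈ C → m - v ∈ C := by
  refine ⟨fun h m hm hmu => ?_, fun h n hn => ?_⟩
  · rw [hC.sub_mem_iff hm] at hmu ⊢
    exact fun n hn => (h n hn).trans (hmu n hn)
  · obtain ⟨m, hm, hmu, hnm⟩ := hC.exists_sub_mem_apply_eq_ceil hn u
    simpa only [hnm, Int.ceil_intCast] using (hC.sub_mem_iff hm v).1 (h m hm hmu) n hn

theorem mem_chamber_iff (hC : IsToricCone L C) {v w : V} :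
    w ∈ chamber L C v ↔ ∀ n ∈ primitiveNormals L C, ⌈n w⌉ = ⌈n v⌉ := by
  refine ⟨fun h n hn => le_antisymm ?_ ?_, fun h m hm => ⟨?_, ?_⟩⟩
  · exact hC.dominates_iff.2 (fun m hm => (h m hm).2) n hn
  · exact hC.dominates_iff.2 (fun m hm => (h m hm).1) n hn
  · exact hC.dominates_iff.1 (fun n hn => (h n hn).ge) m hm
  · exact hC.dominates_iff.1 (fun n hn => (h n hn).le) m hm

theorem eq_of_dominates (hC : IsToricCone L C) {v m m' : V} (hm : m ∈ L) (hm' : m' ∈ L)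
    (h : Dominates L C (v + m) (v + m')) (h' : Dominates L C (v + m') (v + m)) : m = m' := by
  refine sub_eq_zero.1 (hC.eq_zero fun n hn => ?_)
  have hceil := le_antisymm (h' n hn) (h n hn)
  rw [ceil_apply_add hn hm, ceil_apply_add hn hm', add_left_cancel_iff] at hceil
  obtain ⟨z, hz⟩ := hn.2.2.1 m hm
  obtain ⟨z', hz'⟩ := hn.2.2.1 m' hm'
  rw [hz, hz', Int.ceil_intCast, Int.ceil_intCast] at hceil
  rw [map_sub, hz, hz', hceil, sub_self]

theorem exists_mem_sub_mem (hC : IsToricCone L C) (v : V) : ∃ m ∈ L, m ∈ C ∧ m - v ∈ C := by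
  obtain ⟨c, hc, hpos⟩ := hC.exists_interior_vector
  obtain ⟨k, hk⟩ := exists_forall_apply_le_apply_nsmul hC.finite_primitiveNormals hpos v
  refine ⟨k • c, L.nsmul_mem hc k, hC.mem_iff.2 fun n hn => ?_, hC.mem_iff.2 fun n hn => ?_⟩
  · rw [map_nsmul]
    exact nsmul_nonneg (hpos n hn).le k
  · rw [map_sub, sub_nonneg]
    exact hk n hn

/-- Every open conic module is a conic module: push `x` slightly into the interior of the cone. -/
theorem exists_sub_mem_interior_iff (hC : IsToricCone L C) (x : V) :
    ∃ y : V, (∀ n ∈ primitiveNormals L C, ⌈n y⌉ = ⌊n x⌋ + 1) ∧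
      ∀ m ∈ L, (m - x ∈ interior (C : Set V) ↔ m - y ∈ C) := by
  obtain ⟨c, -, hc⟩ := hC.exists_interior_vector
  obtain ⟨η, hη, hlt⟩ := exists_pos_forall_apply_add_smul_lt hC.finite_primitiveNormals c
    fun n _ => Int.lt_floor_add_one (n x)
  have hceil : ∀ n ∈ primitiveNormals L C, ⌈n (x + η • c)⌉ = ⌊n x⌋ + 1 := by
    intro n hn
    rw [Int.ceil_eq_iff]
    push_cast
    refine ⟨?_, (hlt n hn).le⟩
    rw [map_add, map_smul, smul_eq_mul, add_sub_cancel_right]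
    linarith [Int.floor_le (n x), mul_pos hη (hc n hn)]
  refine ⟨x + η • c, hceil, fun m hm => ?_⟩
  rw [hC.sub_mem_iff hm, hC.mem_interior_iff]
  refine forall₂_congr fun n hn => ?_
  obtain ⟨z, hz⟩ := hn.2.2.1 m hm
  rw [hceil n hn, map_sub, sub_pos, hz, Int.ceil_intCast, ← Int.floor_lt, Int.add_one_le_iff]

end IsToricCone

/-! ### Conic modules and graded maps -/

open AddMonoidAlgebra (single)

section Monomial

variable {R M : Type*} [Semiring R]

theorem eq_of_coeff_single_ne_zero {m m' : M} {c : R} (h : (single m c).coeff m' ≠ 0) : m = m' :=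
  (Finsupp.single_apply_ne_zero.1 h).1.symm

theorem exists_of_coeff_mul_ne_zero [Add M] {F G : AddMonoidAlgebra R M} {m : M}
    (h : (F * G).coeff m ≠ 0) :
    ∃ m₁ m₂ : M, F.coeff m₁ ≠ 0 ∧ G.coeff m₂ ≠ 0 ∧ m₁ + m₂ = m := by
  classical
  obtain ⟨m₁, h₁, m₂, h₂, hm⟩ := Finset.mem_add.1
    (AddMonoidAlgebra.support_coeff_mul_subset F G (Finsupp.mem_support_iff.2 h))
  exact ⟨m₁, m₂, Finsupp.mem_support_iff.1 h₁, Finsupp.mem_support_iff.1 h₂, hm⟩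

theorem single_mul_single_neg [AddGroup M] {c d : R} (hcd : c * d = 1) (m : M) :
    (single m c * single (-m) d : AddMonoidAlgebra R M) = 1 := by
  rw [AddMonoidAlgebra.single_mul_single, add_neg_cancel, hcd, AddMonoidAlgebra.one_def]

theorem single_mul_right_injective [AddGroup M] (m : M) :
    Function.Injective (single m 1 * · : AddMonoidAlgebra R M → AddMonoidAlgebra R M) :=
  Function.LeftInverse.injective (g := (single (-m) 1 * ·)) fun F => by
    have h := single_mul_single_neg (mul_one (1 : R)) (-m)
    rw [neg_neg] at h
    simp only [← mul_assoc, h, one_mul]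

end Monomial

section Multiplier

variable {𝕜 : Type u} [Field 𝕜] {V : Type v} [NormedAddCommGroup V] [NormedSpace ℝ V]
  {L : Submodule ℤ V} {C : PointedCone ℝ V}

theorem mem_toricAlgebra {a : Laurent 𝕜 L} :
    a ∈ toricAlgebra 𝕜 L C ↔ ∀ m : L, a.coeff m ≠ 0 → (m : V) ∈ C :=
  forall_congr' fun m => by rw [Finsupp.mem_support_iff]

theorem mem_conicModule {v : V} {a : Laurent 𝕜 L} :
    a ∈ conicModule 𝕜 L C v ↔ ∀ m : L, a.coeff m ≠ 0 → (m : V) - v ∈ C :=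
  forall_congr' fun m => by rw [Finsupp.mem_support_iff]; rfl

theorem single_mem_toricAlgebra {m : L} (hm : (m : V) ∈ C) (c : 𝕜) :
    (single m c : Laurent 𝕜 L) ∈ toricAlgebra 𝕜 L C :=
  mem_toricAlgebra.2 fun _ h => eq_of_coeff_single_ne_zero h ▸ hm

theorem single_mem_conicModule {v : V} {m : L} (hm : (m : V) - v ∈ C) (c : 𝕜) :
    (single m c : Laurent 𝕜 L) ∈ conicModule 𝕜 L C v :=
  mem_conicModule.2 fun _ h => eq_of_coeff_single_ne_zero h ▸ hm

theorem smul_coe (r : toricAlgebra 𝕜 L C) (a : Laurent 𝕜 L) : r • a = (r : Laurent 𝕜 L) * a := rfl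

theorem dominates_of_coeff_single_ne_zero {u v : V} {m : L} {c : 𝕜} (h : Dominates L C (u + m) v)
    {m' : L} (hm' : (single m c : Laurent 𝕜 L).coeff m' ≠ 0) : Dominates L C (u + m') v :=
  eq_of_coeff_single_ne_zero hm' ▸ h

variable [FiniteDimensional ℝ V] [DiscreteTopology L] [IsZLattice ℝ L] (hC : IsToricCone L C)

namespace IsToricCone

include hC

theorem eq_of_forall_mul_eq {v : V} {F G : Laurent 𝕜 L}
    (h : ∀ a ∈ conicModule 𝕜 L C v, F * a = G * a) : F = G := by
  obtain ⟨m, hm, -, hmv⟩ := hC.exists_mem_sub_mem v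
  have hmono := h _ (single_mem_conicModule (m := ⟨m, hm⟩) hmv 1)
  rw [mul_comm, mul_comm G] at hmono
  exact single_mul_right_injective _ hmono

theorem exists_forall_add_mem (S : Finset V) : ∃ k ∈ L, k ∈ C ∧ ∀ x ∈ S, k + x ∈ C := by
  classical
  induction S using Finset.induction_on with
  | empty => exact ⟨0, L.zero_mem, C.zero_mem, by simp⟩
  | insert x S _ ih =>
    obtain ⟨k, hk, hkC, hkS⟩ := ih
    obtain ⟨k', hk', hkC', hkx⟩ := hC.exists_mem_sub_mem (-x)
    rw [sub_neg_eq_add] at hkx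
    refine ⟨k + k', L.add_mem hk hk', C.add_mem hkC hkC', fun y hy => ?_⟩
    obtain rfl | hy := Finset.mem_insert.1 hy
    · exact add_assoc k k' y ▸ C.add_mem hkC hkx
    · exact add_right_comm k y k' ▸ C.add_mem (hkS y hy) hkC'

theorem exists_single_sub_mul_mem (a : Laurent 𝕜 L) (m₀ : L) :
    ∃ k : L, (k : V) ∈ C ∧ single (k - m₀) 1 * a ∈ toricAlgebra 𝕜 L C := by
  classical
  obtain ⟨k, hk, hkC, hka⟩ := hC.exists_forall_add_mem
    (a.coeff.support.image fun m => ((m - m₀ : L) : V))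
  refine ⟨⟨k, hk⟩, hkC, mem_toricAlgebra.2 fun m hm => ?_⟩
  obtain ⟨m₁, m₂, h₁, h₂, rfl⟩ := exists_of_coeff_mul_ne_zero hm
  rw [← eq_of_coeff_single_ne_zero h₁, sub_add_eq_add_sub, add_sub_assoc]
  exact hka _ (Finset.mem_image_of_mem _ (Finsupp.mem_support_iff.2 h₂))

/-- A homomorphism out of `A_v` is determined by its value on one monomial, because every element of
`A_v` has a common multiple with that monomial over the toric algebra. -/
theorem exists_multiplier {v : V} (φ : conicModule 𝕜 L C v →ₗ[toricAlgebra 𝕜 L C] Laurent 𝕜 L) :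
    ∃ F : Laurent 𝕜 L, ∀ a, φ a = F * a := by
  obtain ⟨m, hm, -, hmv⟩ := hC.exists_mem_sub_mem v
  let m₀ : L := ⟨m, hm⟩
  let x₀ : conicModule 𝕜 L C v := ⟨single m₀ 1, single_mem_conicModule hmv 1⟩
  refine ⟨single (-m₀) 1 * φ x₀, fun a => ?_⟩
  obtain ⟨k, hk, hs⟩ := hC.exists_single_sub_mul_mem (a : Laurent 𝕜 L) m₀
  let r : toricAlgebra 𝕜 L C := ⟨single k 1, single_mem_toricAlgebra hk 1⟩
  let s : toricAlgebra 𝕜 L C := ⟨single (k - m₀) 1 * (a : Laurent 𝕜 L), hs⟩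
  have hrs : r • a = s • x₀ := Subtype.ext <| by
    change single k 1 * (a : Laurent 𝕜 L) = single (k - m₀) 1 * (a : Laurent 𝕜 L) * single m₀ 1
    rw [mul_right_comm, AddMonoidAlgebra.single_mul_single, sub_add_cancel, mul_one]
  refine single_mul_right_injective k ?_
  calc single k 1 * φ a
    _ = single (k - m₀) 1 * (a : Laurent 𝕜 L) * φ x₀ := by
        rw [← smul_coe s, ← map_smul, ← hrs, map_smul, smul_coe]
    _ = single k 1 * (single (-m₀) 1 * φ x₀ * (a : Laurent 𝕜 L)) := by
        rw [sub_eq_add_neg, mul_right_comm, mul_right_comm (single (-m₀) 1), ← mul_assoc,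
          ← mul_assoc, AddMonoidAlgebra.single_mul_single, mul_one, mul_right_comm]

end IsToricCone

/-- The Laurent polynomial by which a homomorphism of conic modules multiplies. -/
def IsToricCone.multiplier {u v : V} :
    (conicModule 𝕜 L C u →ₗ[toricAlgebra 𝕜 L C] conicModule 𝕜 L C v) →+ Laurent 𝕜 L :=
  have hspec (h : conicModule 𝕜 L C u →ₗ[toricAlgebra 𝕜 L C] conicModule 𝕜 L C v) :=
    (hC.exists_multiplier ((conicModule 𝕜 L C v).subtype.comp h)).choose_spec
  AddMonoidHom.mk' (fun h =>
      (hC.exists_multiplier ((conicModule 𝕜 L C v).subtype.comp h)).choose) fun h h' =>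
    hC.eq_of_forall_mul_eq fun a ha => by
      rw [add_mul, ← hspec h ⟨a, ha⟩, ← hspec h' ⟨a, ha⟩, ← hspec (h + h') ⟨a, ha⟩]
      rfl

namespace IsToricCone

theorem coe_apply {u v : V}
    (h : conicModule 𝕜 L C u →ₗ[toricAlgebra 𝕜 L C] conicModule 𝕜 L C v)
    (a : conicModule 𝕜 L C u) : (h a : Laurent 𝕜 L) = hC.multiplier h * a :=
  (hC.exists_multiplier ((conicModule 𝕜 L C v).subtype.comp h)).choose_spec a

theorem multiplier_eq {u v : V}
    {h : conicModule 𝕜 L C u →ₗ[toricAlgebra 𝕜 L C] conicModule 𝕜 L C v} {F : Laurent 𝕜 L}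
    (hF : ∀ a, (h a : Laurent 𝕜 L) = F * a) : hC.multiplier h = F :=
  hC.eq_of_forall_mul_eq fun a ha => (hC.coe_apply h ⟨a, ha⟩).symm.trans (hF ⟨a, ha⟩)

theorem dominates_of_multiplier {u v : V}
    {h : conicModule 𝕜 L C u →ₗ[toricAlgebra 𝕜 L C] conicModule 𝕜 L C v} {m : L}
    (hm : (hC.multiplier h).coeff m ≠ 0) : Dominates L C (u + m) v := by
  refine hC.dominates_iff.2 fun k hk hku => ?_
  have hmem : ((⟨k, hk⟩ - m : L) : V) - u ∈ C := by
    rwa [add_comm, ← sub_sub] at hku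
  have hmono := mem_conicModule.1 (h ⟨single _ 1, single_mem_conicModule hmem 1⟩).2 ⟨k, hk⟩
  rw [hC.coe_apply] at hmono
  have hcoeff := (hC.multiplier h).coeff_mul_single_add 1 (⟨k, hk⟩ - m) m
  rw [add_sub_cancel, mul_one] at hcoeff
  exact hmono (hcoeff.trans_ne hm)

include hC in
theorem mul_mem_of_dominates {u v : V} {F : Laurent 𝕜 L}
    (h : ∀ m : L, F.coeff m ≠ 0 → Dominates L C (u + m) v) {a : Laurent 𝕜 L}
    (ha : a ∈ conicModule 𝕜 L C u) : F * a ∈ conicModule 𝕜 L C v := by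
  refine mem_conicModule.2 fun m hm => ?_
  obtain ⟨m₁, m₂, h₁, h₂, rfl⟩ := exists_of_coeff_mul_ne_zero hm
  refine hC.dominates_iff.1 (h m₁ h₁) _ (m₁ + m₂).2 ?_
  rw [add_comm u, Submodule.coe_add, add_sub_add_left_eq_sub]
  exact mem_conicModule.1 ha m₂ h₂

theorem multiplier_comp {u v v' : V}
    (h' : conicModule 𝕜 L C v →ₗ[toricAlgebra 𝕜 L C] conicModule 𝕜 L C v')
    (h : conicModule 𝕜 L C u →ₗ[toricAlgebra 𝕜 L C] conicModule 𝕜 L C v) :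
    hC.multiplier (h'.comp h) = hC.multiplier h' * hC.multiplier h :=
  hC.multiplier_eq fun a => by
    rw [mul_assoc, ← hC.coe_apply, ← hC.coe_apply, LinearMap.comp_apply]

/-- Multiplication by the monomial `c x^m`, as a homomorphism `A_u → A_v`. -/
def monomialHom {u v : V} (m : L) (c : 𝕜) (h : Dominates L C (u + m) v) :
    conicModule 𝕜 L C u →ₗ[toricAlgebra 𝕜 L C] conicModule 𝕜 L C v where
  toFun a := ⟨single m c * a,
    hC.mul_mem_of_dominates (fun _ => dominates_of_coeff_single_ne_zero h) a.2⟩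
  map_add' _ _ := Subtype.ext (mul_add _ _ _)
  map_smul' r a := Subtype.ext (mul_left_comm (single m c) (r : Laurent 𝕜 L) a)

theorem multiplier_monomialHom {u v : V} {m : L} {c : 𝕜} (h : Dominates L C (u + m) v) :
    hC.multiplier (hC.monomialHom m c h) = single m c :=
  hC.multiplier_eq fun _ => rfl

end IsToricCone

/-- Conic modules are isomorphic precisely when the vectors are equivalent, that is, when they lie
in the same chamber up to a lattice translation; see `IsToricCone.nonempty_equiv_iff`. -/
def Equivalent (L : Submodule ℤ V) (C : PointedCone ℝ V) (u v : V) : Prop :=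
  ∃ m : L, Dominates L C (u + m) v ∧ Dominates L C v (u + m)

namespace IsToricCone

include hC

theorem equivalent_of_equiv {u v : V}
    (e : conicModule 𝕜 L C u ≃ₗ[toricAlgebra 𝕜 L C] conicModule 𝕜 L C v) :
    Equivalent L C u v := by
  let F := hC.multiplier e.toLinearMap
  let G := hC.multiplier e.symm.toLinearMap
  have hFG : F * G = 1 := hC.eq_of_forall_mul_eq (v := v) fun a ha => by
    rw [one_mul, mul_assoc, ← hC.coe_apply e.symm.toLinearMap ⟨a, ha⟩, ← hC.coe_apply]
    exact congrArg Subtype.val (e.apply_symm_apply ⟨a, ha⟩)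
  have hcoeff : (F * G).coeff 0 ≠ 0 := by
    rw [hFG, AddMonoidAlgebra.one_def, AddMonoidAlgebra.coeff_single, Finsupp.single_eq_same]
    exact one_ne_zero
  obtain ⟨m, m', hm, hm', hmm'⟩ := exists_of_coeff_mul_ne_zero hcoeff
  refine ⟨m, hC.dominates_of_multiplier hm, ?_⟩
  have hback := (dominates_add_right_iff m.2).2 (hC.dominates_of_multiplier hm')
  rwa [add_assoc, add_comm (m' : V), ← Submodule.coe_add, hmm', ZeroMemClass.coe_zero,
    add_zero] at hback

theorem nonempty_equiv_iff {u v : V} :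
    Nonempty (conicModule 𝕜 L C u ≃ₗ[toricAlgebra 𝕜 L C] conicModule 𝕜 L C v) ↔
      Equivalent L C u v := by
  refine ⟨fun ⟨e⟩ => hC.equivalent_of_equiv e, fun ⟨m, huv, hvu⟩ => ?_⟩
  have hvu' : Dominates L C (v + (-m : L)) u := by
    rw [← dominates_add_right_iff m.2, NegMemClass.coe_neg, neg_add_cancel_right]
    exact hvu
  refine ⟨LinearEquiv.ofLinearMap (hC.monomialHom m 1 huv) (hC.monomialHom (-m) 1 hvu')
    (LinearMap.ext fun a => Subtype.ext ?_) (LinearMap.ext fun a => Subtype.ext ?_)⟩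
  · change single m 1 * (single (-m) 1 * (a : Laurent 𝕜 L)) = (a : Laurent 𝕜 L)
    rw [← mul_assoc, single_mul_single_neg (mul_one 1), one_mul]
  · change single (-m) 1 * (single m 1 * (a : Laurent 𝕜 L)) = (a : Laurent 𝕜 L)
    rw [mul_left_comm, ← mul_assoc, single_mul_single_neg (mul_one 1), one_mul]

end IsToricCone

end Multiplier

section Symbol

variable {𝕜 : Type u} [Field 𝕜] {V : Type v} [NormedAddCommGroup V] [NormedSpace ℝ V]
  {L : Submodule ℤ V} {C : PointedCone ℝ V} {ι : Type} {w : ι → V} {u v : V}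

namespace projModule

/-- An element of `P_v`, as a linear map. -/
def toHom (f : projModule 𝕜 L C w v) :
    conicSum 𝕜 L C w →ₗ[toricAlgebra 𝕜 L C] conicModule 𝕜 L C v := f

theorem toHom_smul (g : (conicEnd 𝕜 L C w)ᵐᵒᵖ) (f : projModule 𝕜 L C w v)
    (a : conicSum 𝕜 L C w) : (g • f).toHom a = f.toHom (g.unop a) := rfl

theorem ext {f g : projModule 𝕜 L C w v} (h : ∀ a, f.toHom a = g.toHom a) : f = g := LinearMap.ext h

/-- The homomorphism `P_u → P_v` induced by a homomorphism `A_u → A_v`. -/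
def map (w : ι → V) (h : conicModule 𝕜 L C u →ₗ[toricAlgebra 𝕜 L C] conicModule 𝕜 L C v) :
    projModule 𝕜 L C w u →ₗ[(conicEnd 𝕜 L C w)ᵐᵒᵖ] projModule 𝕜 L C w v where
  toFun f := h.comp f.toHom
  map_add' _ _ := LinearMap.comp_add _ _ _
  map_smul' _ _ := rfl

/-- The restriction of `f : 𝔸 → A_v` to the `i`-th summand. -/
def restrict (f : projModule 𝕜 L C w v) (i : ι) :
    conicModule 𝕜 L C (w i) →ₗ[toricAlgebra 𝕜 L C] conicModule 𝕜 L C v :=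
  open Classical in
  f.toHom.comp (LinearMap.single (toricAlgebra 𝕜 L C) (fun i => conicModule 𝕜 L C (w i)) i)

theorem restrict_apply [inst : DecidableEq ι] (f : projModule 𝕜 L C w v) (i : ι)
    (a : conicModule 𝕜 L C (w i)) : f.restrict i a = f.toHom (Pi.single i a) := by
  obtain rfl : inst = fun a b => Classical.propDecidable (a = b) := Subsingleton.elim _ _
  rfl

/-- The `i`-th component of an endomorphism of `𝔸`. -/
def row (g : (conicEnd 𝕜 L C w)ᵐᵒᵖ) (i : ι) : projModule 𝕜 L C w (w i) :=
  (LinearMap.proj i).comp g.unop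

end projModule

variable [FiniteDimensional ℝ V] [DiscreteTopology L] [IsZLattice ℝ L] (hC : IsToricCone L C)

/-- The row of Laurent polynomials representing `f : 𝔸 → A_v`. -/
def symbol : projModule 𝕜 L C w v →+ ι → Laurent 𝕜 L :=
  AddMonoidHom.mk' (fun f i => hC.multiplier (f.restrict i)) fun f g =>
    funext fun i => map_add hC.multiplier (f.restrict i) (g.restrict i)

theorem toHom_single [DecidableEq ι] (f : projModule 𝕜 L C w v) (i : ι)
    (a : conicModule 𝕜 L C (w i)) :
    (f.toHom (Pi.single i a) : Laurent 𝕜 L) = symbol hC f i * (a : Laurent 𝕜 L) := by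
  rw [← projModule.restrict_apply]
  exact hC.coe_apply (f.restrict i) a

theorem dominates_of_symbol {f : projModule 𝕜 L C w v} {i : ι} {m : L}
    (h : (symbol hC f i).coeff m ≠ 0) : Dominates L C (w i + m) v :=
  hC.dominates_of_multiplier h

theorem symbol_map (h : conicModule 𝕜 L C u →ₗ[toricAlgebra 𝕜 L C] conicModule 𝕜 L C v)
    (f : projModule 𝕜 L C w u) (i : ι) :
    symbol hC (projModule.map w h f) i = hC.multiplier h * symbol hC f i :=
  hC.multiplier_comp h (f.restrict i)

variable [Fintype ι]

theorem toHom_apply (f : projModule 𝕜 L C w v) (a : conicSum 𝕜 L C w) :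
    (f.toHom a : Laurent 𝕜 L) = ∑ i, symbol hC f i * (a i : Laurent 𝕜 L) := by
  classical
  conv_lhs => rw [← Finset.univ_sum_single a]
  rw [map_sum, AddSubmonoidClass.coe_finsetSum]
  exact Finset.sum_congr rfl fun i _ => toHom_single hC f i (a i)

theorem symbol_eq {f : projModule 𝕜 L C w v} {F : ι → Laurent 𝕜 L}
    (h : ∀ a : conicSum 𝕜 L C w, (f.toHom a : Laurent 𝕜 L) = ∑ i, F i * (a i : Laurent 𝕜 L)) :
    symbol hC f = F := by
  classical
  refine funext fun i => hC.multiplier_eq fun a => ?_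
  rw [projModule.restrict_apply, h, Finset.sum_eq_single i]
  · rw [Pi.single_eq_same]
  · intro j _ hj
    rw [Pi.single_eq_of_ne hj, ZeroMemClass.coe_zero, mul_zero]
  · exact fun hi => absurd (Finset.mem_univ i) hi

theorem symbol_smul (g : (conicEnd 𝕜 L C w)ᵐᵒᵖ) (f : projModule 𝕜 L C w v) (j : ι) :
    symbol hC (g • f) j = ∑ i, symbol hC f i * symbol hC (projModule.row g i) j := by
  refine congrFun (symbol_eq hC (F := fun j => ∑ i, symbol hC f i *
    symbol hC (projModule.row g i) j) fun a => ?_) j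
  have hrow (i : ι) : (g.unop a i : Laurent 𝕜 L) =
      ∑ j, symbol hC (projModule.row g i) j * (a j : Laurent 𝕜 L) :=
    toHom_apply hC (projModule.row g i) a
  rw [projModule.toHom_smul, toHom_apply hC]
  simp only [hrow, Finset.sum_mul, Finset.mul_sum, mul_assoc]
  exact Finset.sum_comm

omit [Fintype ι]

variable [Finite ι]

theorem symbol_injective :
    Function.Injective (symbol hC : projModule 𝕜 L C w v → ι → Laurent 𝕜 L) := by
  cases nonempty_fintype ι
  exact fun f g h => projModule.ext fun a => Subtype.ext <| by
    rw [toHom_apply hC, toHom_apply hC, h]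

theorem exists_symbol_eq (F : ι → Laurent 𝕜 L)
    (hF : ∀ i (m : L), (F i).coeff m ≠ 0 → Dominates L C (w i + m) v) :
    ∃ f : projModule 𝕜 L C w v, symbol hC f = F := by
  cases nonempty_fintype ι
  let f : conicSum 𝕜 L C w →ₗ[toricAlgebra 𝕜 L C] conicModule 𝕜 L C v :=
    { toFun := fun a => ⟨∑ i, F i * (a i : Laurent 𝕜 L), Submodule.sum_mem _ fun i _ =>
        hC.mul_mem_of_dominates (hF i) (a i).2⟩
      map_add' := fun a b => Subtype.ext (by
        simp only [Pi.add_apply, Submodule.coe_add, mul_add, Finset.sum_add_distrib])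
      map_smul' := fun r a => Subtype.ext (by
        change ∑ i, F i * ((r : Laurent 𝕜 L) * (a i : Laurent 𝕜 L)) =
          (r : Laurent 𝕜 L) * ∑ i, F i * (a i : Laurent 𝕜 L)
        rw [Finset.mul_sum]
        exact Finset.sum_congr rfl fun i _ => mul_left_comm _ _ _) }
  exact ⟨f, symbol_eq hC fun _ => rfl⟩

theorem exists_symbol_eq_single [DecidableEq ι] {i : ι} {m : L} (h : Dominates L C (w i + m) v)
    (c : 𝕜) : ∃ f : projModule 𝕜 L C w v, symbol hC f = Pi.single i (single m c) := by
  refine exists_symbol_eq hC _ fun j m' hm' => ?_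
  obtain rfl | hj := eq_or_ne j i
  · rw [Pi.single_eq_same] at hm'
    exact dominates_of_coeff_single_ne_zero h hm'
  · rw [Pi.single_eq_of_ne hj] at hm'
    exact absurd rfl hm'

end Symbol

section Retract

variable {𝕜 : Type u} [Field 𝕜] {V : Type v} [NormedAddCommGroup V] [NormedSpace ℝ V]
  {L : Submodule ℤ V} {C : PointedCone ℝ V} {ι : Type} {w : ι → V}

namespace IsComplete

theorem exists_retract (hw : IsComplete 𝕜 L C w) (v : V) :
    ∃ (s : conicModule 𝕜 L C v →ₗ[toricAlgebra 𝕜 L C] conicSum 𝕜 L C w)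
      (p : projModule 𝕜 L C w v), ∀ a, p.toHom (s a) = a := by
  classical
  obtain ⟨i, ⟨e⟩⟩ := hw v
  let p : conicSum 𝕜 L C w →ₗ[toricAlgebra 𝕜 L C] conicModule 𝕜 L C v :=
    e.symm.toLinearMap.comp (LinearMap.proj i)
  refine ⟨(LinearMap.single (toricAlgebra 𝕜 L C) (fun i => conicModule 𝕜 L C (w i)) i).comp
    e.toLinearMap, p, fun a => ?_⟩
  change e.symm ((Pi.single i (e a) : conicSum 𝕜 L C w) i) = a
  rw [Pi.single_eq_same, e.symm_apply_apply]

theorem projective (hw : IsComplete 𝕜 L C w) (v : V) :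
    Module.Projective (conicEnd 𝕜 L C w)ᵐᵒᵖ (projModule 𝕜 L C w v) := by
  obtain ⟨s, p, hsp⟩ := hw.exists_retract v
  let j : projModule 𝕜 L C w v →ₗ[(conicEnd 𝕜 L C w)ᵐᵒᵖ] (conicEnd 𝕜 L C w)ᵐᵒᵖ :=
    { toFun := fun f => MulOpposite.op (s.comp f.toHom)
      map_add' := fun f g => congrArg MulOpposite.op (LinearMap.comp_add _ _ _)
      map_smul' := fun g f => rfl }
  have := Module.Free.self (conicEnd 𝕜 L C w)ᵐᵒᵖ
  have := Module.Projective.of_free (R := (conicEnd 𝕜 L C w)ᵐᵒᵖ) (P := (conicEnd 𝕜 L C w)ᵐᵒᵖ)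
  exact Module.Projective.of_split j (LinearMap.toSpanSingleton _ _ p) <|
    LinearMap.ext fun f => projModule.ext fun a => hsp (f.toHom a)

theorem exists_eq_mkQ_map (hw : IsComplete 𝕜 L C w) {u v : V}
    {N : Submodule (conicEnd 𝕜 L C w)ᵐᵒᵖ (projModule 𝕜 L C w v)}
    (φ : projModule 𝕜 L C w u →ₗ[(conicEnd 𝕜 L C w)ᵐᵒᵖ] projModule 𝕜 L C w v ⧸ N) :
    ∃ h : conicModule 𝕜 L C u →ₗ[toricAlgebra 𝕜 L C] conicModule 𝕜 L C v,
      φ = N.mkQ.comp (projModule.map w h) := by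
  obtain ⟨s, p, hsp⟩ := hw.exists_retract u
  obtain ⟨q, hq⟩ := N.mkQ_surjective (φ p)
  refine ⟨q.toHom.comp s, LinearMap.ext fun f => ?_⟩
  have hf : f = MulOpposite.op (s.comp f.toHom) • p :=
    projModule.ext fun a => (hsp (f.toHom a)).symm
  have hmap : projModule.map w (q.toHom.comp s) f = MulOpposite.op (s.comp f.toHom) • q := rfl
  rw [LinearMap.comp_apply, hmap, map_smul, hq, ← map_smul, ← hf]

end IsComplete

end Retract

section Radical

variable {𝕜 : Type u} [Field 𝕜] {V : Type v} [NormedAddCommGroup V] [NormedSpace ℝ V]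
  {L : Submodule ℤ V} {C : PointedCone ℝ V} {ι : Type} {w : ι → V} {u v : V}
  [FiniteDimensional ℝ V] [DiscreteTopology L] [IsZLattice ℝ L] (hC : IsToricCone L C)

theorem exists_dominates_of_coeff_mul_symbol {G : Laurent 𝕜 L} {f : projModule 𝕜 L C w u} {i : ι}
    {k : L} (hk : (G * symbol hC f i).coeff k ≠ 0) :
    ∃ m : L, G.coeff m ≠ 0 ∧ Dominates L C (w i + k) (u + m) := by
  obtain ⟨m, m', hm, hm', rfl⟩ := exists_of_coeff_mul_ne_zero hk
  refine ⟨m, hm, ?_⟩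
  have hdom := (dominates_add_right_iff m.2).2 (dominates_of_symbol hC hm')
  rwa [add_assoc, add_comm (m' : V)] at hdom

/-- The graded radical of `P_v`: the homomorphisms `𝔸 → A_v` none of whose monomials is an
isomorphism from a summand onto `A_v`. -/
def gradedRadical [Finite ι] (w : ι → V) (v : V) :
    Submodule (conicEnd 𝕜 L C w)ᵐᵒᵖ (projModule 𝕜 L C w v) where
  carrier := {f | ∀ i (m : L), (symbol hC f i).coeff m ≠ 0 → ¬ Dominates L C v (w i + m)}
  zero_mem' i m h := absurd (by rw [map_zero]; rfl) h
  add_mem' {f g} hf hg i m h := by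
    rw [map_add, Pi.add_apply, AddMonoidAlgebra.coeff_add, Finsupp.add_apply] at h
    by_cases hfm : (symbol hC f i).coeff m = 0
    · rw [hfm, zero_add] at h
      exact hg i m h
    · exact hf i m hfm
  smul_mem' g f hf j k h hv := by
    cases nonempty_fintype ι
    rw [symbol_smul hC, AddMonoidAlgebra.coeff_sum, Finsupp.finsetSum_apply] at h
    obtain ⟨i, -, hi⟩ := Finset.exists_ne_zero_of_sum_ne_zero h
    obtain ⟨m, hm, hdom⟩ := exists_dominates_of_coeff_mul_symbol hC hi
    exact hf i m hm (hv.trans hdom)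

section

variable [Finite ι]

theorem mem_gradedRadical {f : projModule 𝕜 L C w v} :
    f ∈ gradedRadical hC w v ↔
      ∀ i (m : L), (symbol hC f i).coeff m ≠ 0 → ¬ Dominates L C v (w i + m) := Iff.rfl

theorem map_mem_gradedRadical
    {h : conicModule 𝕜 L C u →ₗ[toricAlgebra 𝕜 L C] conicModule 𝕜 L C v}
    (hh : ∀ m : L, (hC.multiplier h).coeff m ≠ 0 → ¬ Dominates L C v (u + m))
    (f : projModule 𝕜 L C w u) : projModule.map w h f ∈ gradedRadical hC w v := by
  intro i k hk hvk
  rw [symbol_map] at hk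
  obtain ⟨m, hm, hdom⟩ := exists_dominates_of_coeff_mul_symbol hC hk
  exact hh m hm (hvk.trans hdom)

end

theorem coeff_symbol_eq_zero_of_ne {f : projModule 𝕜 L C w v} {m : L}
    (hf : IsHomogeneousOfDegree f m) (i : ι) {m' : L} (hm' : m' ≠ m) :
    (symbol hC f i).coeff m' = 0 := by
  classical
  obtain ⟨k, hk, -, hkw⟩ := hC.exists_mem_sub_mem (w i)
  let n : L := ⟨k, hk⟩
  let x : conicModule 𝕜 L C (w i) := ⟨single n 1, single_mem_conicModule hkw 1⟩
  have hx : ∀ j, ((Pi.single i x : conicSum 𝕜 L C w) j : Laurent 𝕜 L).coeff.support ⊆ {n} := by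
    intro j
    obtain rfl | hj := eq_or_ne j i
    · rw [Pi.single_eq_same]
      exact Finsupp.support_single_subset
    · rw [Pi.single_eq_of_ne hj]
      exact fun _ h => absurd rfl (Finsupp.mem_support_iff.1 h)
  have hsupp := hf n _ hx
  change (f.toHom (Pi.single i x) : Laurent 𝕜 L).coeff.support ⊆ _ at hsupp
  rw [toHom_single hC] at hsupp
  by_contra hne
  have hmem := @hsupp (n + m') <| Finsupp.mem_support_iff.2 <| by
    rwa [add_comm, AddMonoidAlgebra.coeff_mul_single_add, mul_one]
  exact hm' (add_left_cancel (Finset.mem_singleton.1 hmem))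

theorem isHomogeneousOfDegree_of_symbol [Finite ι] {f : projModule 𝕜 L C w v} {m : L}
    (h : ∀ i (m' : L), (symbol hC f i).coeff m' ≠ 0 → m' = m) : IsHomogeneousOfDegree f m := by
  cases nonempty_fintype ι
  intro n a ha k hk
  rw [Finsupp.mem_support_iff] at hk
  change (f.toHom a : Laurent 𝕜 L).coeff k ≠ 0 at hk
  rw [toHom_apply hC, AddMonoidAlgebra.coeff_sum, Finsupp.finsetSum_apply] at hk
  obtain ⟨i, -, hi⟩ := Finset.exists_ne_zero_of_sum_ne_zero hk
  obtain ⟨m₁, m₂, h₁, h₂, rfl⟩ := exists_of_coeff_mul_ne_zero hi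
  rw [h i m₁ h₁, Finset.mem_singleton.1 (ha i (Finsupp.mem_support_iff.2 h₂)), add_comm]
  exact Finset.mem_singleton_self _

/-- A monomial isomorphism `g` from a summand onto `A_v` generates `P_v`, since any `f : 𝔸 → A_v`
factors through it. -/
theorem exists_smul_eq {g : projModule 𝕜 L C w v} {i : ι} {m : L} {c : 𝕜} (hc : c ≠ 0)
    (hg : symbol hC g i = single m c) (hv : Dominates L C v (w i + m))
    (f : projModule 𝕜 L C w v) : ∃ E : (conicEnd 𝕜 L C w)ᵐᵒᵖ, E • g = f := by
  classical
  have hdom : Dominates L C (v + (-m : L)) (w i) := by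
    rwa [← dominates_add_right_iff m.2, NegMemClass.coe_neg, neg_add_cancel_right]
  let E : conicEnd 𝕜 L C w :=
    (LinearMap.single (toricAlgebra 𝕜 L C) (fun i => conicModule 𝕜 L C (w i)) i).comp
      ((hC.monomialHom (-m) c⁻¹ hdom).comp f.toHom)
  refine ⟨MulOpposite.op E, projModule.ext fun a => Subtype.ext ?_⟩
  rw [projModule.toHom_smul]
  change (g.toHom (Pi.single i (hC.monomialHom (-m) c⁻¹ hdom (f.toHom a))) : Laurent 𝕜 L) =
    (f.toHom a : Laurent 𝕜 L)
  rw [toHom_single hC, hg, hC.coe_apply, hC.multiplier_monomialHom, ← mul_assoc,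
    single_mul_single_neg (mul_inv_cancel₀ hc), one_mul]

section

variable [Finite ι]

theorem eq_top_of_isHomogeneousOfDegree
    {N : Submodule (conicEnd 𝕜 L C w)ᵐᵒᵖ (projModule 𝕜 L C w v)} {g : projModule 𝕜 L C w v}
    (hg : g ∈ N) {m : L} (hgm : IsHomogeneousOfDegree g m) (hgN : g ∉ gradedRadical hC w v) :
    N = ⊤ := by
  rw [mem_gradedRadical] at hgN
  push Not at hgN
  obtain ⟨i, m', hi, hv⟩ := hgN
  obtain rfl : m' = m := of_not_not (mt (coeff_symbol_eq_zero_of_ne hC hgm i) hi)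
  have hsingle : symbol hC g i = single m' ((symbol hC g i).coeff m') := by
    refine AddMonoidAlgebra.ext (Finsupp.eq_single_iff.2 ⟨fun k hk => ?_, rfl⟩)
    refine Finset.mem_singleton.2 (of_not_not fun hkm => ?_)
    exact Finsupp.mem_support_iff.1 hk (coeff_symbol_eq_zero_of_ne hC hgm i hkm)
  refine eq_top_iff.2 fun f _ => ?_
  obtain ⟨E, rfl⟩ := exists_smul_eq hC hi hsingle hv f
  exact N.smul_mem E hg

theorem exists_eq_sum_monomials (f : projModule 𝕜 L C w v) [Fintype ι] [DecidableEq ι] :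
    ∃ g : ι → L → projModule 𝕜 L C w v,
      (∀ i m, symbol hC (g i m) = Pi.single i (single m ((symbol hC f i).coeff m))) ∧
      f = ∑ i, ∑ m ∈ (symbol hC f i).coeff.support, g i m := by
  have hex (i : ι) (m : L) : ∃ g : projModule 𝕜 L C w v,
      symbol hC g = Pi.single i (single m ((symbol hC f i).coeff m)) := by
    by_cases hm : (symbol hC f i).coeff m = 0
    · exact ⟨0, by rw [map_zero, hm, AddMonoidAlgebra.single_zero, Pi.single_zero]⟩
    · exact exists_symbol_eq_single hC (dominates_of_symbol hC hm) _
  choose g hg using hex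
  refine ⟨g, hg, symbol_injective hC ?_⟩
  simp only [map_sum, hg]
  calc symbol hC f
    _ = ∑ i, Pi.single i (symbol hC f i) := (Finset.univ_sum_single _).symm
    _ = _ := Finset.sum_congr rfl fun i _ => by
        conv_lhs => rw [← AddMonoidAlgebra.sum_coeff_single (symbol hC f i)]
        exact map_sum (AddMonoidHom.single (fun _ : ι => Laurent 𝕜 L) i) _ _

theorem isGraded_gradedRadical (v : V) : IsGraded (gradedRadical (𝕜 := 𝕜) hC w v) := by
  classical
  cases nonempty_fintype ι
  intro f hf
  obtain ⟨g, hg, hsum⟩ := exists_eq_sum_monomials hC f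
  have hcoeff {i : ι} {m : L} {j : ι} {m' : L} (h : (symbol hC (g i m) j).coeff m' ≠ 0) :
      m' = m ∧ (symbol hC f j).coeff m' ≠ 0 := by
    rw [hg] at h
    obtain rfl | hj := eq_or_ne j i
    · rw [Pi.single_eq_same] at h
      obtain rfl := eq_of_coeff_single_ne_zero h
      rw [AddMonoidAlgebra.coeff_single, Finsupp.single_eq_same] at h
      exact ⟨rfl, h⟩
    · rw [Pi.single_eq_of_ne hj] at h
      exact absurd rfl h
  rw [hsum]
  refine sum_mem fun i _ => sum_mem fun m _ => AddSubgroup.subset_closure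
    ⟨fun j m' h => hf j m' (hcoeff h).2, m, ?_⟩
  exact isHomogeneousOfDegree_of_symbol hC fun j m' h => (hcoeff h).1

omit [Finite ι] in
include hC in
theorem IsComplete.exists_translate (hw : IsComplete 𝕜 L C w) (v : V) :
    ∃ (i : ι) (m : L), Dominates L C (w i + m) v ∧ Dominates L C v (w i + m) := by
  obtain ⟨i, ⟨e⟩⟩ := hw v
  exact ⟨i, hC.equivalent_of_equiv e.symm⟩

theorem IsComplete.gradedRadical_ne_top (hw : IsComplete 𝕜 L C w) (v : V) :
    gradedRadical (𝕜 := 𝕜) hC w v ≠ ⊤ := by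
  classical
  intro htop
  obtain ⟨i, m, hwv, hvw⟩ := hw.exists_translate hC v
  obtain ⟨f, hf⟩ := exists_symbol_eq_single hC hwv (1 : 𝕜)
  refine (mem_gradedRadical hC).1 (htop ▸ Submodule.mem_top : f ∈ _) i m ?_ hvw
  rw [hf, Pi.single_eq_same, AddMonoidAlgebra.coeff_single, Finsupp.single_eq_same]
  exact one_ne_zero

theorem IsComplete.maximalGradedSubmodule_eq (hw : IsComplete 𝕜 L C w) (v : V) :
    maximalGradedSubmodule 𝕜 L C w v = gradedRadical hC w v := by
  refine le_antisymm (sSup_le ?_)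
    (le_sSup ⟨isGraded_gradedRadical hC v, hw.gradedRadical_ne_top hC v⟩)
  rintro N ⟨hN, hNtop⟩ f hf
  refine (AddSubgroup.closure_le (gradedRadical (𝕜 := 𝕜) hC w v).toAddSubgroup).2 ?_ (hN f hf)
  rintro g ⟨hg, m, hgm⟩
  exact of_not_not fun hgN => hNtop (eq_top_of_isHomogeneousOfDegree hC hg hgm hgN)

end

end Radical

section HomSimple

open scoped ModuleCat

variable {𝕜 : Type u} [Field 𝕜] {V : Type v} [NormedAddCommGroup V] [NormedSpace ℝ V]
  {L : Submodule ℤ V} {C : PointedCone ℝ V} {ι : Type} {w : ι → V} {u u' v : V}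
  [FiniteDimensional ℝ V] [DiscreteTopology L] [IsZLattice ℝ L] (hC : IsToricCone L C)

/-- The inclusion `P_u → P_v` induced by `A_u ⊆ A_v`, with junk value zero when `A_u` is not
contained in `A_v`. -/
def incl (𝕜 : Type u) [Field 𝕜] (w : ι → V) (u v : V) :
    projModule 𝕜 L C w u →ₗ[(conicEnd 𝕜 L C w)ᵐᵒᵖ] projModule 𝕜 L C w v :=
  open Classical in
  if h : Dominates L C (u + (0 : L)) v then projModule.map w (hC.monomialHom 0 1 h) else 0

theorem incl_eq (h : Dominates L C (u + (0 : L)) v) :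
    incl hC 𝕜 w u v = projModule.map w (hC.monomialHom 0 1 h) :=
  dif_pos h

theorem symbol_incl (h : Dominates L C u v) (f : projModule 𝕜 L C w u) :
    symbol hC (incl hC 𝕜 w u v f) = symbol hC f := by
  funext i
  rw [incl_eq hC (by rwa [ZeroMemClass.coe_zero, add_zero]), symbol_map,
    hC.multiplier_monomialHom, ← AddMonoidAlgebra.one_def, one_mul]

theorem algebraMap_smul_map_monomialHom {m : L} (h : Dominates L C (u + m) v) (c : 𝕜)
    (f : projModule 𝕜 L C w u) :
    algebraMap 𝕜 (conicEnd 𝕜 L C w)ᵐᵒᵖ c • projModule.map w (hC.monomialHom m 1 h) f =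
      projModule.map w (hC.monomialHom m c h) f := by
  refine projModule.ext fun a => Subtype.ext ?_
  rw [projModule.toHom_smul]
  change single m 1 * (f.toHom (c • a) : Laurent 𝕜 L) = single m c * (f.toHom a : Laurent 𝕜 L)
  rw [f.toHom.map_smul_of_tower]
  change single m 1 * (c • (f.toHom a : Laurent 𝕜 L)) = _
  rw [mul_smul_comm, ← smul_mul_assoc, AddMonoidAlgebra.smul_single, smul_eq_mul, mul_one]

/-- The homomorphism `P_u → S_v` induced by a homomorphism `A_u → A_v`. -/
def projModule.toSimple (w : ι → V)
    (h : conicModule 𝕜 L C u →ₗ[toricAlgebra 𝕜 L C] conicModule 𝕜 L C v) :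
    projModule 𝕜 L C w u →ₗ[(conicEnd 𝕜 L C w)ᵐᵒᵖ] simpleModule 𝕜 L C w v :=
  (maximalGradedSubmodule 𝕜 L C w v).mkQ.comp (projModule.map w h)

namespace IsComplete

variable [Finite ι] (hw : IsComplete 𝕜 L C w)
include hw

omit [FiniteDimensional ℝ V] [DiscreteTopology L] [IsZLattice ℝ L] [Finite ι] in
theorem exists_eq_toSimple
    (φ : projModule 𝕜 L C w u →ₗ[(conicEnd 𝕜 L C w)ᵐᵒᵖ] simpleModule 𝕜 L C w v) :
    ∃ h : conicModule 𝕜 L C u →ₗ[toricAlgebra 𝕜 L C] conicModule 𝕜 L C v,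
      φ = projModule.toSimple w h :=
  hw.exists_eq_mkQ_map (N := maximalGradedSubmodule 𝕜 L C w v) φ

include hC in
theorem toSimple_eq_zero
    {h : conicModule 𝕜 L C u →ₗ[toricAlgebra 𝕜 L C] conicModule 𝕜 L C v}
    (hh : ∀ m : L, (hC.multiplier h).coeff m ≠ 0 → ¬ Dominates L C v (u + m)) :
    projModule.toSimple w h = 0 := by
  refine LinearMap.ext fun f => (Submodule.Quotient.mk_eq_zero _).2 ?_
  rw [hw.maximalGradedSubmodule_eq hC]
  exact map_mem_gradedRadical hC hh f

theorem comp_incl_eq_zero (h : Dominates L C u' u) (h' : ¬ Dominates L C u u')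
    (φ : projModule 𝕜 L C w u →ₗ[(conicEnd 𝕜 L C w)ᵐᵒᵖ] simpleModule 𝕜 L C w v) :
    φ.comp (incl hC 𝕜 w u' u) = 0 := by
  obtain ⟨g, rfl⟩ := hw.exists_eq_toSimple φ
  have h₀ : Dominates L C (u' + (0 : L)) u := by rwa [ZeroMemClass.coe_zero, add_zero]
  rw [incl_eq hC h₀]
  refine hw.toSimple_eq_zero hC (h := g.comp (hC.monomialHom 0 1 h₀)) fun m hm hvm => h' ?_
  rw [hC.multiplier_comp, hC.multiplier_monomialHom, ← AddMonoidAlgebra.one_def, mul_one] at hm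
  exact (dominates_add_right_iff m.2).1 ((hC.dominates_of_multiplier hm).trans hvm)

include hC in
theorem hom_simpleModule_eq_zero (h : ¬ Equivalent L C u v)
    (φ : projModule 𝕜 L C w u →ₗ[(conicEnd 𝕜 L C w)ᵐᵒᵖ] simpleModule 𝕜 L C w v) : φ = 0 := by
  obtain ⟨g, rfl⟩ := hw.exists_eq_toSimple φ
  exact hw.toSimple_eq_zero hC fun m hm hvm => h ⟨m, hC.dominates_of_multiplier hm, hvm⟩

theorem toSimple_monomialHom_ne_zero {m : L} (huv : Dominates L C (u + m) v)
    (hvu : Dominates L C v (u + m)) :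
    projModule.toSimple w (hC.monomialHom m (1 : 𝕜) huv) ≠ 0 := by
  classical
  intro hzero
  obtain ⟨i, n, hwu, huw⟩ := hw.exists_translate hC u
  obtain ⟨f, hf⟩ := exists_symbol_eq_single hC hwu (1 : 𝕜)
  have hmem := (Submodule.Quotient.mk_eq_zero _).1 (LinearMap.congr_fun hzero f)
  rw [hw.maximalGradedSubmodule_eq hC] at hmem
  refine hmem i (n + m) ?_ (hvu.trans ?_)
  · rw [symbol_map, hC.multiplier_monomialHom, hf, Pi.single_eq_same,
      AddMonoidAlgebra.single_mul_single, add_comm, AddMonoidAlgebra.coeff_single,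
      Finsupp.single_eq_same, one_mul]
    exact one_ne_zero
  · rw [Submodule.coe_add, ← add_assoc]
    exact (dominates_add_right_iff m.2).2 huw

theorem exists_eq_toSimple_monomialHom {m : L} (huv : Dominates L C (u + m) v)
    (hvu : Dominates L C v (u + m))
    (φ : projModule 𝕜 L C w u →ₗ[(conicEnd 𝕜 L C w)ᵐᵒᵖ] simpleModule 𝕜 L C w v) :
    ∃ c : 𝕜, φ = projModule.toSimple w (hC.monomialHom m c huv) := by
  obtain ⟨g, rfl⟩ := hw.exists_eq_toSimple φ
  let c := (hC.multiplier g).coeff m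
  have hsub : projModule.toSimple w (g - hC.monomialHom m c huv) =
      projModule.toSimple w g - projModule.toSimple w (hC.monomialHom m c huv) := by
    refine LinearMap.ext fun f => ?_
    exact map_sub (maximalGradedSubmodule 𝕜 L C w v).mkQ
      (projModule.map w g f) (projModule.map w (hC.monomialHom m c huv) f)
  refine ⟨c, sub_eq_zero.1 (hsub.symm.trans (hw.toSimple_eq_zero hC fun n hn hvn => ?_))⟩
  have hnm : n = m := Subtype.ext <| hC.eq_of_dominates n.2 m.2
    ((hC.dominates_of_multiplier hn).trans hvu) (huv.trans hvn)
  refine hn ?_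
  rw [hnm, map_sub, hC.multiplier_monomialHom, AddMonoidAlgebra.coeff_sub, Finsupp.sub_apply,
    AddMonoidAlgebra.coeff_single, Finsupp.single_eq_same, sub_self]

include hC in
theorem rank_hom_simpleModule [Decidable (Equivalent L C u v)] :
    Module.rank 𝕜 (projModule 𝕜 L C w u →ₗ[(conicEnd 𝕜 L C w)ᵐᵒᵖ] simpleModule 𝕜 L C w v) =
      if Equivalent L C u v then 1 else 0 := by
  split_ifs with h
  · obtain ⟨m, huv, hvu⟩ := h
    refine rank_eq_one _ (hw.toSimple_monomialHom_ne_zero hC huv hvu) fun φ => ?_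
    obtain ⟨c, rfl⟩ := hw.exists_eq_toSimple_monomialHom hC huv hvu φ
    refine ⟨c, LinearMap.ext fun f => ?_⟩
    exact congrArg (maximalGradedSubmodule 𝕜 L C w v).mkQ
      (algebraMap_smul_map_monomialHom hC huv c f)
  · have : Subsingleton
        (projModule 𝕜 L C w u →ₗ[(conicEnd 𝕜 L C w)ᵐᵒᵖ] simpleModule 𝕜 L C w v) :=
      subsingleton_of_forall_eq 0 (hw.hom_simpleModule_eq_zero hC h)
    exact rank_subsingleton' _ _

end IsComplete

end HomSimple

/-! ### The cellular resolution -/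

section IncidenceVecMul

open scoped Matrix

variable {V ν : Type*} [NormedAddCommGroup V] [NormedSpace ℝ V] [Finite ν] {P : RelPolyhedron V ν}
  {ε : Matrix P.Face P.Face ℤ} (hε : P.IsIncidence ε) {R : Type*} [Ring R] {b b' : P.Face → R}
  {J : P.Face}
include hε

theorem RelPolyhedron.IsIncidence.vecMul_map_apply_congr
    (h : ∀ I, J ≤ I → P.codim I = P.codim J + 1 → b I = b' I) :
    (b ᵥ* ε.map Int.cast) J = (b' ᵥ* ε.map Int.cast) J := by
  refine Finset.sum_congr rfl fun I _ => ?_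
  change b I * (ε I J : R) = b' I * (ε I J : R)
  by_cases hIJ : ε I J = 0
  · rw [hIJ, Int.cast_zero, mul_zero, mul_zero]
  · obtain ⟨hJI, hcodim⟩ := hε.of_ne_zero hIJ
    rw [h I hJI hcodim]

theorem RelPolyhedron.IsIncidence.vecMul_map_apply_eq_zero
    (h : ∀ I, J ≤ I → P.codim I = P.codim J + 1 → b I = 0) : (b ᵥ* ε.map Int.cast) J = 0 :=
  (hε.vecMul_map_apply_congr (b' := 0) h).trans (congrFun (Matrix.zero_vecMul _) J)

end IncidenceVecMul

section ChamberPolyhedron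

open Topology

variable {V : Type v} [NormedAddCommGroup V] [NormedSpace ℝ V] [FiniteDimensional ℝ V]
  (L : Submodule ℤ V) (C : PointedCone ℝ V) [Finite (primitiveNormals L C)] (u v : V)

/-- The chamber of `v`, as a relative polyhedron: its non-strict inequalities `⟨x, n⟩ ≤ d_n` are
the half-spaces, and its strict inequalities `d_n - 1 < ⟨x, n⟩` cut out the ambient open set. -/
def chamberPolyhedron : RelPolyhedron V (primitiveNormals L C) where
  domain := {x | ∀ n : primitiveNormals L C, (⌈n.1 v⌉ : ℝ) - 1 < n.1 x}
  isOpen_domain := by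
    rw [Set.ofPred_forall]
    exact isOpen_iInter_of_finite fun n =>
      isOpen_lt continuous_const n.1.continuous_of_finiteDimensional
  convex_domain := by
    rw [Set.ofPred_forall]
    exact convex_iInter fun n => convex_halfSpace_gt n.1.isLinear _
  form n := n
  bound n := ⌈n.1 v⌉

variable {L C u v}

theorem mem_domain_chamberPolyhedron_iff :
    u ∈ (chamberPolyhedron L C v).domain ↔ Dominates L C u v :=
  Subtype.forall.trans <| forall₂_congr fun _ _ => Int.le_ceil_iff.symm

theorem violated_chamberPolyhedron_eq_empty_iff :
    (chamberPolyhedron L C v).violated u = ∅ ↔ Dominates L C v u := by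
  rw [Set.eq_empty_iff_forall_notMem, Subtype.forall]
  refine forall₂_congr fun n _ => ?_
  exact (show ¬ (⌈n v⌉ : ℝ) < n u ↔ _ from not_lt).trans Int.ceil_le.symm

theorem IsToricCone.exists_active_eq_empty (hC : IsToricCone L C) (h : Dominates L C u v) :
    ∃ u' ∈ (chamberPolyhedron L C v).domain, (chamberPolyhedron L C v).active u' = ∅ ∧
      (chamberPolyhedron L C v).violated u' = (chamberPolyhedron L C v).violated u := by
  obtain ⟨c, -, hc⟩ := hC.exists_interior_vector
  obtain ⟨δ, hdomain, hactive, hviolated⟩ :=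
    (RelPolyhedron.eventually_add_smul (mem_domain_chamberPolyhedron_iff.2 h) (-c)).exists
  have hneg (n : primitiveNormals L C) : (chamberPolyhedron L C v).form n (-c) < 0 := by
    rw [map_neg]
    exact neg_lt_zero.2 (hc n n.2)
  refine ⟨_, hdomain, hactive.trans ?_, hviolated.trans (Set.union_eq_left.2 ?_)⟩
  · exact Set.eq_empty_iff_forall_notMem.2 fun n hn => (hneg n).ne hn.2
  · exact fun n hn => absurd hn.2 (hneg n).not_gt

theorem IsToricCone.exists_mem_carrier_active_eq_empty (hC : IsToricCone L C) (v : V) :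
    ∃ x ∈ (chamberPolyhedron L C v).carrier, (chamberPolyhedron L C v).active x = ∅ := by
  obtain ⟨x, hx, hactive, hviolated⟩ := hC.exists_active_eq_empty (dominates_refl v)
  rw [violated_chamberPolyhedron_eq_empty_iff.2 (dominates_refl v)] at hviolated
  exact ⟨x, ⟨hx, hviolated⟩, hactive⟩

/-- The open conic module of the cell with active set `I` is `A_{y I}`; see
`IsToricCone.exists_isCellPoint`. -/
structure IsCellPoint (v : V) (y : (chamberPolyhedron L C v).Face → V) : Prop where
  ceil_of_mem {I : (chamberPolyhedron L C v).Face} {n : primitiveNormals L C} (hn : n ∈ I.1) :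
    ⌈n.1 (y I)⌉ = ⌈n.1 v⌉ + 1
  ceil_of_notMem {I : (chamberPolyhedron L C v).Face} {n : primitiveNormals L C} (hn : n ∉ I.1) :
    ⌈n.1 (y I)⌉ = ⌈n.1 v⌉

theorem floor_add_one_of_mem_active {x : V} {n : primitiveNormals L C}
    (hn : n ∈ (chamberPolyhedron L C v).active x) : ⌊n.1 x⌋ + 1 = ⌈n.1 v⌉ + 1 := by
  change n.1 x = ⌈n.1 v⌉ at hn
  rw [hn, Int.floor_intCast]

theorem floor_add_one_of_notMem_active {x : V} (hx : x ∈ (chamberPolyhedron L C v).carrier)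
    {n : primitiveNormals L C} (hn : n ∉ (chamberPolyhedron L C v).active x) :
    ⌊n.1 x⌋ + 1 = ⌈n.1 v⌉ := by
  obtain ⟨hdomain, hle⟩ := RelPolyhedron.mem_carrier_iff.1 hx
  rw [← eq_sub_iff_add_eq, Int.floor_eq_iff]
  push_cast
  rw [sub_add_cancel]
  exact ⟨(hdomain n).le, (hle n).lt_of_ne hn⟩

theorem IsToricCone.exists_isCellPoint [DiscreteTopology L] [IsZLattice ℝ L]
    (hC : IsToricCone L C) (v : V) :
    ∃ y : (chamberPolyhedron L C v).Face → V, IsCellPoint v y := by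
  choose y hy _ using hC.exists_sub_mem_interior_iff
  refine ⟨fun I => y I.point, fun {I n} hn => ?_, fun {I n} hn => ?_⟩
  · rw [hy _ n n.2, floor_add_one_of_mem_active (by rwa [I.active_point])]
  · rw [hy _ n n.2, floor_add_one_of_notMem_active I.point_mem (by rwa [I.active_point])]

namespace IsCellPoint

variable {y : (chamberPolyhedron L C v).Face → V} (hy : IsCellPoint v y)
include hy

theorem dominates_iff {I : (chamberPolyhedron L C v).Face} :
    Dominates L C u (y I) ↔
      Dominates L C u v ∧ I.1 ⊆ (chamberPolyhedron L C v).violated u := by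
  have hlt (n : primitiveNormals L C) :
      ⌈n.1 v⌉ + 1 ≤ ⌈n.1 u⌉ ↔ n ∈ (chamberPolyhedron L C v).violated u :=
    Int.add_one_le_iff.trans Int.lt_ceil
  refine ⟨fun h => ⟨fun n hn => ?_, fun n hn => ?_⟩, fun ⟨hv, hI⟩ n hn => ?_⟩
  · refine le_trans ?_ (h n hn)
    by_cases hnI : ⟨n, hn⟩ ∈ I.1
    · exact (Int.le_add_one le_rfl).trans (hy.ceil_of_mem hnI).ge
    · exact (hy.ceil_of_notMem hnI).ge
  · exact (hlt n).1 ((hy.ceil_of_mem hn).symm.trans_le (h n n.2))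
  · by_cases hnI : ⟨n, hn⟩ ∈ I.1
    · exact (hy.ceil_of_mem hnI).trans_le ((hlt ⟨n, hn⟩).2 (hI hnI))
    · exact (hy.ceil_of_notMem hnI).trans_le (hv n hn)

theorem violated_eq (I : (chamberPolyhedron L C v).Face) :
    (chamberPolyhedron L C v).violated (y I) = I.1 := by
  refine subset_antisymm (fun n hn => by_contra fun hnI => ?_)
    (hy.dominates_iff.1 (dominates_refl _)).2
  exact (Int.ceil_le.1 (hy.ceil_of_notMem hnI).le).not_gt hn

theorem dominates_iff_le {I J : (chamberPolyhedron L C v).Face} :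
    Dominates L C (y I) (y J) ↔ J ≤ I := by
  rw [hy.dominates_iff, hy.violated_eq]
  exact and_iff_right (hy.dominates_iff.1 (dominates_refl _)).1

open scoped Matrix RelPolyhedron

variable {ε : Matrix (chamberPolyhedron L C v).Face (chamberPolyhedron L C v).Face ℤ}
  (hε : RelPolyhedron.IsIncidence ε)
include hε

theorem exactOn (hC : IsToricCone L C) (R : Type*) [CommRing R] (huv : Dominates L C u v)
    (hvu : ¬ Dominates L C v u) :
    ExactOn (ε.map (Int.cast : ℤ → R)) {I | Dominates L C u (y I)} := by
  obtain ⟨u', hdomain, hactive, hviolated⟩ := hC.exists_active_eq_empty huv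
  have hvisible : (chamberPolyhedron L C v).visible u' = {I | Dominates L C u (y I)} := by
    ext I
    change _ ∧ _ ↔ Dominates L C u (y I)
    rw [hy.dominates_iff, hactive, hviolated, Set.empty_union]
    exact and_congr_left fun _ => iff_of_true (Set.empty_subset _) huv
  rw [← violated_chamberPolyhedron_eq_empty_iff, ← hviolated, ← ne_eq,
    ← Set.nonempty_iff_ne_empty] at hvu
  exact hvisible ▸ RelPolyhedron.exactOn_visible hε R hdomain hvu

/-- In a degree `u` outside of the chamber of `v`, the cellular complex of open conic modules is
exact. -/
theorem exists_vecMul_eq (hC : IsToricCone L C) {R : Type*} [CommRing R]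
    {c : (chamberPolyhedron L C v).Face → R}
    (hc : ∀ I, c I ≠ 0 → Dominates L C u (y I)) (hzero : c ᵥ* ε.map Int.cast = 0)
    (hne : ∀ I, I.1 = ∅ → c I ≠ 0 → ¬ Dominates L C v u) :
    ∃ b : (chamberPolyhedron L C v).Face → R,
      (∀ I, b I ≠ 0 → Dominates L C u (y I)) ∧ b ᵥ* ε.map Int.cast = c := by
  by_cases hu : Dominates L C u v ∧ ¬ Dominates L C v u
  · obtain ⟨b, hb, hbc⟩ := hy.exactOn hε hC R hu.1 hu.2 c (fun I hI => hc I hI)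
      fun J _ => congrFun hzero J
    refine ⟨b, fun I hI => hb hI, funext fun J => ?_⟩
    by_cases hJ : Dominates L C u (y J)
    · exact hbc J hJ
    · rw [not_imp_comm.1 (hc J) hJ]
      refine hε.vecMul_map_apply_eq_zero fun I hJI _ => ?_
      exact not_imp_comm.1 (fun hI => hb hI) fun hI =>
        hJ (Dominates.trans hI (hy.dominates_iff_le.2 hJI))
  · have hczero : c = 0 := funext fun I => by_contra fun hI => by
      obtain ⟨huv, hIu⟩ := hy.dominates_iff.1 (hc I hI)
      have hvu := of_not_not fun h => hu ⟨huv, h⟩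
      rw [violated_chamberPolyhedron_eq_empty_iff.2 hvu, Set.subset_empty_iff] at hIu
      exact hne I hIu hI hvu
    exact ⟨0, fun I hI => absurd rfl hI, by rw [hczero, Matrix.zero_vecMul]⟩

end IsCellPoint

end ChamberPolyhedron

section Resolution

open CategoryTheory CategoryTheory.Limits CategoryTheory.Abelian

universe w₁ w₂ w₃ t

variable {𝕜 : Type t} [CommRing 𝕜] {A : Type w₁} [Category.{w₂} A] [Abelian A] [Linear 𝕜 A]

theorem exact_lift_kernel {P₂ P₁ P₀ S : A} {d₁ : P₂ ⟶ P₁} {d₀ : P₁ ⟶ P₀} {e : P₀ ⟶ S}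
    {hd : d₁ ≫ d₀ = 0} (he : d₀ ≫ e = 0) (hexact : (ShortComplex.mk d₁ d₀ hd).Exact) :
    ∃ h : d₁ ≫ kernel.lift e d₀ he = 0,
      (ShortComplex.mk d₁ (kernel.lift e d₀ he) h).Exact := by
  have h : d₁ ≫ kernel.lift e d₀ he = 0 := by
    rw [← cancel_mono (kernel.ι e), Category.assoc, kernel.lift_ι, hd, zero_comp]
  let f : ShortComplex.mk d₁ (kernel.lift e d₀ he) h ⟶ ShortComplex.mk d₁ d₀ hd :=
    { τ₁ := 𝟙 _, τ₂ := 𝟙 _, τ₃ := kernel.ι e }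
  have : Epi f.τ₁ := inferInstanceAs (Epi (𝟙 _))
  have : IsIso f.τ₂ := inferInstanceAs (IsIso (𝟙 _))
  have : Mono f.τ₃ := inferInstanceAs (Mono (kernel.ι e))
  exact ⟨h, (ShortComplex.exact_iff_of_epi_of_isIso_of_mono f).2 hexact⟩

theorem kernel_ι_comp_eq_zero {P₁ P₀ S Y : A} {d₀ : P₁ ⟶ P₀} {e : P₀ ⟶ S} {he : d₀ ≫ e = 0}
    (hexact : (ShortComplex.mk d₀ e he).Exact) {φ : P₀ ⟶ Y} (hφ : d₀ ≫ φ = 0) :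
    kernel.ι e ≫ φ = 0 := by
  have : Epi (kernel.lift e d₀ he) := (ShortComplex.exact_iff_epi_kernel_lift _).1 hexact
  rw [← cancel_epi (kernel.lift e d₀ he), comp_zero, kernel.lift_ι_assoc, hφ]

theorem exact_kernel_ι {P₀ S : A} (e : P₀ ⟶ S) [Epi e] :
    (ShortComplex.mk (kernel.ι e) e (kernel.condition e)).ShortExact where
  exact := ShortComplex.exact_kernel e

theorem nonempty_hom_linearEquiv {P₀ S Y : A} (e : P₀ ⟶ S) [Epi e]
    (hY : ∀ φ : P₀ ⟶ Y, kernel.ι e ≫ φ = 0) : Nonempty ((S ⟶ Y) ≃ₗ[𝕜] (P₀ ⟶ Y)) := by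
  have hexact := (exact_kernel_ι e).exact
  have : Epi (ShortComplex.mk (kernel.ι e) e (kernel.condition e)).g := ‹Epi e›
  refine ⟨LinearEquiv.ofBijective (Linear.leftComp 𝕜 Y e) ⟨fun φ ψ h => ?_, fun φ => ?_⟩⟩
  · exact (cancel_epi e).1 h
  · exact ⟨hexact.desc φ (hY φ), hexact.g_desc φ (hY φ)⟩

variable [HasExt.{w₃} A]

theorem nonempty_ext_succ_linearEquiv {P₀ S Y : A} [Projective P₀] (e : P₀ ⟶ S) [Epi e]
    (hY : ∀ φ : P₀ ⟶ Y, kernel.ι e ≫ φ = 0) (n : ℕ) :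
    Nonempty (Ext S Y (n + 1) ≃ₗ[𝕜] Ext (kernel e) Y n) := by
  have hS := exact_kernel_ι e
  let connecting : Ext (kernel e) Y n →ₗ[𝕜] Ext S Y (n + 1) :=
    hS.extClass.precompOfLinear 𝕜 Y (add_comm 1 n)
  refine ⟨(LinearEquiv.ofBijective connecting ⟨?_, fun x => ?_⟩).symm⟩
  · rw [injective_iff_map_eq_zero]
    intro x hx
    obtain ⟨z, rfl⟩ := Ext.contravariant_sequence_exact₁ hS Y x (add_comm 1 n) hx
    cases n with
    | zero =>
      obtain ⟨φ, rfl⟩ := (Ext.mk₀_bijective _ _).2 z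
      rw [Ext.mk₀_comp_mk₀]
      exact (congrArg Ext.mk₀ (hY φ)).trans (Ext.mk₀_zero _ _)
    | succ n => rw [Ext.eq_zero_of_projective z, Ext.comp_zero]
  · exact Ext.contravariant_sequence_exact₃ hS Y x (Ext.eq_zero_of_projective _) (add_comm 1 n)

/-- The resolution need only be minimal relative to `Y`: when its differentials induce zero on
morphisms to `Y`, no cohomology has to be taken. -/
theorem nonempty_ext_linearEquiv {Y : A} (n : ℕ) {S : A} {P : ℕ → A} [∀ k, Projective (P k)]
    (d : ∀ k, P (k + 1) ⟶ P k) (e : P 0 ⟶ S) [Epi e] (he : d 0 ≫ e = 0)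
    (hd : ∀ k, d (k + 1) ≫ d k = 0) (hexact₀ : (ShortComplex.mk _ _ he).Exact)
    (hexact : ∀ k, (ShortComplex.mk _ _ (hd k)).Exact)
    (hY : ∀ k (φ : P k ⟶ Y), d k ≫ φ = 0) :
    Nonempty (Ext S Y n ≃ₗ[𝕜] (P n ⟶ Y)) := by
  have hι (φ : P 0 ⟶ Y) : kernel.ι e ≫ φ = 0 := kernel_ι_comp_eq_zero hexact₀ (hY 0 φ)
  induction n generalizing S P with
  | zero => exact (nonempty_hom_linearEquiv e hι).map Ext.linearEquiv₀.trans
  | succ n ih =>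
    obtain ⟨shift⟩ := nonempty_ext_succ_linearEquiv (𝕜 := 𝕜) e hι n
    obtain ⟨h, h'⟩ := exact_lift_kernel he (hexact 0)
    have : Epi (kernel.lift e (d 0) he) := (ShortComplex.exact_iff_epi_kernel_lift _).1 hexact₀
    refine (ih (P := fun k => P (k + 1)) (fun k => d (k + 1)) (kernel.lift e (d 0) he) h
      (fun k => hd (k + 1)) h' (fun k => hexact (k + 1)) (fun k => hY (k + 1)) fun φ => ?_).map
      shift.trans
    exact kernel_ι_comp_eq_zero h' (hY 1 φ)

end Resolution

section CellModules

open scoped Matrix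

theorem projective_pi {A κ : Type*} [Semiring A] [Finite κ] (X : κ → Type*)
    [∀ k, AddCommMonoid (X k)] [∀ k, Module A (X k)] [∀ k, Module.Projective A (X k)] :
    Module.Projective A (∀ k, X k) := by
  classical
  cases nonempty_fintype κ
  exact Module.Projective.of_equiv (DirectSum.linearEquivFunOnFintype A κ X)

/-- The faces of codimension `k`. -/
abbrev RelPolyhedron.FaceOfCodim {V ν : Type*} [NormedAddCommGroup V] [NormedSpace ℝ V]
    (P : RelPolyhedron V ν) (k : ℕ) : Type _ :=
  {I : P.Face // P.codim I.1 = k}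

instance {V ν : Type*} [NormedAddCommGroup V] [NormedSpace ℝ V] [Finite ν]
    (P : RelPolyhedron V ν) (k : ℕ) : Fintype (P.FaceOfCodim k) :=
  Fintype.ofFinite _

variable {𝕜 : Type u} [Field 𝕜] {V : Type v} [NormedAddCommGroup V] [NormedSpace ℝ V]
  [FiniteDimensional ℝ V] {L : Submodule ℤ V} {C : PointedCone ℝ V}
  [Finite (primitiveNormals L C)] {ι : Type} {w : ι → V} {v : V}

variable (𝕜 w) in
/-- The term of degree `k` of the cellular resolution: the direct sum of the modules `P_{y I}` over
the cells of codimension `k`, each cell being given by its active set `I`. -/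
abbrev CellModule (y : (chamberPolyhedron L C v).Face → V) (k : ℕ) : Type (max u v) :=
  ∀ I : (chamberPolyhedron L C v).FaceOfCodim k, projModule 𝕜 L C w (y I)

variable [DiscreteTopology L] [IsZLattice ℝ L] (hC : IsToricCone L C)
  {y : (chamberPolyhedron L C v).Face → V} {k : ℕ} {i : ι} {m : L}
  {I : (chamberPolyhedron L C v).Face}

/-- The coefficients at `x^m` of the `i`-th components of the symbols, extended by zero to the
cells of all codimensions, so that the boundary becomes multiplication by one matrix. -/
def cellCoeff (c : CellModule 𝕜 w y k) (i : ι) (m : L) : (chamberPolyhedron L C v).Face → 𝕜 :=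
  Function.extend Subtype.val (fun I => (symbol hC (c I) i).coeff m) 0

theorem cellCoeff_apply (c : CellModule 𝕜 w y k) (i : ι) (m : L)
    (I : (chamberPolyhedron L C v).FaceOfCodim k) :
    cellCoeff hC c i m I = (symbol hC (c I) i).coeff m :=
  Subtype.val_injective.extend_apply _ _ _

theorem cellCoeff_eq_zero (c : CellModule 𝕜 w y k)
    (hI : (chamberPolyhedron L C v).codim I.1 ≠ k) : cellCoeff hC c i m I = 0 :=
  Function.extend_apply' _ _ _ fun ⟨J, hJ⟩ => hI (hJ ▸ J.2)

theorem codim_eq_of_cellCoeff_ne_zero {c : CellModule 𝕜 w y k} (h : cellCoeff hC c i m I ≠ 0) :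
    (chamberPolyhedron L C v).codim I.1 = k :=
  not_imp_comm.1 (cellCoeff_eq_zero hC c) h

theorem dominates_of_cellCoeff {c : CellModule 𝕜 w y k} (h : cellCoeff hC c i m I ≠ 0) :
    Dominates L C (w i + m) (y I) :=
  dominates_of_symbol hC <|
    (cellCoeff_apply hC c i m ⟨I, codim_eq_of_cellCoeff_ne_zero hC h⟩).symm.trans_ne h

theorem cellCoeff_zero : cellCoeff hC (0 : CellModule 𝕜 w y k) i m = 0 := by
  refine funext fun I => by_contra fun h => h ?_
  refine (cellCoeff_apply hC _ i m ⟨I, codim_eq_of_cellCoeff_ne_zero hC h⟩).trans ?_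
  rw [Pi.zero_apply, map_zero]
  rfl

theorem finite_cellCoeff_ne_zero (c : CellModule 𝕜 w y k) (i : ι) :
    {m | cellCoeff hC c i m ≠ 0}.Finite := by
  refine (Set.finite_iUnion fun I : (chamberPolyhedron L C v).FaceOfCodim k =>
    (symbol hC (c I) i).coeff.hasFiniteSupport).subset fun m hm => ?_
  obtain ⟨I, hI⟩ := Function.ne_iff.1 hm
  let J : (chamberPolyhedron L C v).FaceOfCodim k :=
    ⟨I, codim_eq_of_cellCoeff_ne_zero hC hI⟩
  exact Set.mem_iUnion.2 ⟨J, (cellCoeff_apply hC c i m J).symm.trans_ne hI⟩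

theorem cellModule_ext [Finite ι] {c c' : CellModule 𝕜 w y k}
    (h : ∀ i m J, (chamberPolyhedron L C v).codim J.1 = k →
      cellCoeff hC c i m J = cellCoeff hC c' i m J) : c = c' := by
  funext I
  refine symbol_injective hC (funext fun i => AddMonoidAlgebra.ext (Finsupp.ext fun m => ?_))
  rw [← cellCoeff_apply, ← cellCoeff_apply, h i m I I.2]

theorem exists_cellCoeff_eq [Finite ι] {b : ι → L → (chamberPolyhedron L C v).Face → 𝕜}
    (hb : ∀ i m I, b i m I ≠ 0 → Dominates L C (w i + m) (y I))
    (hfinite : ∀ i, {m | b i m ≠ 0}.Finite) (k : ℕ) :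
    ∃ c : CellModule 𝕜 w y k, ∀ i m I, (chamberPolyhedron L C v).codim I.1 = k →
      cellCoeff hC c i m I = b i m I := by
  have hsupport (i : ι) (I : (chamberPolyhedron L C v).Face) :
      (Function.support fun m => b i m I).Finite :=
    (hfinite i).subset fun m hm => Function.ne_iff.2 ⟨I, hm⟩
  choose c hc using fun I : (chamberPolyhedron L C v).FaceOfCodim k =>
    exists_symbol_eq (w := w) (v := y I) hC
      (fun i => AddMonoidAlgebra.ofCoeff (Finsupp.ofSupportFinite _ (hsupport i I)))
      fun i m h => hb i m I h
  refine ⟨c, fun i m I hI => (cellCoeff_apply hC c i m ⟨I, hI⟩).trans ?_⟩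
  rw [hc]
  rfl

variable (ε : Matrix (chamberPolyhedron L C v).Face (chamberPolyhedron L C v).Face ℤ)

/-- The differential of the cellular resolution; its components are the inclusions
`P_{y I} → P_{y J}` with the incidence numbers as signs. -/
def cellBoundary (𝕜 : Type u) [Field 𝕜] (w : ι → V) (y : (chamberPolyhedron L C v).Face → V)
    (k : ℕ) : CellModule 𝕜 w y (k + 1) →ₗ[(conicEnd 𝕜 L C w)ᵐᵒᵖ] CellModule 𝕜 w y k :=
  LinearMap.pi fun J => ∑ I : (chamberPolyhedron L C v).FaceOfCodim (k + 1),
    ε I J • (incl hC 𝕜 w (y I) (y J)).comp (LinearMap.proj I)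

theorem cellBoundary_apply (c : CellModule 𝕜 w y (k + 1))
    (J : (chamberPolyhedron L C v).FaceOfCodim k) :
    cellBoundary hC ε 𝕜 w y k c J = ∑ I : (chamberPolyhedron L C v).FaceOfCodim (k + 1),
      ε I J • incl hC 𝕜 w (y I) (y J) (c I) := by
  rw [cellBoundary, LinearMap.pi_apply, LinearMap.sum_apply]
  rfl

variable (hy : IsCellPoint v y) {ε} (hε : RelPolyhedron.IsIncidence ε)
include hy hε

theorem coeff_symbol_zsmul_incl (i : ι) (m : L) (I J : (chamberPolyhedron L C v).Face)
    (f : projModule 𝕜 L C w (y I)) :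
    (symbol hC (ε I J • incl hC 𝕜 w (y I) (y J) f) i).coeff m =
      (symbol hC f i).coeff m * (ε I J : 𝕜) := by
  rw [map_zsmul, Pi.smul_apply, AddMonoidAlgebra.coeff_smul, Finsupp.smul_apply, zsmul_eq_mul,
    mul_comm]
  by_cases hIJ : ε I J = 0
  · rw [hIJ, Int.cast_zero, mul_zero, mul_zero]
  · rw [symbol_incl hC (hy.dominates_iff_le.2 (hε.of_ne_zero hIJ).1)]

theorem cellCoeff_cellBoundary (c : CellModule 𝕜 w y (k + 1)) (i : ι) (m : L) :
    cellCoeff hC (cellBoundary hC ε 𝕜 w y k c) i m =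
      cellCoeff hC c i m ᵥ* ε.map (Int.cast : ℤ → 𝕜) := by
  funext J
  by_cases hJ : (chamberPolyhedron L C v).codim J.1 = k
  · rw [cellCoeff_apply hC _ i m ⟨J, hJ⟩, cellBoundary_apply, map_sum, Finset.sum_apply,
      AddMonoidAlgebra.coeff_sum, Finsupp.finsetSum_apply]
    refine Fintype.sum_of_injective Subtype.val Subtype.val_injective _ _ (fun I hI => ?_)
      fun I => ?_
    · rw [cellCoeff_eq_zero hC c fun h => hI ⟨⟨I, h⟩, rfl⟩, zero_mul]
    · rw [cellCoeff_apply]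
      exact coeff_symbol_zsmul_incl hC hy hε i m I J (c I)
  · rw [cellCoeff_eq_zero hC _ hJ]
    refine (hε.vecMul_map_apply_eq_zero fun I _ hI => cellCoeff_eq_zero hC c fun h => hJ ?_).symm
    exact Nat.succ_injective (hI.symm.trans h)

theorem cellBoundary_cellBoundary [Finite ι] (c : CellModule 𝕜 w y (k + 1 + 1)) :
    cellBoundary hC ε 𝕜 w y k (cellBoundary hC ε 𝕜 w y (k + 1) c) = 0 := by
  refine cellModule_ext hC fun i m J _ => ?_
  rw [cellCoeff_cellBoundary hC hy hε, cellCoeff_cellBoundary hC hy hε, Matrix.vecMul_vecMul,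
    hε.map_mul_self, Matrix.vecMul_zero, cellCoeff_zero]

theorem exists_cellBoundary_eq [Finite ι] (c : CellModule 𝕜 w y k)
    (hc : ∀ i m, cellCoeff hC c i m ᵥ* ε.map (Int.cast : ℤ → 𝕜) = 0)
    (hne : ∀ i m I, I.1 = ∅ → cellCoeff hC c i m I ≠ 0 → ¬ Dominates L C v (w i + m)) :
    ∃ b, cellBoundary hC ε 𝕜 w y k b = c := by
  have hdegree (i : ι) (m : L) : ∃ b : (chamberPolyhedron L C v).Face → 𝕜,
      (∀ I, b I ≠ 0 → Dominates L C (w i + m) (y I)) ∧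
        b ᵥ* ε.map (Int.cast : ℤ → 𝕜) = cellCoeff hC c i m ∧ (cellCoeff hC c i m = 0 → b = 0) := by
    by_cases hcoeff : cellCoeff hC c i m = 0
    · exact ⟨0, fun I hI => absurd rfl hI, by rw [hcoeff, Matrix.zero_vecMul], fun _ => rfl⟩
    · obtain ⟨b, hb, hbc⟩ := hy.exists_vecMul_eq hε hC
        (fun I hI => dominates_of_cellCoeff hC hI) (hc i m) (hne i m)
      exact ⟨b, hb, hbc, fun h => absurd h hcoeff⟩
  choose b hb hbc hzero using hdegree
  obtain ⟨f, hf⟩ := exists_cellCoeff_eq hC hb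
    (fun i => (finite_cellCoeff_ne_zero hC c i).subset fun m => mt (hzero i m)) (k + 1)
  refine ⟨f, cellModule_ext hC fun i m J hJ => ?_⟩
  rw [cellCoeff_cellBoundary hC hy hε, ← hbc]
  exact hε.vecMul_map_apply_congr fun I _ hI => hf i m I (hI.trans (congrArg Nat.succ hJ))

theorem cellBoundary_exact [Finite ι] (c : CellModule 𝕜 w y (k + 1))
    (hc : cellBoundary hC ε 𝕜 w y k c = 0) : ∃ b, cellBoundary hC ε 𝕜 w y (k + 1) b = c := by
  refine exists_cellBoundary_eq hC hy hε c (fun i m => ?_) fun i m I hI h => ?_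
  · rw [← cellCoeff_cellBoundary hC hy hε, hc, cellCoeff_zero]
  · have hcodim := codim_eq_of_cellCoeff_ne_zero hC h
    rw [hI, RelPolyhedron.codim_empty] at hcodim
    exact absurd hcodim (Nat.succ_ne_zero k).symm

end CellModules

theorem rank_pi_eq_natCard {K κ : Type*} [Field K] [Finite κ] {X : κ → Type*}
    [∀ k, AddCommGroup (X k)] [∀ k, Module K (X k)] {p : κ → Prop} [DecidablePred p]
    (h : ∀ k, Module.rank K (X k) = if p k then 1 else 0) :
    Module.rank K (∀ k, X k) = (Nat.card {k // p k} : Cardinal) := by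
  have hcard (k : κ) : Module.rank K (X k) = Cardinal.mk (ULift (PLift (p k))) := by
    rw [h]
    split_ifs with hk
    · exact (Cardinal.eq_one_iff_unique.2 ⟨inferInstance, ⟨⟨⟨hk⟩⟩⟩⟩).symm
    · exact (Cardinal.mk_eq_zero_iff.2 ⟨fun x => hk x.down.down⟩).symm
  simp only [rank_pi, hcard]
  rw [← Cardinal.mk_sigma, ← Nat.cast_card]
  exact congrArg _ (Nat.card_congr (Equiv.sigmaULiftPLiftEquivSubtype p))

section CellResolution

open CategoryTheory
open scoped Matrix ModuleCat

variable {𝕜 : Type u} [Field 𝕜] {V : Type v} [NormedAddCommGroup V] [NormedSpace ℝ V]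
  [FiniteDimensional ℝ V] {L : Submodule ℤ V} {C : PointedCone ℝ V}
  [Finite (primitiveNormals L C)] {ι : Type} {w : ι → V} {u v : V}

theorem projective_cellModule (hw : IsComplete 𝕜 L C w)
    (y : (chamberPolyhedron L C v).Face → V) (k : ℕ) :
    Projective (ModuleCat.of (conicEnd 𝕜 L C w)ᵐᵒᵖ (CellModule 𝕜 w y k)) := by
  have := fun I : (chamberPolyhedron L C v).FaceOfCodim k => hw.projective (y I)
  exact (IsProjective.iff_projective _).1 <| projective_pi (A := (conicEnd 𝕜 L C w)ᵐᵒᵖ)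
    fun I : (chamberPolyhedron L C v).FaceOfCodim k => projModule 𝕜 L C w (y I)

variable (hC : IsToricCone L C)

/-- The interior of the chamber of `v`, as its cell of codimension zero. -/
def IsToricCone.topFace (v : V) : (chamberPolyhedron L C v).FaceOfCodim 0 :=
  ⟨⟨∅, hC.exists_mem_carrier_active_eq_empty v⟩, RelPolyhedron.codim_empty⟩

variable {y : (chamberPolyhedron L C v).Face → V} (hy : IsCellPoint v y)

include hy in
theorem IsCellPoint.dominates_topFace_iff :
    Dominates L C u (y (hC.topFace v)) ↔ Dominates L C u v :=
  hy.dominates_iff.trans (and_iff_left (Set.empty_subset _))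

variable [DiscreteTopology L] [IsZLattice ℝ L]

/-- The augmentation of the cellular resolution of `S_v`. -/
def cellAugmentation (𝕜 : Type u) [Field 𝕜] (w : ι → V) (y : (chamberPolyhedron L C v).Face → V) :
    CellModule 𝕜 w y 0 →ₗ[(conicEnd 𝕜 L C w)ᵐᵒᵖ] simpleModule 𝕜 L C w v :=
  (maximalGradedSubmodule 𝕜 L C w v).mkQ.comp
    ((incl hC 𝕜 w (y (hC.topFace v)) v).comp (LinearMap.proj (hC.topFace v)))

variable [Finite ι] {ε : Matrix (chamberPolyhedron L C v).Face (chamberPolyhedron L C v).Face ℤ}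
  (hε : RelPolyhedron.IsIncidence ε) (hw : IsComplete 𝕜 L C w) {k : ℕ} {v' : V}

include hy in
theorem cellAugmentation_surjective :
    Function.Surjective (cellAugmentation hC 𝕜 w y) := by
  classical
  intro s
  obtain ⟨f, rfl⟩ := (maximalGradedSubmodule 𝕜 L C w v).mkQ_surjective s
  obtain ⟨g, hg⟩ := exists_symbol_eq (w := w) (v := y (hC.topFace v)) hC (symbol hC f) fun i m h =>
    (hy.dominates_topFace_iff hC).2 (dominates_of_symbol hC h)
  have hincl : incl hC 𝕜 w (y (hC.topFace v)) v g = f := symbol_injective hC <|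
    (symbol_incl hC ((hy.dominates_topFace_iff hC).1 (dominates_refl _)) g).trans hg
  let c : CellModule 𝕜 w y 0 := Pi.single (hC.topFace v) g
  have hc : c (hC.topFace v) = g := Pi.single_eq_same _ _
  refine ⟨c, ?_⟩
  change (maximalGradedSubmodule 𝕜 L C w v).mkQ
    (incl hC 𝕜 w (y (hC.topFace v)) v (c (hC.topFace v))) = _
  rw [hc, hincl]

include hy hw in
theorem cellAugmentation_eq_zero_iff (c : CellModule 𝕜 w y 0) :
    cellAugmentation hC 𝕜 w y c = 0 ↔
      ∀ i (m : L), cellCoeff hC c i m (hC.topFace v) ≠ 0 → ¬ Dominates L C v (w i + m) := by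
  refine (Submodule.Quotient.mk_eq_zero (maximalGradedSubmodule 𝕜 L C w v)).trans ?_
  rw [hw.maximalGradedSubmodule_eq hC, mem_gradedRadical hC]
  refine forall₂_congr fun i m => ?_
  rw [cellCoeff_apply]
  exact symbol_incl hC ((hy.dominates_topFace_iff hC).1 (dominates_refl _)) (c (hC.topFace v)) ▸
    Iff.rfl

include hy hε hw in
theorem exists_cellBoundary_of_cellAugmentation (c : CellModule 𝕜 w y 0)
    (hc : cellAugmentation hC 𝕜 w y c = 0) : ∃ b, cellBoundary hC ε 𝕜 w y 0 b = c := by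
  refine exists_cellBoundary_eq hC hy hε c (fun i m => funext fun J => ?_) fun i m I hI => ?_
  · exact hε.vecMul_map_apply_eq_zero fun I _ hI =>
      cellCoeff_eq_zero hC c (hI.trans_ne (Nat.succ_ne_zero _))
  · obtain rfl : I = hC.topFace v := Subtype.ext hI
    exact (cellAugmentation_eq_zero_iff hC hy hw c).1 hc i m

include hy hε hw in
/-- The cellular resolution is minimal. -/
theorem comp_cellBoundary_eq_zero
    (φ : CellModule 𝕜 w y k →ₗ[(conicEnd 𝕜 L C w)ᵐᵒᵖ] simpleModule 𝕜 L C w v') :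
    φ.comp (cellBoundary hC ε 𝕜 w y k) = 0 := by
  classical
  refine LinearMap.ext fun c => ?_
  rw [LinearMap.comp_apply, ← Finset.univ_sum_single (cellBoundary hC ε 𝕜 w y k c), map_sum]
  refine Finset.sum_eq_zero fun J _ => ?_
  let φJ := φ.comp (LinearMap.single _
    (fun J : (chamberPolyhedron L C v).FaceOfCodim k => projModule 𝕜 L C w (y J)) J)
  change φJ (cellBoundary hC ε 𝕜 w y k c J) = 0
  rw [cellBoundary_apply, map_sum]
  refine Finset.sum_eq_zero fun I _ => ?_
  rw [map_zsmul]
  by_cases hIJ : ε I J = 0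
  · rw [hIJ, zero_smul]
  · obtain ⟨hJI, hcodim⟩ := hε.of_ne_zero hIJ
    have hIJ' : ¬ Dominates L C (y J) (y I) := fun h => by
      rw [(hy.dominates_iff_le.1 h).antisymm hJI] at hcodim
      exact Nat.succ_ne_self _ hcodim.symm
    have hzero := hw.comp_incl_eq_zero hC (hy.dominates_iff_le.2 hJI) hIJ' φJ
    rw [show φJ (incl hC 𝕜 w (y I) (y J) (c I)) = 0 from LinearMap.congr_fun hzero (c I),
      smul_zero]

include hC hy hw in
theorem nonempty_ext_simpleModule (v' : V) (k : ℕ) :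
    Nonempty (Abelian.Ext (simpleModule 𝕜 L C w v) (simpleModule 𝕜 L C w v') k ≃ₗ[𝕜]
      (ModuleCat.of (conicEnd 𝕜 L C w)ᵐᵒᵖ (CellModule 𝕜 w y k) ⟶ simpleModule 𝕜 L C w v')) := by
  obtain ⟨ε, hε⟩ := RelPolyhedron.exists_isIncidence (chamberPolyhedron L C v)
  have := projective_cellModule hw y
  let e : ModuleCat.of _ (CellModule 𝕜 w y 0) ⟶ simpleModule 𝕜 L C w v :=
    ModuleCat.ofHom (cellAugmentation hC 𝕜 w y)
  have : Epi e := (ModuleCat.epi_iff_surjective _).2 (cellAugmentation_surjective hC hy)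
  let d (k : ℕ) : ModuleCat.of _ (CellModule 𝕜 w y (k + 1)) ⟶
      ModuleCat.of (conicEnd 𝕜 L C w)ᵐᵒᵖ (CellModule 𝕜 w y k) :=
    ModuleCat.ofHom (cellBoundary hC ε 𝕜 w y k)
  refine nonempty_ext_linearEquiv (P := fun k => ModuleCat.of _ (CellModule 𝕜 w y k)) k d e
    ?_ ?_ ?_ ?_ ?_
  · exact ModuleCat.hom_ext (comp_cellBoundary_eq_zero hC hy hε hw _)
  · exact fun k => ModuleCat.hom_ext (LinearMap.ext (cellBoundary_cellBoundary hC hy hε))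
  · exact (ShortComplex.moduleCat_exact_iff _).2
      (exists_cellBoundary_of_cellAugmentation hC hy hε hw)
  · exact fun k => (ShortComplex.moduleCat_exact_iff _).2 (cellBoundary_exact hC hy hε)
  · exact fun k φ => ModuleCat.hom_ext (comp_cellBoundary_eq_zero hC hy hε hw φ.hom)

include hC hw in
theorem rank_hom_cellModule (y : (chamberPolyhedron L C v).Face → V) (v' : V) (k : ℕ) :
    Module.rank 𝕜 (ModuleCat.of (conicEnd 𝕜 L C w)ᵐᵒᵖ (CellModule 𝕜 w y k) ⟶
      simpleModule 𝕜 L C w v') =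
    (Nat.card {I : (chamberPolyhedron L C v).FaceOfCodim k // Equivalent L C (y I) v'} :
      Cardinal) := by
  classical
  let e := (ModuleCat.homLinearEquiv (S := 𝕜)
    (M := ModuleCat.of (conicEnd 𝕜 L C w)ᵐᵒᵖ (CellModule 𝕜 w y k))
    (N := simpleModule 𝕜 L C w v')).trans (LinearMap.lsum _
      (fun I : (chamberPolyhedron L C v).FaceOfCodim k => projModule 𝕜 L C w (y I)) 𝕜).symm
  exact e.rank_eq.trans (rank_pi_eq_natCard fun I => hw.rank_hom_simpleModule hC)

end CellResolution

/-! ### Cells of a chamber -/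

section OpenFace

open Topology

variable {V ν : Type*} [NormedAddCommGroup V] [NormedSpace ℝ V] {P : RelPolyhedron V ν}

/-- The relative interior of the face `I`. -/
def RelPolyhedron.Face.openFace (I : P.Face) : Set V := {x ∈ P.carrier | P.active x = I}

theorem RelPolyhedron.Face.point_mem_openFace (I : P.Face) : I.point ∈ I.openFace :=
  ⟨I.point_mem, I.active_point⟩

theorem RelPolyhedron.Face.openFace_injective :
    Function.Injective (RelPolyhedron.Face.openFace (P := P)) := by
  intro I J hIJ
  obtain ⟨-, hactive⟩ : I.point ∈ J.openFace := hIJ ▸ I.point_mem_openFace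
  exact Subtype.ext (I.active_point.symm.trans hactive)

variable [Finite ν] (I : P.Face)

theorem RelPolyhedron.Face.vectorSpan_openFace :
    vectorSpan ℝ I.openFace = (P.conormal I.1).dualCoannihilator := by
  refine le_antisymm ?_ fun z hz => ?_
  · rw [vectorSpan_def, Submodule.span_le]
    rintro _ ⟨x, ⟨-, hx⟩, x', ⟨-, hx'⟩, rfl⟩
    rw [SetLike.mem_coe, Submodule.mem_dualCoannihilator]
    refine RelPolyhedron.conormal_apply_eq_zero fun n hn => ?_
    have hn' : n ∈ P.active x' := hx' ▸ hn
    rw [← hx] at hn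
    exact (map_sub _ x x').trans (sub_eq_zero.2 (hn.trans hn'.symm))
  · rw [Submodule.mem_dualCoannihilator] at hz
    have hform (n) (hn : n ∈ P.active I.point) : P.form n z = 0 :=
      hz _ (RelPolyhedron.form_mem_conormal (I.active_point ▸ hn))
    obtain ⟨δ, ⟨hdomain, hactive, hviolated⟩, hδ⟩ :=
      ((RelPolyhedron.eventually_add_smul I.point_mem.1 z).and self_mem_nhdsWithin).exists
    have hmem : I.point + δ • z ∈ I.openFace := by
      refine ⟨⟨hdomain, ?_⟩, ?_⟩
      · rw [hviolated, I.point_mem.2, Set.empty_union, Set.eq_empty_iff_forall_notMem]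
        exact fun n hn => hn.2.ne' (hform n hn.1)
      · rw [hactive, Set.sep_eq_self_iff_mem_true.2 hform, I.active_point]
    have hsub := vsub_mem_vectorSpan ℝ hmem I.point_mem_openFace
    rw [vsub_eq_sub, add_sub_cancel_left] at hsub
    exact (Submodule.smul_mem_iff _ (ne_of_gt hδ)).1 hsub

theorem RelPolyhedron.Face.hasCodim_openFace_iff [FiniteDimensional ℝ V] {k : ℕ} :
    HasCodim I.openFace k ↔ P.codim I.1 = k := by
  have h := Subspace.finrank_add_finrank_dualCoannihilator_eq (P.conormal I.1)
  rw [HasCodim, I.vectorSpan_openFace, RelPolyhedron.codim]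
  lia

end OpenFace

section CountCells

theorem cellSet_congr {V : Type*} [NormedAddCommGroup V] [NormedSpace ℝ V] {L : Submodule ℤ V}
    {C : PointedCone ℝ V} {u v : V} {Ω : Set (Module.Dual ℝ V)} (hΩ : Ω ⊆ primitiveNormals L C)
    (h : ∀ n ∈ primitiveNormals L C, ⌈n u⌉ = ⌈n v⌉) : cellSet L C u Ω = cellSet L C v Ω := by
  ext x
  refine and_congr (forall₂_congr fun n hn => ?_) (forall₂_congr fun n hn => ?_)
  · rw [h n (hΩ hn)]
  · rw [h n hn]

variable {𝕜 : Type u} [Field 𝕜] {V : Type v} [NormedAddCommGroup V] [NormedSpace ℝ V]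
  [FiniteDimensional ℝ V] {L : Submodule ℤ V} {C : PointedCone ℝ V}
  [Finite (primitiveNormals L C)] {v v' : V} {Δ τ : Set V} {k : ℕ}

theorem cellSet_eq_sep {Ω : Set (Module.Dual ℝ V)} (hΩ : Ω ⊆ primitiveNormals L C) :
    cellSet L C v Ω = {x ∈ (chamberPolyhedron L C v).carrier |
      (chamberPolyhedron L C v).active x = {n | n.1 ∉ Ω}} := by
  ext x
  constructor
  · rintro ⟨hlt, heq⟩
    refine ⟨RelPolyhedron.mem_carrier_iff.2 ⟨fun n => ?_, fun n => ?_⟩, Set.ext fun n => ?_⟩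
    · by_cases hn : n.1 ∈ Ω
      · exact (hlt _ hn).1
      · exact (sub_one_lt _).trans_eq (heq _ n.2 hn).symm
    · by_cases hn : n.1 ∈ Ω
      · exact (hlt _ hn).2.le
      · exact (heq _ n.2 hn).le
    · exact ⟨fun hactive hn => (hlt _ hn).2.ne hactive, heq _ n.2⟩
  · rintro ⟨hx, hactive⟩
    obtain ⟨hdomain, hle⟩ := RelPolyhedron.mem_carrier_iff.1 hx
    have hactive (n) : (chamberPolyhedron L C v).form n x = (chamberPolyhedron L C v).bound n ↔
        n.1 ∉ Ω := Set.ext_iff.1 hactive n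
    exact ⟨fun n hn => ⟨hdomain ⟨n, hΩ hn⟩, (hle ⟨n, hΩ hn⟩).lt_of_ne fun h =>
      (hactive ⟨n, hΩ hn⟩).1 h hn⟩, fun n hn => (hactive ⟨n, hn⟩).2⟩

variable [DiscreteTopology L] [IsZLattice ℝ L] (hC : IsToricCone L C)
include hC

theorem IsToricCone.isCell_iff (hΔ : IsChamber L C Δ) (hv : v ∈ Δ) :
    IsCell L C Δ τ ↔ ∃ I : (chamberPolyhedron L C v).Face, I.openFace = τ := by
  obtain ⟨v₀, rfl⟩ := hΔ
  constructor
  · rintro ⟨⟨x, hx⟩, u, hu, Ω, hΩ, rfl⟩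
    rw [cellSet_congr hΩ fun n hn => ((hC.mem_chamber_iff.1 hu n hn).trans
      (hC.mem_chamber_iff.1 hv n hn).symm), cellSet_eq_sep hΩ] at hx ⊢
    exact ⟨⟨_, x, hx⟩, rfl⟩
  · rintro ⟨I, rfl⟩
    refine ⟨⟨I.point, I.point_mem_openFace⟩, v, hv, Subtype.val '' I.1ᶜ,
      Subtype.coe_image_subset _ _, ?_⟩
    rw [cellSet_eq_sep (Subtype.coe_image_subset _ _)]
    simp only [RelPolyhedron.Face.openFace, Subtype.val_injective.mem_set_image, Set.mem_compl_iff,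
      not_not, Set.ofPred_mem_eq]

namespace IsCellPoint

variable {y : (chamberPolyhedron L C v).Face → V} (hy : IsCellPoint v y)
include hy

theorem openConicModule_eq {I : (chamberPolyhedron L C v).Face} {x : V} (hx : x ∈ I.openFace) :
    openConicModule 𝕜 L C x = conicModule 𝕜 L C (y I) := by
  obtain ⟨hcarrier, hactive⟩ := hx
  obtain ⟨z, hz, hzx⟩ := hC.exists_sub_mem_interior_iff x
  have hchamber : y I ∈ chamber L C z := hC.mem_chamber_iff.2 fun n hn => by
    rw [hz n hn]
    by_cases hnI : ⟨n, hn⟩ ∈ I.1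
    · exact (hy.ceil_of_mem hnI).trans (floor_add_one_of_mem_active (hactive ▸ hnI)).symm
    · exact (hy.ceil_of_notMem hnI).trans
        (floor_add_one_of_notMem_active hcarrier (hactive ▸ hnI)).symm
  ext f
  exact forall₂_congr fun m _ => (hzx m m.2).trans (hchamber m m.2).symm

theorem cellsOfType_eq_range (hΔ : IsChamber L C Δ) (hv : v ∈ Δ) :
    cellsOfType 𝕜 L C Δ v' k = Set.range
      fun I : {I : (chamberPolyhedron L C v).FaceOfCodim k // Equivalent L C (y I) v'} =>
        I.1.1.openFace := by
  have hequiv (I : (chamberPolyhedron L C v).Face) : (∀ x ∈ I.openFace,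
      Nonempty (openConicModule 𝕜 L C x ≃ₗ[toricAlgebra 𝕜 L C] conicModule 𝕜 L C v')) ↔
      Equivalent L C (y I) v' := by
    rw [← hC.nonempty_equiv_iff (𝕜 := 𝕜)]
    refine ⟨fun h => ?_, fun h x hx => ?_⟩
    · exact hy.openConicModule_eq (𝕜 := 𝕜) hC I.point_mem_openFace ▸ h _ I.point_mem_openFace
    · rwa [hy.openConicModule_eq hC hx]
  ext τ
  constructor
  · rintro ⟨hτ, hcodim, h⟩
    obtain ⟨I, rfl⟩ := (hC.isCell_iff hΔ hv).1 hτ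
    exact ⟨⟨⟨I, I.hasCodim_openFace_iff.1 hcodim⟩, (hequiv I).1 h⟩, rfl⟩
  · rintro ⟨⟨⟨I, hcodim⟩, h⟩, rfl⟩
    exact ⟨(hC.isCell_iff hΔ hv).2 ⟨I, rfl⟩, I.hasCodim_openFace_iff.2 hcodim, (hequiv I).2 h⟩

theorem ncard_cellsOfType (hΔ : IsChamber L C Δ) (hv : v ∈ Δ) :
    (cellsOfType 𝕜 L C Δ v' k).ncard =
      Nat.card {I : (chamberPolyhedron L C v).FaceOfCodim k // Equivalent L C (y I) v'} := by
  rw [hy.cellsOfType_eq_range hC hΔ hv]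
  exact Set.ncard_range_of_injective <| RelPolyhedron.Face.openFace_injective.comp <|
    Subtype.val_injective.comp Subtype.val_injective

end IsCellPoint

end CountCells

end Toric

end

theorem proposition6p5 {𝕜 : Type*} [Field 𝕜]
    {V : Type*} [NormedAddCommGroup V] [NormedSpace ℝ V] [FiniteDimensional ℝ V]
    (L : Submodule ℤ V) [DiscreteTopology L] [IsZLattice ℝ L]
    (C : PointedCone ℝ V) (hC : Toric.IsToricCone L C)
    {ι : Type} [Finite ι] (w : ι → V) (hw : Toric.IsComplete 𝕜 L C w)
    (Δ Δ' : Set V) (hΔ : Toric.IsChamber L C Δ) (hΔ' : Toric.IsChamber L C Δ')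
    (v : V) (hv : v ∈ Δ) (v' : V) (hv' : v' ∈ Δ') (i : ℕ) :
    (Toric.cellsOfType 𝕜 L C Δ v' i).Finite ∧
    Module.rank 𝕜 (CategoryTheory.Abelian.Ext (Toric.simpleModule 𝕜 L C w v)
        (Toric.simpleModule 𝕜 L C w v') i) =
      ((Toric.cellsOfType 𝕜 L C Δ v' i).ncard : Cardinal) := by
  have := hC.finite_primitiveNormals.to_subtype
  obtain ⟨y, hy⟩ := hC.exists_isCellPoint v
  refine ⟨?_, ?_⟩
  · rw [hy.cellsOfType_eq_range hC hΔ hv]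
    exact Set.finite_range _
  · obtain ⟨e⟩ := Toric.nonempty_ext_simpleModule hC hy hw v' i
    rw [e.rank_eq, Toric.rank_hom_cellModule hC hw, hy.ncard_cellsOfType hC hΔ hv]
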